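/- Let $N\ge 1$ and $0\le m\le N$ be integers, let $0<\gamma<N$ and $0<\alpha<\frac{2}{\gamma+m}$, and let $a\in\{1,-1\}$. Let $\Omega=\{x\in\mathbb R^N : x_1>0,\dots,x_m>0\}$ and let $C_0(\Omega)$ be the space of continuous functions on $\overline\Omega$ that vanish on $\partial\Omega$ and at infinity. Let $e^{t\Delta_\Omega}f(x)=\int_\Omega K_t(x,y)f(y)\,dy$ with $$K_t(x,y)=(4\pi t)^{-N/2}\prod_{j=m+1}^N e^{-|x_j-y_j|^2/4t}\prod_{i=1}^m\left[e^{-|x_i-y_i|^2/4t}-e^{-|x_i+y_i|^2/4t}\right]$$ be the Dirichlet heat semigroup on $\Omega$. Put $$\psi_0(x)=\gamma(\gamma+2)\cdots(\gamma+2m-2)\,x_1\cdots x_m|x|^{-\gamma-2m}\quad(x\in\Omega),\qquad \Psi(t)=e^{t\Delta_\Omega}\psi_0$$ (for $m=0$, $\psi_0(x)=|x|^{-\gamma}$). Let $\mathcal X$ be the space of $\psi\in L^1_{\rm loc}(\Omega)$ with $\|\psi\|_{\mathcal X}:=\|\psi/\psi_0\|_{L^\infty(\Omega)}<\infty$. For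 $\psi\in\mathcal X$ and $0<S\le\infty$, a solution on $(0,S)$ with initial value $\psi$ is a function $u\in C((0,S);C_0(\Omega))$ with $$u(t)=e^{t\Delta_\Omega}\psi+a\int_0^t e^{(t-\sigma)\Delta_\Omega}\big(|u(\sigma)|^\alpha u(\sigma)\big)\,d\sigma,\qquad 0<t<S,$$ the integral being absolutely convergent in $C_0(\Omega)$, such that $|u(t,x)|\le M'\Psi(t,x)$ for all $0<t\le\tau$ and $x\in\Omega$, for some $M'>0$ and some $\tau\in(0,S)$. Let $T_{\max}(\psi)\in[0,\infty]$ be the supremum of all $S$ for which such a solution exists. Let $K,M,T>0$ satisfy $$K+2(\alpha+1)M^{\alpha+1}\int_0^T\|\Psi(\sigma)\|_{L^\infty(\Omega)}^\alpha d\sigma\le M,\qquad 2(\alpha+1)M^\alpha\int_0^T\|\Psi(\sigma)\|_{L^\infty(\Omega)}^\alpha d\sigma<1,$$ and let $\psi\in\mathcal X$ with $\|\psi\|_{\mathcal X}\le K$. Then $T<T_{\max}(\psi)$ and there is a solution $u$ on $(0,T_{\max}(\psi))$ with initial value $\psi$, satisfying $|u(t)|\le M\Psi(t)$ on $\Omega$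 for $0<t\le T$, which is the unique maximal one: every solution with initial value $\psi$, on any interval $(0,S)$, is the restriction of $u$. Moreover: (i) If $a=-1$, then $T_{\max}(\psi)=\infty$. (ii) If $a=1$, then there exists $c>0$ such that $$\lambda^{\left(\frac1\alpha-\frac{\gamma+m}2\right)^{-1}}\,T_{\max}(\lambda\psi)>c\qquad\text{for all }\lambda>0.$$ (iii) If $a=1$, then $T_{\max}(\psi_0)<\infty$, and $$\lambda^{\left(\frac1\alpha-\frac{\gamma+m}2\right)^{-1}}\,T_{\max}(\lambda\psi_0)=T_{\max}(\psi_0)\qquad\text{for all }\lambda>0.$$ -/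

import Mathlib

open MeasureTheory Set
open scoped ENNReal ZeroAtInfty

noncomputable section

namespace SectorHeat

/-- The sector `Ω = {x ∈ ℝ^N : x₁ > 0, …, x_m > 0}` (all of `ℝ^N` if `m = 0`). -/
def sector (N m : ℕ) : Set (EuclideanSpace ℝ (Fin N)) :=
  {x | ∀ i : Fin N, i.val < m → 0 < x i}

/-- Lebesgue measure on the sector. -/
instance (N m : ℕ) : MeasureSpace (sector N m) := Measure.Subtype.measureSpace

/-- The Dirichlet heat kernel `K_t(x, y)` of the sector. -/
def kernel (N m : ℕ) (t : ℝ) (x y : EuclideanSpace ℝ (Fin N)) : ℝ :=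
  (4 * Real.pi * t) ^ (-(N : ℝ) / 2) *
    ∏ i : Fin N,
      if i.val < m then
        Real.exp (-(x i - y i) ^ 2 / (4 * t)) - Real.exp (-(x i + y i) ^ 2 / (4 * t))
      else Real.exp (-(x i - y i) ^ 2 / (4 * t))

/-- The heat semigroup on the sector, `(e^{tΔ_Ω} f)(x) = ∫_Ω K_t(x, y) f(y) dy`. -/
def heat (N m : ℕ) (t : ℝ) (f : sector N m → ℝ) (x : sector N m) : ℝ :=
  ∫ y : sector N m, kernel N m t x y * f y

/-- `ψ₀(x) = γ (γ + 2) ⋯ (γ + 2m - 2) x₁ ⋯ x_m |x|^{-γ-2m}` on the sector. -/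
def psi0 (N m : ℕ) (γ : ℝ) (x : sector N m) : ℝ :=
  (∏ k ∈ Finset.range m, (γ + 2 * (k : ℝ))) *
    (∏ i : Fin N, if i.val < m then (x : EuclideanSpace ℝ (Fin N)) i else 1) *
    ‖(x : EuclideanSpace ℝ (Fin N))‖ ^ (-γ - 2 * (m : ℝ))

/-- The norm `‖ψ / ψ₀‖_{L^∞(Ω)}`, as an extended nonnegative number. -/
def xNorm (N m : ℕ) (γ : ℝ) (ψ : sector N m → ℝ) : ℝ≥0∞ :=
  eLpNorm (fun x => ψ x / psi0 N m γ x) ⊤ volume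

/-- The closed ball `B_K = {ψ ∈ L¹_loc(Ω) : ‖ψ / ψ₀‖_{L^∞(Ω)} ≤ K}`. -/
def ball (N m : ℕ) (γ K : ℝ) : Set (sector N m → ℝ) :=
  {ψ | LocallyIntegrable ψ volume ∧ xNorm N m γ ψ ≤ ENNReal.ofReal K}

/-- `Ψ(t) = e^{tΔ_Ω} ψ₀`. -/
def Psi (N m : ℕ) (γ t : ℝ) : sector N m → ℝ :=
  heat N m t (psi0 N m γ)

/-- `∫₀ᵀ ‖Ψ(σ)‖_{L^∞(Ω)}^α dσ`, as an extended nonnegative number. -/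
def PsiIntegral (N m : ℕ) (γ α T : ℝ) : ℝ≥0∞ :=
  ∫⁻ σ in Ioc 0 T, (eLpNorm (Psi N m γ σ) ⊤ volume) ^ α

/-- The nonlinearity `|v|^α v`. -/
def nonlin {X : Type*} (α : ℝ) (v : X → ℝ) (x : X) : ℝ :=
  |v x| ^ α * v x

/-- `u` is a solution on `(0, S)`, `0 < S ≤ ∞`, of
`u(t) = e^{tΔ_Ω} ψ + a ∫₀ᵗ e^{(t-σ)Δ_Ω} (|u(σ)|^α u(σ)) dσ`,
continuous from `(0, S)` to `C₀(Ω)` and bounded by a multiple of `Ψ` on some `(0, τ]`.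
Since `Ω` is open, Mathlib's `C₀(Ω, ℝ)` (limit `0` along the complements of compact subsets of `Ω`)
consists of the restrictions to `Ω` of the continuous functions on the closure of `Ω` which vanish
on the boundary and at infinity, with the supremum norm. -/
structure IsSolution (N m : ℕ) (γ α a : ℝ) (ψ : sector N m → ℝ) (S : ℝ≥0∞)
    (u : ℝ → C₀(sector N m, ℝ)) : Prop where
  continuousOn : ContinuousOn u {t | 0 < t ∧ ENNReal.ofReal t < S}
  bound : ∃ τ M : ℝ, 0 < τ ∧ ENNReal.ofReal τ < S ∧
    ∀ t ∈ Ioc 0 τ, ∀ x, |u t x| ≤ M * Psi N m γ t x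
  absConv : ∀ t, 0 < t → ENNReal.ofReal t < S →
    ∫⁻ σ in Ioo 0 t, eLpNorm (heat N m (t - σ) (nonlin α (u σ))) ⊤ volume < ⊤
  eqn : ∀ t, 0 < t → ENNReal.ofReal t < S → ∀ x,
    u t x = heat N m t ψ x + a * ∫ σ in Ioo 0 t, heat N m (t - σ) (nonlin α (u σ)) x

/-- `u`, on `(0, S)`, is the maximal solution with initial value `ψ`: every solution with this
initial value lives on a smaller or equal interval and coincides with `u` there. -/
structure IsMaximalSolution (N m : ℕ) (γ α a : ℝ) (ψ : sector N m → ℝ) (S : ℝ≥0∞)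
    (u : ℝ → C₀(sector N m, ℝ)) : Prop where
  isSolution : IsSolution N m γ α a ψ S u
  le_of_solution : ∀ S' v, IsSolution N m γ α a ψ S' v → S' ≤ S
  eq_of_solution : ∀ S' v, IsSolution N m γ α a ψ S' v →
    ∀ t, 0 < t → ENNReal.ofReal t < S' → v t = u t

/-- The maximal existence time `T_max(ψ) ∈ [0, ∞]`. -/
def Tmax (N m : ℕ) (γ α a : ℝ) (ψ : sector N m → ℝ) : ℝ≥0∞ :=
  sSup {S | ∃ u, IsSolution N m γ α a ψ S u}

end SectorHeat

end

open SectorHeat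

noncomputable section

namespace SectorHeat

/-! The argument is a contraction in a weighted sup norm, with the linear solution `Psi` as weight.
The semigroup carries a function bounded by `k * Psi σ` to one bounded by `k * Psi t` after time `t
- σ`. Homogeneity of `psi0` gives `‖Psi t‖ = t ^ (-β) * ‖Psi 1‖` with `β = (γ + m) / 2`. In the
Duhamel term one factor `Psi` is kept as weight and the other `α` are estimated in sup norm, so
everything reduces to the integral of `σ ^ (-(α * β))`, which is finite because `α * β < 1`.
`IsWeight` isolates these two properties; they also hold for the constant weight with exponent `0`,
so one existence lemma (`exists_isMild`) and one uniqueness lemma (`IsMild.eq_of_lt_one`) serve both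
the singular time `0` and restarts from `C₀` data.

The linear input is that `e^{tΔ} ψ₀` exists and lies in `C₀`. Near the origin `ψ₀` may fail to be
integrable, but the kernel vanishes linearly in each `y_i` with `i < m` (`kernel_le_prod`), and `y₁
⋯ y_m ψ₀` is bounded by a multiple of `|y|^{-γ}`, which is locally integrable since `γ < N`.

Uniqueness holds near `0` in the weight `Psi` and propagates by steps of fixed length in the weight
`1`; solutions then glue to a maximal one. Since the length of a continuation step depends only on
the sup norm, a solution of bounded norm is global (`Tmax_eq_top_of_bounded`).

For `a = -1` the norm does not increase: `u(t+h)` is `e^{hΔ}(u - h|u|^α u)` up to `o(h)`, and the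
map `u ↦ u - h|u|^α u` does not enlarge the norm for small `h`. The lower bound for `Tmax` of `λψ`
comes from local existence with `M = 2λK` and the largest admissible order of `T`. The exact law for
`λψ₀` is the scaling `u ↦ c^{2/α} u(c² t, c x)`, used with `c` and with `1 / c`.

For blow-up, positivity and Jensen's inequality show that `g(r) = (e^{(t-r)Δ} u(r))(x)` satisfies
`g' ≥ g^{α+1}`, whence `α t ≤ Psi(t,x)^{-α}` as long as the solution lives. At `x = √t x₁` the right
side is a constant times `t^{αβ}`, and `αβ < 1` bounds `t`. -/

/-! ### The heat kernel -/

/-- The Gauss–Weierstrass kernel on `ℝ^N`. -/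
def gauss (N : ℕ) (t : ℝ) (z : EuclideanSpace ℝ (Fin N)) : ℝ :=
  (4 * Real.pi * t) ^ (-(N : ℝ) / 2) * Real.exp (-‖z‖ ^ 2 / (4 * t))

/-- The closure of the sector. -/
def closedSector (N m : ℕ) : Set (EuclideanSpace ℝ (Fin N)) :=
  {x | ∀ i : Fin N, i.val < m → 0 ≤ x i}

theorem sector_subset_closedSector (N m : ℕ) : sector N m ⊆ closedSector N m :=
  fun _ hx i hi => (hx i hi).le

theorem isOpen_sector (N m : ℕ) : IsOpen (sector N m) := by
  have : sector N m = ⋂ i : Fin N, {x | i.val < m → 0 < x i} := by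
    ext x; simp [sector]
  rw [this]
  refine isOpen_iInter_of_finite fun i => ?_
  by_cases hi : i.val < m
  · simp only [hi, true_imp_iff]
    exact isOpen_lt continuous_const (by fun_prop)
  · simp [hi]

theorem isClosed_closedSector (N m : ℕ) : IsClosed (closedSector N m) := by
  have : closedSector N m = ⋂ i : Fin N, {x | i.val < m → 0 ≤ x i} := by
    ext x; simp [closedSector]
  rw [this]
  refine isClosed_iInter fun i => ?_
  by_cases hi : i.val < m
  · simp only [hi, true_imp_iff]
    exact isClosed_le continuous_const (by fun_prop)
  · simp [hi]

theorem measurableSet_sector (N m : ℕ) : MeasurableSet (sector N m) :=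
  (isOpen_sector N m).measurableSet

theorem measurableEmbedding_coe (N m : ℕ) :
    MeasurableEmbedding ((↑) : sector N m → EuclideanSpace ℝ (Fin N)) :=
  MeasurableEmbedding.subtype_coe (measurableSet_sector N m)

theorem map_volume_sector (N m : ℕ) :
    (volume : Measure (sector N m)).map (↑) = volume.restrict (sector N m) :=
  map_comap_subtype_coe (measurableSet_sector N m) _

instance (N m : ℕ) : SigmaFinite (volume : Measure (sector N m)) := by
  have : SigmaFinite ((volume : Measure (sector N m)).map Subtype.val) := by
    rw [map_volume_sector]; infer_instance
  exact this.of_map _ (measurableEmbedding_coe N m).measurable.aemeasurable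

instance (N m : ℕ) : (volume : Measure (sector N m)).IsOpenPosMeasure :=
  Measure.IsOpenPosMeasure.comap _ (isOpen_sector N m).isOpenEmbedding_subtypeVal

theorem integrable_sector_iff {N m : ℕ} {f : EuclideanSpace ℝ (Fin N) → ℝ} :
    Integrable (fun y : sector N m => f y) ↔ IntegrableOn f (sector N m) := by
  rw [IntegrableOn, ← map_volume_sector, (measurableEmbedding_coe N m).integrable_map_iff]
  rfl

theorem integral_sector {N m : ℕ} (f : EuclideanSpace ℝ (Fin N) → ℝ) :
    ∫ y : sector N m, f y = ∫ y in sector N m, f y :=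
  integral_subtype (measurableSet_sector N m) f

theorem gauss_pos {N : ℕ} {t : ℝ} (ht : 0 < t) (z : EuclideanSpace ℝ (Fin N)) :
    0 < gauss N t z := by
  unfold gauss; positivity

theorem continuous_gauss (N : ℕ) (t : ℝ) : Continuous (gauss N t) := by
  unfold gauss; fun_prop

theorem gauss_le {N : ℕ} {t : ℝ} (ht : 0 < t) (z : EuclideanSpace ℝ (Fin N)) :
    gauss N t z ≤ (4 * Real.pi * t) ^ (-(N : ℝ) / 2) := by
  unfold gauss
  refine mul_le_of_le_one_right (by positivity) (Real.exp_le_one_iff.2 ?_)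
  rw [neg_div, neg_nonpos]; positivity

theorem integral_gauss {N : ℕ} {t : ℝ} (ht : 0 < t) : ∫ z, gauss N t z = 1 := by
  have h : ∀ z : EuclideanSpace ℝ (Fin N), gauss N t z =
      (4 * Real.pi * t) ^ (-(N : ℝ) / 2) * Real.exp (-(1 / (4 * t)) * ‖z‖ ^ 2) := by
    intro z; unfold gauss; congr 2; field_simp
  simp_rw [h]
  rw [integral_const_mul, GaussianFourier.integral_rexp_neg_mul_sq_norm (by positivity),
    finrank_euclideanSpace, Fintype.card_fin, show Real.pi / (1 / (4 * t)) = 4 * Real.pi * t by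
      field_simp, ← Real.rpow_add (by positivity)]
  rw [show -(N : ℝ) / 2 + N / 2 = 0 by ring, Real.rpow_zero]

theorem integrable_gauss {N : ℕ} {t : ℝ} (ht : 0 < t) : Integrable (gauss N t) := by
  by_contra h
  have := integral_gauss (N := N) ht
  rw [integral_undef h] at this
  exact zero_ne_one this

theorem exp_neg_norm_sq {N : ℕ} (b : ℝ) (z : EuclideanSpace ℝ (Fin N)) :
    Real.exp (-‖z‖ ^ 2 / b) = ∏ i, Real.exp (-(z i) ^ 2 / b) := by
  rw [← Real.exp_sum, EuclideanSpace.norm_sq_eq]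
  congr 1
  simp [neg_div, Finset.sum_div]

/-- The kernel of the sector is the Gaussian times boundary correction factors. -/
theorem kernel_eq {N m : ℕ} {t : ℝ} (ht : 0 < t) (x y : EuclideanSpace ℝ (Fin N)) :
    kernel N m t x y = gauss N t (x - y) *
      ∏ i : Fin N, if i.val < m then 1 - Real.exp (-(x i * y i) / t) else 1 := by
  unfold kernel gauss
  rw [exp_neg_norm_sq, mul_assoc ((4 * Real.pi * t) ^ (-(N : ℝ) / 2)), ← Finset.prod_mul_distrib]
  congr 1
  refine Finset.prod_congr rfl fun i _ => ?_
  split_ifs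
  · rw [mul_sub, ← Real.exp_add]
    simp only [PiLp.sub_apply, mul_one]
    congr 2
    field_simp
    ring
  · simp

theorem correction_mem {N m : ℕ} {t : ℝ} (ht : 0 < t) {x y : EuclideanSpace ℝ (Fin N)}
    (hx : x ∈ closedSector N m) (hy : y ∈ closedSector N m) (i : Fin N) :
    0 ≤ (if i.val < m then 1 - Real.exp (-(x i * y i) / t) else 1) ∧
      (if i.val < m then 1 - Real.exp (-(x i * y i) / t) else 1) ≤ 1 := by
  split_ifs with hi
  · have h1 : Real.exp (-(x i * y i) / t) ≤ 1 := by
      rw [Real.exp_le_one_iff, neg_div, neg_nonpos]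
      exact div_nonneg (mul_nonneg (hx i hi) (hy i hi)) ht.le
    have h2 := Real.exp_pos (-(x i * y i) / t)
    constructor <;> linarith
  · simp

theorem kernel_nonneg {N m : ℕ} {t : ℝ} (ht : 0 < t) {x y : EuclideanSpace ℝ (Fin N)}
    (hx : x ∈ closedSector N m) (hy : y ∈ closedSector N m) : 0 ≤ kernel N m t x y := by
  rw [kernel_eq ht]
  exact mul_nonneg (gauss_pos ht _).le
    (Finset.prod_nonneg fun i _ => (correction_mem ht hx hy i).1)

theorem kernel_pos {N m : ℕ} {t : ℝ} (ht : 0 < t) {x y : EuclideanSpace ℝ (Fin N)}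
    (hx : x ∈ sector N m) (hy : y ∈ sector N m) : 0 < kernel N m t x y := by
  rw [kernel_eq ht]
  refine mul_pos (gauss_pos ht _) (Finset.prod_pos fun i _ => ?_)
  split_ifs with hi
  · rw [sub_pos, Real.exp_lt_one_iff, neg_div, neg_lt_zero]
    exact div_pos (mul_pos (hx i hi) (hy i hi)) ht
  · exact one_pos

theorem kernel_le_gauss {N m : ℕ} {t : ℝ} (ht : 0 < t) {x y : EuclideanSpace ℝ (Fin N)}
    (hx : x ∈ closedSector N m) (hy : y ∈ closedSector N m) :
    kernel N m t x y ≤ gauss N t (x - y) := by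
  rw [kernel_eq ht]
  exact mul_le_of_le_one_right (gauss_pos ht _).le
    (Finset.prod_le_one (fun i _ => (correction_mem ht hx hy i).1)
      fun i _ => (correction_mem ht hx hy i).2)

theorem kernel_symm (N m : ℕ) (t : ℝ) (x y : EuclideanSpace ℝ (Fin N)) :
    kernel N m t x y = kernel N m t y x := by
  unfold kernel
  congr 1
  refine Finset.prod_congr rfl fun i _ => ?_
  rw [show (x i - y i) ^ 2 = (y i - x i) ^ 2 by ring, add_comm (x i)]

theorem continuous_kernel (N m : ℕ) (t : ℝ) :
    Continuous fun p : EuclideanSpace ℝ (Fin N) × EuclideanSpace ℝ (Fin N) =>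
      kernel N m t p.1 p.2 := by
  unfold kernel
  refine continuous_const.mul (continuous_finsetProd _ fun i _ => ?_)
  split_ifs <;> fun_prop

theorem kernel_eq_zero {N m : ℕ} (t : ℝ) {x : EuclideanSpace ℝ (Fin N)} {i : Fin N}
    (hi : i.val < m) (hx : x i = 0) (y : EuclideanSpace ℝ (Fin N)) : kernel N m t x y = 0 := by
  unfold kernel
  rw [Finset.prod_eq_zero (Finset.mem_univ i), mul_zero]
  simp [hi, hx]

/-! ### Reflections, and Gaussian bounds for the kernel of the sector. -/

/-- Reflection of the `i`-th coordinate. -/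
def reflect {N : ℕ} (i : Fin N) (x : EuclideanSpace ℝ (Fin N)) : EuclideanSpace ℝ (Fin N) :=
  x - EuclideanSpace.single i (2 * x i)

theorem reflect_apply_self {N : ℕ} (i : Fin N) (x : EuclideanSpace ℝ (Fin N)) :
    reflect i x i = -x i := by
  simp [reflect]; ring

theorem gauss_reflect {N : ℕ} {t : ℝ} (ht : 0 < t) (i : Fin N) (x y : EuclideanSpace ℝ (Fin N)) :
    gauss N t (reflect i x - y) = gauss N t (x - y) * Real.exp (-(x i * y i) / t) := by
  have h : ‖reflect i x - y‖ ^ 2 = ‖x - y‖ ^ 2 + 4 * (x i * y i) := by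
    rw [EuclideanSpace.norm_sq_eq, EuclideanSpace.norm_sq_eq,
      ← Finset.add_sum_erase _ _ (Finset.mem_univ i), ← Finset.add_sum_erase _ _ (Finset.mem_univ i)]
    have : ∑ j ∈ Finset.univ.erase i, ‖(reflect i x - y) j‖ ^ 2 =
        ∑ j ∈ Finset.univ.erase i, ‖(x - y) j‖ ^ 2 := by
      refine Finset.sum_congr rfl fun j hj => ?_
      have hj' : j ≠ i := Finset.ne_of_mem_erase hj
      simp [reflect, hj']
    rw [this]
    simp only [PiLp.sub_apply, reflect_apply_self, Real.norm_eq_abs, sq_abs]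
    ring
  unfold gauss
  rw [h, mul_assoc ((4 * Real.pi * t) ^ (-(N : ℝ) / 2)), ← Real.exp_add]
  congr 2
  field_simp
  ring

theorem one_sub_sum_le_prod_one_sub' {ι : Type*} (s : Finset ι) (b : ι → ℝ)
    (h0 : ∀ i, 0 ≤ b i) (h1 : ∀ i, b i ≤ 1) : 1 - ∑ i ∈ s, b i ≤ ∏ i ∈ s, (1 - b i) := by
  classical
  induction s using Finset.induction_on with
  | empty => simp
  | insert i s hi ih =>
    rw [Finset.sum_insert hi, Finset.prod_insert hi]
    have hp : ∏ j ∈ s, (1 - b j) ≤ 1 :=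
      Finset.prod_le_one (fun j _ => by linarith [h1 j]) fun j _ => by linarith [h0 j]
    nlinarith [h0 i, h1 i]

/-- The product of the corrections `1 - b_i` is at least `1 - ∑ b_i`, and by `gauss_reflect` each
`b_i` times the Gaussian is the Gaussian seen from the reflected point. -/
theorem gauss_sub_kernel_le {N m : ℕ} {t : ℝ} (ht : 0 < t) {x y : EuclideanSpace ℝ (Fin N)}
    (hx : x ∈ closedSector N m) (hy : y ∈ closedSector N m) :
    gauss N t (x - y) - kernel N m t x y ≤
      ∑ i : Fin N, if i.val < m then gauss N t (reflect i x - y) else 0 := by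
  have h := one_sub_sum_le_prod_one_sub' Finset.univ
    (fun i : Fin N => if i.val < m then Real.exp (-(x i * y i) / t) else 0)
    (fun i => by split_ifs <;> positivity) (fun i => by
      have := (correction_mem ht hx hy i).1
      split_ifs at this ⊢ <;> linarith)
  have h2 : ∀ i : Fin N, 1 - (if i.val < m then Real.exp (-(x i * y i) / t) else 0) =
      if i.val < m then 1 - Real.exp (-(x i * y i) / t) else 1 := by
    intro i; split_ifs <;> simp
  simp_rw [h2] at h
  have h3 : (∑ i : Fin N, if i.val < m then gauss N t (reflect i x - y) else 0) =
      gauss N t (x - y) * ∑ i : Fin N, if i.val < m then Real.exp (-(x i * y i) / t) else 0 := by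
    rw [Finset.mul_sum]
    refine Finset.sum_congr rfl fun i _ => ?_
    split_ifs
    · rw [gauss_reflect ht]
    · simp
  rw [h3, kernel_eq ht]
  nlinarith [gauss_pos ht (x - y)]

/-- Doubling the time uses half of the exponent; the spare factor `exp (-‖z‖ ^ 2 / (8 * t))` absorbs
polynomial growth in `‖z‖ / √t`. -/
theorem gauss_eq_gauss_two {N : ℕ} {t : ℝ} (ht : 0 < t) (z : EuclideanSpace ℝ (Fin N)) :
    gauss N t z = 2 ^ ((N : ℝ) / 2) * gauss N (2 * t) z * Real.exp (-‖z‖ ^ 2 / (8 * t)) := by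
  unfold gauss
  have h : (4 * Real.pi * (2 * t)) ^ (-(N : ℝ) / 2) =
      2 ^ (-(N : ℝ) / 2) * (4 * Real.pi * t) ^ (-(N : ℝ) / 2) := by
    rw [← Real.mul_rpow (by positivity) (by positivity)]; congr 1; ring
  have h2 : (2 : ℝ) ^ ((N : ℝ) / 2) * 2 ^ (-(N : ℝ) / 2) = 1 := by
    rw [← Real.rpow_add two_pos, show (N : ℝ) / 2 + -N / 2 = 0 by ring, Real.rpow_zero]
  have h3 : Real.exp (-‖z‖ ^ 2 / (4 * t)) =
      Real.exp (-‖z‖ ^ 2 / (4 * (2 * t))) * Real.exp (-‖z‖ ^ 2 / (8 * t)) := by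
    rw [← Real.exp_add]; congr 1; field_simp; ring
  rw [h, h3]
  linear_combination (-(4 * Real.pi * t) ^ (-(N : ℝ) / 2) *
    (Real.exp (-‖z‖ ^ 2 / (4 * (2 * t))) * Real.exp (-‖z‖ ^ 2 / (8 * t)))) * h2

theorem gauss_mul_norm_sq_le {N : ℕ} {t : ℝ} (ht : 0 < t) (z : EuclideanSpace ℝ (Fin N)) :
    gauss N t z * ‖z‖ ^ 2 ≤ 8 * t * 2 ^ ((N : ℝ) / 2) * gauss N (2 * t) z := by
  rw [gauss_eq_gauss_two ht]
  have h := Real.add_one_le_exp (‖z‖ ^ 2 / (8 * t))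
  have h1 : Real.exp (-‖z‖ ^ 2 / (8 * t)) * ‖z‖ ^ 2 ≤ 8 * t := by
    have h2 : ‖z‖ ^ 2 ≤ 8 * t * Real.exp (‖z‖ ^ 2 / (8 * t)) := by
      have : ‖z‖ ^ 2 = 8 * t * (‖z‖ ^ 2 / (8 * t)) := by field_simp
      nlinarith
    rw [neg_div, Real.exp_neg, inv_mul_le_iff₀ (Real.exp_pos _)]
    linarith
  have h4 := gauss_pos (N := N) (show 0 < 2 * t by positivity) z
  have h5 : (0 : ℝ) < 2 ^ ((N : ℝ) / 2) := by positivity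
  nlinarith [mul_pos h5 h4]

/-- For `y ≥ √t` the left side is at most `1`. Otherwise `1 - exp (-(x * y) / t) ≤ x * y / t` with
`x ≤ √t + |x - y|`, and the exponential absorbs `|x - y| / √t` at the cost of the constant `2`;
hence `3 = 1 + 2`. -/
theorem exp_mul_one_sub_exp_le {t : ℝ} (ht : 0 < t) {x y : ℝ} (hy : 0 ≤ y) :
    Real.exp (-(x - y) ^ 2 / (8 * t)) * (1 - Real.exp (-(x * y) / t)) ≤ 3 / √t * y := by
  have hs : 0 < √t := Real.sqrt_pos.2 ht
  have hst : √t * √t = t := Real.mul_self_sqrt ht.le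
  have he1 : Real.exp (-(x - y) ^ 2 / (8 * t)) ≤ 1 := by
    rw [Real.exp_le_one_iff, neg_div, neg_nonpos]; positivity
  have he0 := Real.exp_pos (-(x - y) ^ 2 / (8 * t))
  have hf0 := Real.exp_pos (-(x * y) / t)
  have hf1 : 1 - Real.exp (-(x * y) / t) ≤ x * y / t := by
    have := Real.add_one_le_exp (-(x * y) / t)
    rw [neg_div] at this ⊢; linarith
  rcases le_total (√t) y with h | h
  · have : 1 ≤ y / √t := by rwa [one_le_div hs]
    have h2 : 3 / √t * y = 3 * (y / √t) := by ring
    rw [h2]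
    nlinarith
  · set r := |x - y| with hr
    have hxr : x ≤ √t + r := by
      have := le_abs_self (x - y); linarith
    have hrr : Real.exp (-(x - y) ^ 2 / (8 * t)) * (r / √t) ≤ 2 := by
      rw [neg_div, Real.exp_neg, inv_mul_le_iff₀ (Real.exp_pos _)]
      have h1 := Real.add_one_le_exp ((x - y) ^ 2 / (8 * t))
      have h2 : (x - y) ^ 2 / (8 * t) = (r / √t) ^ 2 / 8 := by
        rw [div_pow, Real.sq_sqrt ht.le, hr, sq_abs]; field_simp
      rw [h2] at h1 ⊢
      nlinarith [sq_nonneg (r / √t - 4)]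
    have h3 : x * y / t ≤ (1 + r / √t) * (y / √t) := by
      have : (1 + r / √t) * (y / √t) = (√t + r) * y / t := by
        field_simp
        rw [Real.sq_sqrt ht.le]
        ring
      rw [this]; gcongr
    calc _ ≤ Real.exp (-(x - y) ^ 2 / (8 * t)) * ((1 + r / √t) * (y / √t)) := by
          gcongr; exact hf1.trans h3
      _ = (Real.exp (-(x - y) ^ 2 / (8 * t)) + Real.exp (-(x - y) ^ 2 / (8 * t)) * (r / √t)) *
          (y / √t) := by ring
      _ ≤ (1 + 2) * (y / √t) := by gcongr
      _ = 3 / √t * y := by ring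

/-- This linear vanishing at the walls `y_i = 0` compensates the extra singularity of `ψ₀` at the
origin. -/
theorem kernel_le_prod {N m : ℕ} {t : ℝ} (ht : 0 < t) {x y : EuclideanSpace ℝ (Fin N)}
    (hx : x ∈ closedSector N m) (hy : y ∈ closedSector N m) :
    kernel N m t x y ≤ 2 ^ ((N : ℝ) / 2) * gauss N (2 * t) (x - y) *
      ∏ i : Fin N, if i.val < m then 3 / √t * y i else 1 := by
  rw [kernel_eq ht, gauss_eq_gauss_two ht, mul_assoc, exp_neg_norm_sq, ← Finset.prod_mul_distrib]
  have hg := gauss_pos (N := N) (show 0 < 2 * t by positivity) (x - y)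
  refine mul_le_mul_of_nonneg_left (Finset.prod_le_prod (fun i _ => ?_) fun i _ => ?_)
    (by positivity)
  · exact mul_nonneg (Real.exp_pos _).le (correction_mem ht hx hy i).1
  · split_ifs with hi
    · exact exp_mul_one_sub_exp_le ht (hy i hi)
    · rw [mul_one, Real.exp_le_one_iff, neg_div, neg_nonpos]; positivity

/-! ### The Chapman–Kolmogorov identity -/

theorem integral_exp_mul_exp {t s : ℝ} (ht : 0 < t) (hs : 0 < s) (x y : ℝ) :
    Integrable (fun z => Real.exp (-(x - z) ^ 2 / (4 * t)) * Real.exp (-(z - y) ^ 2 / (4 * s))) ∧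
    ∫ z, Real.exp (-(x - z) ^ 2 / (4 * t)) * Real.exp (-(z - y) ^ 2 / (4 * s)) =
      √(4 * Real.pi * (t * s / (t + s))) * Real.exp (-(x - y) ^ 2 / (4 * (t + s))) := by
  set b := (t + s) / (4 * t * s) with hb
  set w := (s * x + t * y) / (t + s) with hw
  have hb0 : 0 < b := by positivity
  have h : ∀ z, Real.exp (-(x - z) ^ 2 / (4 * t)) * Real.exp (-(z - y) ^ 2 / (4 * s)) =
      Real.exp (-(x - y) ^ 2 / (4 * (t + s))) * Real.exp (-b * (z - w) ^ 2) := by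
    intro z
    rw [← Real.exp_add, ← Real.exp_add]
    congr 1
    rw [hb, hw]
    field_simp
    ring
  simp_rw [h]
  constructor
  · exact ((integrable_exp_neg_mul_sq hb0).comp_sub_right w).const_mul _
  · rw [integral_const_mul, integral_sub_right_eq_self (fun z => Real.exp (-b * z ^ 2)) w,
      integral_gaussian, mul_comm]
    congr 2
    rw [hb]; field_simp

/-- The half-line Dirichlet heat kernel, up to normalisation. -/
def halfKernel (t x y : ℝ) : ℝ :=
  Real.exp (-(x - y) ^ 2 / (4 * t)) - Real.exp (-(x + y) ^ 2 / (4 * t))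

/-- Both factors are odd in `z`, so the product is even and the integral is half of the one over the
line, where it splits into four Gaussian convolutions. -/
theorem integral_halfKernel_mul {t s : ℝ} (ht : 0 < t) (hs : 0 < s) (x y : ℝ) :
    ∫ z in Ioi (0 : ℝ), halfKernel t x z * halfKernel s z y =
      √(4 * Real.pi * (t * s / (t + s))) * halfKernel (t + s) x y := by
  have habs : ∀ z : ℝ, halfKernel t x |z| * halfKernel s |z| y =
      halfKernel t x z * halfKernel s z y := by
    intro z
    rcases abs_choice z with h | h <;> rw [h]
    unfold halfKernel
    rw [show x - -z = x + z by ring, show x + -z = x - z by ring,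
      show (-z - y) ^ 2 = (z + y) ^ 2 by ring, show (-z + y) ^ 2 = (z - y) ^ 2 by ring]
    ring
  have h1 := integral_comp_abs (f := fun z => halfKernel t x z * halfKernel s z y)
  simp_rw [habs] at h1
  obtain ⟨i1, e1⟩ := integral_exp_mul_exp ht hs x y
  obtain ⟨i2, e2⟩ := integral_exp_mul_exp ht hs x (-y)
  obtain ⟨i3, e3⟩ := integral_exp_mul_exp ht hs (-x) y
  obtain ⟨i4, e4⟩ := integral_exp_mul_exp ht hs (-x) (-y)
  have h2 : ∀ z, halfKernel t x z * halfKernel s z y =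
      Real.exp (-(x - z) ^ 2 / (4 * t)) * Real.exp (-(z - y) ^ 2 / (4 * s)) -
      Real.exp (-(x - z) ^ 2 / (4 * t)) * Real.exp (-(z - -y) ^ 2 / (4 * s)) -
      (Real.exp (-(-x - z) ^ 2 / (4 * t)) * Real.exp (-(z - y) ^ 2 / (4 * s)) -
      Real.exp (-(-x - z) ^ 2 / (4 * t)) * Real.exp (-(z - -y) ^ 2 / (4 * s))) := by
    intro z
    unfold halfKernel
    rw [show (-x - z) ^ 2 = (x + z) ^ 2 by ring, show z - -y = z + y by ring]
    ring
  have h3 : ∫ z, halfKernel t x z * halfKernel s z y =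
      2 * (√(4 * Real.pi * (t * s / (t + s))) * halfKernel (t + s) x y) := by
    simp_rw [h2]
    have i12 := i1.sub i2
    have i34 := i3.sub i4
    simp only [Pi.sub_def] at i12 i34
    rw [integral_sub i12 i34, integral_sub i1 i2, integral_sub i3 i4,
      e1, e2, e3, e4]
    unfold halfKernel
    rw [show x - -y = x + y by ring, show (-x - y) ^ 2 = (x + y) ^ 2 by ring,
      show (-x - -y) ^ 2 = (x - y) ^ 2 by ring]
    ring
  linarith

theorem integral_kernel_mul_kernel {N m : ℕ} {t s : ℝ} (ht : 0 < t) (hs : 0 < s)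
    (x y : EuclideanSpace ℝ (Fin N)) :
    ∫ z : sector N m, kernel N m t x z * kernel N m s z y = kernel N m (t + s) x y := by
  let f : Fin N → ℝ → ℝ := fun i =>
    if i.val < m then (Ioi (0 : ℝ)).indicator fun z => halfKernel t (x i) z * halfKernel s z (y i)
    else fun z => Real.exp (-(x i - z) ^ 2 / (4 * t)) * Real.exp (-(z - y i) ^ 2 / (4 * s))
  have hf : ∀ i, ∫ z, f i z = √(4 * Real.pi * (t * s / (t + s))) *
      (if i.val < m then
        Real.exp (-(x i - y i) ^ 2 / (4 * (t + s))) - Real.exp (-(x i + y i) ^ 2 / (4 * (t + s)))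
      else Real.exp (-(x i - y i) ^ 2 / (4 * (t + s)))) := by
    intro i
    by_cases hi : i.val < m
    · simp only [f, hi, if_true]
      rw [integral_indicator measurableSet_Ioi, integral_halfKernel_mul ht hs]
      rfl
    · simp only [f, hi, if_false]
      exact (integral_exp_mul_exp ht hs _ _).2
  -- The indicator of the sector is a product of indicators of half-lines, so the whole integrand
  -- factors over the coordinates.
  have hprod : ∀ z : EuclideanSpace ℝ (Fin N),
      (sector N m).indicator (fun z => kernel N m t x z * kernel N m s z y) z =
      ((4 * Real.pi * t) ^ (-(N : ℝ) / 2) * (4 * Real.pi * s) ^ (-(N : ℝ) / 2)) *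
        ∏ i, f i (z.ofLp i) := by
    intro z
    by_cases hz : z ∈ sector N m
    · rw [indicator_of_mem hz]
      unfold kernel
      rw [mul_mul_mul_comm, ← Finset.prod_mul_distrib]
      congr 1
      refine Finset.prod_congr rfl fun i _ => ?_
      by_cases hi : i.val < m
      · have : z.ofLp i ∈ Ioi (0 : ℝ) := hz i hi
        simp only [f, hi, if_true]
        rw [indicator_of_mem this]
        rfl
      · simp only [f, hi, if_false]
    · rw [indicator_of_notMem hz]
      simp only [sector, mem_ofPred_eq, not_forall] at hz
      obtain ⟨i, hi, hzi⟩ := hz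
      rw [Finset.prod_eq_zero (Finset.mem_univ i), mul_zero]
      simp only [f, hi, if_true]
      exact indicator_of_notMem hzi _
  rw [integral_sector (fun z => kernel N m t x z * kernel N m s z y),
    ← integral_indicator (measurableSet_sector N m)]
  simp_rw [hprod]
  rw [integral_const_mul, (PiLp.volume_preserving_ofLp (Fin N)).integral_comp
    (MeasurableEquiv.toLp 2 (Fin N → ℝ)).symm.measurableEmbedding
    (fun z : Fin N → ℝ => ∏ i, f i (z i)), integral_fintype_prod_volume_eq_prod]
  simp_rw [hf]
  rw [Finset.prod_mul_distrib, Finset.prod_const, Finset.card_univ, Fintype.card_fin]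
  unfold kernel
  rw [← mul_assoc]
  congr 1
  have hts : 0 < t + s := by positivity
  rw [Real.sqrt_eq_rpow, ← Real.rpow_natCast, ← Real.rpow_mul (by positivity),
    show (1 / 2 * (N : ℝ)) = -(-(N : ℝ) / 2) by ring, Real.rpow_neg (by positivity),
    ← Real.inv_rpow (by positivity), ← Real.mul_rpow (by positivity) (by positivity),
    ← Real.mul_rpow (by positivity) (by positivity)]
  congr 1
  field_simp

/-! ### Regularity of the heat semigroup -/

open Filter Topology

theorem tendsto_gauss (N : ℕ) {t : ℝ} (ht : 0 < t) :
    Tendsto (gauss N t) (cocompact _) (𝓝 0) := by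
  have h1 : Tendsto (fun z : EuclideanSpace ℝ (Fin N) => -‖z‖ ^ 2 / (4 * t)) (cocompact _) atBot := by
    have h2 : Tendsto (fun z : EuclideanSpace ℝ (Fin N) => ‖z‖ ^ 2) (cocompact _) atTop :=
      (tendsto_pow_atTop two_ne_zero).comp tendsto_norm_cocompact_atTop
    exact (tendsto_neg_atTop_atBot.comp h2).atBot_div_const (by positivity)
  have h3 := (Real.tendsto_exp_atBot.comp h1).const_mul ((4 * Real.pi * t) ^ (-(N : ℝ) / 2))
  rw [mul_zero] at h3
  exact h3

/-- Moving the centre by at most `1` is paid for by doubling the time, since `‖x₀ - y‖² ≤ 2 + 2‖x -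
y‖²`. This supplies the locally uniform majorant for continuity in `x`. -/
theorem gauss_le_of_dist_le {N : ℕ} {t : ℝ} (ht : 0 < t) {x x₀ y : EuclideanSpace ℝ (Fin N)}
    (hx : ‖x - x₀‖ ≤ 1) :
    gauss N t (x - y) ≤ 2 ^ ((N : ℝ) / 2) * Real.exp (1 / (4 * t)) * gauss N (2 * t) (x₀ - y) := by
  unfold gauss
  have h : (4 * Real.pi * (2 * t)) ^ (-(N : ℝ) / 2) =
      2 ^ (-(N : ℝ) / 2) * (4 * Real.pi * t) ^ (-(N : ℝ) / 2) := by
    rw [← Real.mul_rpow (by positivity) (by positivity)]; congr 1; ring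
  have h2 : (2 : ℝ) ^ ((N : ℝ) / 2) * 2 ^ (-(N : ℝ) / 2) = 1 := by
    rw [← Real.rpow_add two_pos, show (N : ℝ) / 2 + -N / 2 = 0 by ring, Real.rpow_zero]
  have h3 : Real.exp (-‖x - y‖ ^ 2 / (4 * t)) ≤
      Real.exp (1 / (4 * t)) * Real.exp (-‖x₀ - y‖ ^ 2 / (4 * (2 * t))) := by
    rw [← Real.exp_add]
    refine Real.exp_le_exp.2 ?_
    have h4 : ‖x₀ - y‖ ≤ 1 + ‖x - y‖ := by
      calc ‖x₀ - y‖ = ‖(x - y) - (x - x₀)‖ := by congr 1; abel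
        _ ≤ ‖x - y‖ + ‖x - x₀‖ := norm_sub_le _ _
        _ ≤ 1 + ‖x - y‖ := by linarith
    have h5 : ‖x₀ - y‖ ^ 2 ≤ 2 + 2 * ‖x - y‖ ^ 2 := by
      nlinarith [norm_nonneg (x₀ - y), norm_nonneg (x - y), sq_nonneg (‖x - y‖ - 1)]
    rw [show 1 / (4 * t) + -‖x₀ - y‖ ^ 2 / (4 * (2 * t)) = (2 - ‖x₀ - y‖ ^ 2) / (8 * t) by
      field_simp; ring, show -‖x - y‖ ^ 2 / (4 * t) = (-2 * ‖x - y‖ ^ 2) / (8 * t) by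
      field_simp; ring]
    gcongr
    linarith
  rw [h]
  calc _ ≤ (4 * Real.pi * t) ^ (-(N : ℝ) / 2) *
        (Real.exp (1 / (4 * t)) * Real.exp (-‖x₀ - y‖ ^ 2 / (4 * (2 * t)))) := by gcongr
    _ = _ := by
      linear_combination (-(4 * Real.pi * t) ^ (-(N : ℝ) / 2) *
        (Real.exp (1 / (4 * t)) * Real.exp (-‖x₀ - y‖ ^ 2 / (4 * (2 * t))))) * h2

theorem integrable_gauss_sub {N : ℕ} {t : ℝ} (ht : 0 < t) (x : EuclideanSpace ℝ (Fin N)) :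
    Integrable fun y => gauss N t (x - y) :=
  (integrable_gauss ht).comp_sub_left x

theorem integral_gauss_sub {N : ℕ} {t : ℝ} (ht : 0 < t) (x : EuclideanSpace ℝ (Fin N)) :
    ∫ y, gauss N t (x - y) = 1 := by
  rw [integral_sub_left_eq_self (gauss N t), integral_gauss ht]

theorem integrable_sector_gauss_sub {N : ℕ} (m : ℕ) {t : ℝ} (ht : 0 < t)
    (x : EuclideanSpace ℝ (Fin N)) : Integrable fun y : sector N m => gauss N t (x - y) :=
  integrable_sector_iff.2 (integrable_gauss_sub ht x).integrableOn

theorem integral_sector_gauss_sub_le {N : ℕ} (m : ℕ) {t : ℝ} (ht : 0 < t)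
    (x : EuclideanSpace ℝ (Fin N)) : ∫ y : sector N m, gauss N t (x - y) ≤ 1 := by
  rw [integral_sector fun y => gauss N t (x - y), ← integral_gauss_sub ht x]
  exact setIntegral_le_integral (integrable_gauss_sub ht x)
    (.of_forall fun y => (gauss_pos ht _).le)

theorem continuous_gauss_sub_coe {N : ℕ} (m : ℕ) (t : ℝ) (x : EuclideanSpace ℝ (Fin N)) :
    Continuous fun y : sector N m => gauss N t (x - y) :=
  (continuous_gauss N t).comp (by fun_prop)

theorem integrable_gauss_sub_mul {N m : ℕ} {t : ℝ} (ht : 0 < t) (x : EuclideanSpace ℝ (Fin N))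
    {g : sector N m → ℝ} (hg : Integrable g) :
    Integrable fun y : sector N m => gauss N t (x - y) * g y := by
  refine hg.bdd_mul (c := (4 * Real.pi * t) ^ (-(N : ℝ) / 2))
    (continuous_gauss_sub_coe m t x).aestronglyMeasurable (.of_forall fun y => ?_)
  rw [Real.norm_of_nonneg (gauss_pos ht _).le]
  exact gauss_le ht _

theorem tendsto_integral_gauss_sub_mul {N m : ℕ} {t : ℝ} (ht : 0 < t)
    {g : sector N m → ℝ} (hg : Integrable g) :
    Tendsto (fun x => ∫ y : sector N m, gauss N t (x - y) * g y) (cocompact _) (𝓝 0) := by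
  have : (cocompact (EuclideanSpace ℝ (Fin N))).IsCountablyGenerated := by
    rw [← Metric.cobounded_eq_cocompact, ← comap_norm_atTop]
    infer_instance
  have h := tendsto_integral_filter_of_dominated_convergence (μ := (volume : Measure (sector N m)))
    (l := cocompact (EuclideanSpace ℝ (Fin N)))
    (F := fun x (y : sector N m) => gauss N t (x - y) * g y) (f := fun _ => 0)
    (fun y => (4 * Real.pi * t) ^ (-(N : ℝ) / 2) * |g y|)
    (.of_forall fun x => (integrable_gauss_sub_mul ht x hg).aestronglyMeasurable)
    (.of_forall fun x => .of_forall fun y => ?_) (hg.abs.const_mul _)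
    (.of_forall fun y => ?_)
  · simpa using h
  · rw [norm_mul, Real.norm_of_nonneg (gauss_pos ht _).le, Real.norm_eq_abs]
    gcongr
    exact gauss_le ht _
  · have h1 : Tendsto (fun x : EuclideanSpace ℝ (Fin N) => x - y) (cocompact _) (cocompact _) :=
      (Homeomorph.subRight (y : EuclideanSpace ℝ (Fin N))).isClosedEmbedding.tendsto_cocompact
    have h2 := ((tendsto_gauss N ht).comp h1).mul_const (g y)
    rw [zero_mul] at h2
    exact h2

/-- `f` is, up to arbitrarily small constants, dominated by integrable functions. -/
def Decays {N m : ℕ} (f : sector N m → ℝ) : Prop :=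
  ∀ ε > 0, ∃ g : sector N m → ℝ, Integrable g ∧ ∀ᵐ y, |f y| ≤ g y + ε

theorem Decays.integrable_gauss_mul {N m : ℕ} {t : ℝ} (ht : 0 < t) (x : EuclideanSpace ℝ (Fin N))
    {f : sector N m → ℝ} (hf : Decays f) (hfm : AEStronglyMeasurable f) :
    Integrable fun y : sector N m => gauss N t (x - y) * |f y| := by
  obtain ⟨g, hg, hfg⟩ := hf 1 one_pos
  refine ((integrable_gauss_sub_mul ht x hg).add (integrable_sector_gauss_sub m ht x)).mono'
    ((continuous_gauss_sub_coe m t x).aestronglyMeasurable.mul hfm.norm) ?_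
  filter_upwards [hfg] with y hy
  rw [norm_mul, Real.norm_of_nonneg (gauss_pos ht _).le, Real.norm_eq_abs, abs_abs]
  have := gauss_pos (N := N) ht (x - y)
  simp only [Pi.add_apply]
  nlinarith

/-- The integrable part tends to zero by dominated convergence; the remainder `ε` contributes at
most `ε` because the Gaussian has mass at most `1` on the sector. -/
theorem Decays.tendsto_gauss_conv {N m : ℕ} {t : ℝ} (ht : 0 < t)
    {f : sector N m → ℝ} (hf : Decays f) (hfm : AEStronglyMeasurable f) :
    Tendsto (fun x => ∫ y : sector N m, gauss N t (x - y) * |f y|) (cocompact _) (𝓝 0) := by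
  rw [Metric.tendsto_nhds]
  intro ε hε
  obtain ⟨g, hg, hfg⟩ := hf (ε / 2) (half_pos hε)
  have h := tendsto_integral_gauss_sub_mul ht hg
  filter_upwards [(Metric.tendsto_nhds.1 h) (ε / 2) (half_pos hε)] with x hx
  rw [dist_zero_right, Real.norm_eq_abs] at hx ⊢
  rw [abs_of_nonneg (integral_nonneg fun y => mul_nonneg (gauss_pos ht _).le (abs_nonneg _))]
  calc ∫ y : sector N m, gauss N t (x - y) * |f y|
      ≤ ∫ y : sector N m, (gauss N t (x - y) * g y + gauss N t (x - y) * (ε / 2)) := by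
        refine integral_mono_ae (hf.integrable_gauss_mul ht x hfm)
          ((integrable_gauss_sub_mul ht x hg).add
            ((integrable_sector_gauss_sub m ht x).mul_const _)) ?_
        filter_upwards [hfg] with y hy
        have := gauss_pos (N := N) ht (x - y)
        nlinarith
    _ = (∫ y : sector N m, gauss N t (x - y) * g y) +
        (∫ y : sector N m, gauss N t (x - y)) * (ε / 2) := by
        rw [integral_add (integrable_gauss_sub_mul ht x hg)
          ((integrable_sector_gauss_sub m ht x).mul_const _), integral_mul_const]
    _ < ε := by
        have h1 := integral_sector_gauss_sub_le m ht x
        have h2 := le_abs_self (∫ y : sector N m, gauss N t (x - y) * g y)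
        nlinarith

/-- The superlevel set of `|U|` in the closed sector is closed and bounded, and the boundary
condition keeps it inside the open sector; so it is compact there. -/
theorem exists_zeroAtInfty_of_closedSector {N m : ℕ} {U : EuclideanSpace ℝ (Fin N) → ℝ}
    (hc : ContinuousOn U (closedSector N m))
    (h0 : ∀ x ∈ closedSector N m, x ∉ sector N m → U x = 0)
    (hlim : Tendsto U (cocompact _ ⊓ 𝓟 (closedSector N m)) (𝓝 0)) :
    ∃ u : C₀(sector N m, ℝ), ∀ x, u x = U x := by
  have hcont : Continuous fun x : sector N m => U x :=
    (hc.mono (sector_subset_closedSector N m)).domRestrict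
  refine ⟨⟨⟨fun x => U x, hcont⟩, ?_⟩, fun x => rfl⟩
  change Tendsto (fun x : sector N m => U x) _ _
  rw [Metric.tendsto_nhds]
  intro ε hε
  set K := closedSector N m ∩ U ⁻¹' {r | ε ≤ |r|} with hK
  have hKc : IsClosed K := hc.preimage_isClosed_of_isClosed (isClosed_closedSector N m)
    (isClosed_le continuous_const continuous_abs)
  have hKs : K ⊆ sector N m := by
    intro x hx
    by_contra hxs
    have h := hx.2
    rw [mem_preimage, h0 x hx.1 hxs] at h
    have : ε ≤ |(0 : ℝ)| := h
    rw [abs_zero] at this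
    linarith
  have hKcomp : IsCompact K := by
    have h1 := (Metric.tendsto_nhds.1 hlim) ε hε
    rw [eventually_inf_principal] at h1
    rw [Filter.Eventually, mem_cocompact] at h1
    obtain ⟨C, hC, hCK⟩ := h1
    refine hC.of_isClosed_subset hKc fun x hx => ?_
    by_contra hxC
    have h2 := hCK hxC hx.1
    rw [dist_zero_right, Real.norm_eq_abs] at h2
    exact absurd (show ε ≤ |U x| from hx.2) (not_le.2 h2)
  have hK' : IsCompact ((↑) ⁻¹' K : Set (sector N m)) := by
    rw [Subtype.isCompact_iff, Subtype.image_preimage_coe, inter_eq_self_of_subset_right hKs]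
    exact hKcomp
  filter_upwards [hK'.compl_mem_cocompact] with x hx
  rw [dist_zero_right, Real.norm_eq_abs]
  by_contra hcon
  exact hx ⟨sector_subset_closedSector N m x.2, not_lt.1 hcon⟩

/-- If the kernel times `|f|` is dominated by a Gaussian times a decaying function, then
`e^{tΔ} f` is well defined and belongs to `C₀`. -/
theorem heat_mem_zeroAtInfty {N m : ℕ} {t s C : ℝ} (hs : 0 < s) (hC : 0 ≤ C)
    {f g : sector N m → ℝ} (hf : AEStronglyMeasurable f) (hg : AEStronglyMeasurable g)
    (hgd : Decays g)
    (hdom : ∀ x ∈ closedSector N m, ∀ᵐ y : sector N m,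
      |kernel N m t x y * f y| ≤ C * (gauss N s (x - y) * |g y|)) :
    (∀ x ∈ closedSector N m, Integrable fun y : sector N m => kernel N m t x y * f y) ∧
      ∃ u : C₀(sector N m, ℝ), ∀ x, u x = heat N m t f x := by
  have hmeas : ∀ x : EuclideanSpace ℝ (Fin N),
      AEStronglyMeasurable fun y : sector N m => kernel N m t x y * f y := fun x =>
    ((continuous_kernel N m t).comp (by fun_prop : Continuous fun y : sector N m =>
      ((x, y) : EuclideanSpace ℝ (Fin N) × EuclideanSpace ℝ (Fin N)))).aestronglyMeasurable.mul hf
  have hint : ∀ x ∈ closedSector N m, Integrable fun y : sector N m => kernel N m t x y * f y :=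
    fun x hx => ((hgd.integrable_gauss_mul hs x hg).const_mul C).mono' (hmeas x) (hdom x hx)
  refine ⟨hint, exists_zeroAtInfty_of_closedSector
    (U := fun x => ∫ y : sector N m, kernel N m t x y * f y) ?_ ?_ ?_⟩
  · intro x₀ hx₀
    refine continuousWithinAt_of_dominated (bound := fun y : sector N m =>
      C * (2 ^ ((N : ℝ) / 2) * Real.exp (1 / (4 * s)) * (gauss N (2 * s) (x₀ - y) * |g y|)))
      (.of_forall hmeas) ?_ ?_ (.of_forall fun y => ?_)
    · filter_upwards [self_mem_nhdsWithin,
        mem_nhdsWithin_of_mem_nhds (Metric.closedBall_mem_nhds x₀ one_pos)] with x hx hx1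
      rw [mem_closedBall_iff_norm] at hx1
      filter_upwards [hdom x hx] with y hy
      refine hy.trans ?_
      rw [← mul_assoc (2 ^ ((N : ℝ) / 2) * Real.exp (1 / (4 * s)))]
      gcongr
      exact gauss_le_of_dist_le hs hx1
    · exact ((hgd.integrable_gauss_mul (by positivity) x₀ hg).const_mul _).const_mul C
    · have : Continuous fun x : EuclideanSpace ℝ (Fin N) => kernel N m t x y * f y :=
        ((continuous_kernel N m t).comp (by fun_prop :
          Continuous fun x : EuclideanSpace ℝ (Fin N) => (x, (y : EuclideanSpace ℝ (Fin N))))).mul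
          continuous_const
      exact this.continuousWithinAt
  · intro x hx hxs
    simp only [sector, mem_ofPred_eq, not_forall] at hxs
    obtain ⟨i, hi, hxi⟩ := hxs
    have hx0 : x i = 0 := le_antisymm (not_lt.1 hxi) (hx i hi)
    simp [kernel_eq_zero t hi hx0]
  · have h := ((hgd.tendsto_gauss_conv hs hg).const_mul C).mono_left
      (inf_le_left : cocompact _ ⊓ 𝓟 (closedSector N m) ≤ cocompact _)
    rw [mul_zero] at h
    refine squeeze_zero_norm' ?_ h
    rw [eventually_inf_principal]
    filter_upwards with x hx
    rw [← integral_const_mul]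
    exact norm_integral_le_of_norm_le ((hgd.integrable_gauss_mul hs x hg).const_mul C) (hdom x hx)

theorem abs_apply_le_norm {N m : ℕ} (f : C₀(sector N m, ℝ)) (x : sector N m) : |f x| ≤ ‖f‖ := by
  rw [← ZeroAtInftyContinuousMap.norm_toBCF_eq_norm]
  exact f.toBCF.norm_coe_le_norm x

theorem norm_le_of_forall {N m : ℕ} {f : C₀(sector N m, ℝ)} {C : ℝ} (hC : 0 ≤ C)
    (h : ∀ x, |f x| ≤ C) : ‖f‖ ≤ C := by
  rw [← ZeroAtInftyContinuousMap.norm_toBCF_eq_norm]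
  exact (BoundedContinuousFunction.norm_le hC).2 h

theorem decays_zeroAtInfty {N m : ℕ} (f : C₀(sector N m, ℝ)) : Decays f := by
  intro ε hε
  have h := (Metric.tendsto_nhds.1 (zero_at_infty f)) ε hε
  rw [Filter.Eventually, mem_cocompact] at h
  obtain ⟨K, hK, hKf⟩ := h
  have hKm : MeasurableSet K := hK.measurableSet
  have hKfin : (volume : Measure (sector N m)) K < ⊤ := by
    rw [Measure.Subtype.volume_def, (measurableEmbedding_coe N m).comap_apply]
    exact (hK.image continuous_subtype_val).measure_lt_top
  refine ⟨K.indicator fun _ => ‖f‖, (integrable_indicator_iff hKm).2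
    (integrableOn_const hKfin.ne), .of_forall fun y => ?_⟩
  by_cases hy : y ∈ K
  · rw [indicator_of_mem hy]
    linarith [abs_apply_le_norm f y]
  · rw [indicator_of_notMem hy, zero_add]
    have := hKf hy
    rw [mem_ofPred_eq, dist_zero_right] at this
    exact this.le

theorem heat_zeroAtInfty {N m : ℕ} {t : ℝ} (ht : 0 < t) (f : C₀(sector N m, ℝ)) :
    (∀ x ∈ closedSector N m, Integrable fun y : sector N m => kernel N m t x y * f y) ∧
      ∃ u : C₀(sector N m, ℝ), ∀ x, u x = heat N m t f x := by
  refine heat_mem_zeroAtInfty (s := t) (C := 1) ht zero_le_one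
    (map_continuous f).aestronglyMeasurable (map_continuous f).aestronglyMeasurable
    (decays_zeroAtInfty f) fun x hx => .of_forall fun y => ?_
  have hy := sector_subset_closedSector N m y.2
  rw [abs_mul, abs_of_nonneg (kernel_nonneg ht hx hy), one_mul]
  gcongr
  exact kernel_le_gauss ht hx hy

/-! ### The initial value `ψ₀` -/

theorem norm_pos_of_mem_sector {N m : ℕ} (hm : m ≤ N) (hm0 : 0 < m)
    {y : EuclideanSpace ℝ (Fin N)} (hy : y ∈ sector N m) : 0 < ‖y‖ := by
  rw [norm_pos_iff]
  rintro rfl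
  have := hy ⟨0, hm0.trans_le hm⟩ hm0
  simp at this

theorem psi0_nonneg {N m : ℕ} {γ : ℝ} (hγ : 0 < γ) (y : sector N m) : 0 ≤ psi0 N m γ y := by
  unfold psi0
  refine mul_nonneg (mul_nonneg (Finset.prod_nonneg fun k _ => by positivity)
    (Finset.prod_nonneg fun i _ => ?_)) (by positivity)
  split_ifs with hi
  · exact (y.2 i hi).le
  · exact zero_le_one

theorem psi0_pos {N m : ℕ} {γ : ℝ} (hγ : 0 < γ) {y : sector N m}
    (hy : (y : EuclideanSpace ℝ (Fin N)) ≠ 0) : 0 < psi0 N m γ y := by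
  unfold psi0
  refine mul_pos (mul_pos (Finset.prod_pos fun k _ => by positivity)
    (Finset.prod_pos fun i _ => ?_)) (Real.rpow_pos_of_pos (norm_pos_iff.2 hy) _)
  split_ifs with hi
  · exact y.2 i hi
  · exact zero_lt_one

theorem measurable_psi0 (N m : ℕ) (γ : ℝ) : Measurable (psi0 N m γ) := by
  unfold psi0
  refine Measurable.mul (measurable_const.mul (Finset.measurable_fun_prod _ fun i _ => ?_)) ?_
  · split_ifs <;> fun_prop
  · exact (continuous_subtype_val.norm.measurable).pow_const _

theorem card_filter_lt {N m : ℕ} (hm : m ≤ N) :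
    (Finset.univ.filter fun i : Fin N => i.val < m).card = m := by
  rw [Fin.card_filter_val_lt, min_eq_right hm]

/-- Each of the two products of coordinates is at most `‖y‖ ^ m`, which together cancel the excess
`-2m` in the exponent. -/
theorem prod_mul_psi0_le {N m : ℕ} (hm : m ≤ N) {γ c : ℝ} (hγ : 0 < γ) (hc : 0 ≤ c)
    (y : sector N m) :
    (∏ i : Fin N, if i.val < m then c * (y : EuclideanSpace ℝ (Fin N)) i else 1) * psi0 N m γ y ≤
      c ^ m * (∏ k ∈ Finset.range m, (γ + 2 * (k : ℝ))) *
        ‖(y : EuclideanSpace ℝ (Fin N))‖ ^ (-γ) := by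
  have hP : 0 ≤ ∏ k ∈ Finset.range m, (γ + 2 * (k : ℝ)) :=
    Finset.prod_nonneg fun k _ => by positivity
  have hle : ∀ c : ℝ, 0 ≤ c → (∏ i : Fin N, if i.val < m then
      c * (y : EuclideanSpace ℝ (Fin N)) i else 1) ≤
      (c * ‖(y : EuclideanSpace ℝ (Fin N))‖) ^ m := by
    intro c hc
    have : (c * ‖(y : EuclideanSpace ℝ (Fin N))‖) ^ m =
        ∏ i : Fin N, if i.val < m then c * ‖(y : EuclideanSpace ℝ (Fin N))‖ else 1 := by
      rw [Finset.prod_ite, Finset.prod_const, Finset.prod_const, one_pow, mul_one,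
        card_filter_lt hm]
    rw [this]
    refine Finset.prod_le_prod (fun i _ => ?_) fun i _ => ?_
    · split_ifs with hi
      · exact mul_nonneg hc (y.2 i hi).le
      · exact zero_le_one
    · split_ifs with hi
      · gcongr
        exact (le_abs_self _).trans (PiLp.norm_apply_le (y : EuclideanSpace ℝ (Fin N)) i)
      · exact le_rfl
  have h1 := hle c hc
  have h2 := hle 1 zero_le_one
  simp only [one_mul] at h2
  have hr : (‖(y : EuclideanSpace ℝ (Fin N))‖ ^ m) * (‖(y : EuclideanSpace ℝ (Fin N))‖ ^ m) *
      ‖(y : EuclideanSpace ℝ (Fin N))‖ ^ (-γ - 2 * (m : ℝ)) =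
      ‖(y : EuclideanSpace ℝ (Fin N))‖ ^ (-γ) := by
    rcases Nat.eq_zero_or_pos m with rfl | hm0
    · simp
    · have hy := norm_pos_of_mem_sector hm hm0 y.2
      rw [← Real.rpow_natCast, ← Real.rpow_add hy, ← Real.rpow_add hy]
      congr 1; ring
  have h3 : 0 ≤ ∏ i : Fin N, if i.val < m then (y : EuclideanSpace ℝ (Fin N)) i else 1 :=
    Finset.prod_nonneg fun i _ => by
      split_ifs with hi
      · exact (y.2 i hi).le
      · exact zero_le_one
  unfold psi0
  calc _ ≤ (c * ‖(y : EuclideanSpace ℝ (Fin N))‖) ^ m *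
        ((∏ k ∈ Finset.range m, (γ + 2 * (k : ℝ))) * ‖(y : EuclideanSpace ℝ (Fin N))‖ ^ m *
          ‖(y : EuclideanSpace ℝ (Fin N))‖ ^ (-γ - 2 * (m : ℝ))) := by gcongr
    _ = _ := by rw [← hr, mul_pow]; ring

/-- The power is integrable near the origin because `γ < N`, and small far away because `γ > 0`. -/
theorem decays_norm_rpow {N m : ℕ} {γ : ℝ} (hγ : 0 < γ) (hγN : γ < N) :
    Decays fun y : sector N m => ‖(y : EuclideanSpace ℝ (Fin N))‖ ^ (-γ) := by
  have hN : 0 < N := by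
    rcases Nat.eq_zero_or_pos N with rfl | h
    · simp at hγN; linarith
    · exact h
  have : Nonempty (Fin N) := ⟨⟨0, hN⟩⟩
  intro ε hε
  -- The radius at which the power equals `ε`.
  set R := ε ^ (-γ⁻¹) with hR
  have hR0 : 0 < R := Real.rpow_pos_of_pos hε _
  have hint : IntegrableOn (fun y : EuclideanSpace ℝ (Fin N) => ‖y‖ ^ (-γ)) (Metric.ball 0 R) := by
    rw [integrableOn_fun_norm_addHaar volume (f := fun r => r ^ (-γ)), finrank_euclideanSpace,
      Fintype.card_fin]
    have h1 : IntegrableOn (fun r : ℝ => r ^ ((N : ℝ) - 1 - γ)) (Ioo 0 R) := by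
      rw [intervalIntegral.integrableOn_Ioo_rpow_iff hR0]
      linarith
    refine h1.congr_fun (fun r hr => ?_) measurableSet_Ioo
    simp only [smul_eq_mul]
    rw [← Real.rpow_natCast, ← Real.rpow_add hr.1, Nat.cast_sub hN, Nat.cast_one]
    congr 1
  refine ⟨fun y => (Metric.ball 0 R).indicator (fun y : EuclideanSpace ℝ (Fin N) => ‖y‖ ^ (-γ)) y,
    ?_, .of_forall fun y => ?_⟩
  · rw [integrable_sector_iff]
    exact ((integrable_indicator_iff measurableSet_ball).2 hint).integrableOn
  · rw [abs_of_nonneg (by positivity)]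
    beta_reduce
    by_cases hy : (y : EuclideanSpace ℝ (Fin N)) ∈ Metric.ball (0 : EuclideanSpace ℝ (Fin N)) R
    · rw [indicator_of_mem hy]; linarith
    · rw [indicator_of_notMem hy, zero_add]
      rw [mem_ball_zero_iff, not_lt] at hy
      calc _ ≤ R ^ (-γ) := Real.rpow_le_rpow_of_nonpos hR0 hy (by linarith)
        _ = ε := by
          rw [hR, ← Real.rpow_mul hε.le, neg_mul_neg, inv_mul_cancel₀ hγ.ne', Real.rpow_one]

theorem heat_of_le_psi0 {N m : ℕ} (hm : m ≤ N) {γ : ℝ} (hγ : 0 < γ) (hγN : γ < N) {t : ℝ}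
    (ht : 0 < t) {k : ℝ} {f : sector N m → ℝ} (hf : AEStronglyMeasurable f) 
    (hk : 0 ≤ k) (hfk : ∀ᵐ y, |f y| ≤ k * psi0 N m γ y) :
    (∀ x ∈ closedSector N m, Integrable fun y : sector N m => kernel N m t x y * f y) ∧
      ∃ u : C₀(sector N m, ℝ), ∀ x, u x = heat N m t f x := by
  have hP : 0 ≤ ∏ k ∈ Finset.range m, (γ + 2 * (k : ℝ)) :=
    Finset.prod_nonneg fun k _ => by positivity
  refine heat_mem_zeroAtInfty (s := 2 * t) (g := fun y => ‖(y : EuclideanSpace ℝ (Fin N))‖ ^ (-γ))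
    (C := k * (2 ^ ((N : ℝ) / 2) * ((3 / √t) ^ m * (∏ k ∈ Finset.range m, (γ + 2 * (k : ℝ))))))
    (by positivity) (by positivity) hf ?_ (decays_norm_rpow hγ hγN) fun x hx => ?_
  · exact ((continuous_subtype_val.norm.measurable).pow_const _).aestronglyMeasurable
  · filter_upwards [hfk] with y hy
    have hyc := sector_subset_closedSector N m y.2
    rw [abs_mul, abs_of_nonneg (kernel_nonneg ht hx hyc), abs_of_nonneg
      (by positivity : (0 : ℝ) ≤ ‖(y : EuclideanSpace ℝ (Fin N))‖ ^ (-γ))]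
    have hg := gauss_pos (N := N) (show 0 < 2 * t by positivity) (x - y)
    calc _ ≤ (2 ^ ((N : ℝ) / 2) * gauss N (2 * t) (x - y) *
          ∏ i : Fin N, if i.val < m then 3 / √t * (y : EuclideanSpace ℝ (Fin N)) i else 1) *
          (k * psi0 N m γ y) :=
          mul_le_mul (kernel_le_prod ht hx hyc) hy (abs_nonneg _)
            ((kernel_nonneg ht hx hyc).trans (kernel_le_prod ht hx hyc))
      _ = k * (2 ^ ((N : ℝ) / 2) * gauss N (2 * t) (x - y)) *
          ((∏ i : Fin N, if i.val < m then 3 / √t * (y : EuclideanSpace ℝ (Fin N)) i else 1) *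
          psi0 N m γ y) := by ring
      _ ≤ k * (2 ^ ((N : ℝ) / 2) * gauss N (2 * t) (x - y)) * ((3 / √t) ^ m *
          (∏ k ∈ Finset.range m, (γ + 2 * (k : ℝ))) *
          ‖(y : EuclideanSpace ℝ (Fin N))‖ ^ (-γ)) := by
          exact mul_le_mul_of_nonneg_left (prod_mul_psi0_le hm hγ (by positivity) y)
            (by positivity)
      _ = _ := by ring

/-! ### The heat semigroup on `C₀` -/

theorem continuous_kernel_left {N m : ℕ} (t : ℝ) (x : EuclideanSpace ℝ (Fin N)) :
    Continuous fun y : sector N m => kernel N m t x y :=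
  Continuous.comp (g := fun p : EuclideanSpace ℝ (Fin N) × EuclideanSpace ℝ (Fin N) =>
    kernel N m t p.1 p.2) (f := fun y : sector N m => (x, (y : EuclideanSpace ℝ (Fin N))))
    (continuous_kernel N m t) (by fun_prop)

theorem integrable_kernel {N m : ℕ} {t : ℝ} (ht : 0 < t) {x : EuclideanSpace ℝ (Fin N)}
    (hx : x ∈ closedSector N m) : Integrable fun y : sector N m => kernel N m t x y :=
  (integrable_sector_gauss_sub m ht x).mono' (continuous_kernel_left t x).aestronglyMeasurable
    (.of_forall fun y => by
      have hy := sector_subset_closedSector N m y.2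
      rw [Real.norm_of_nonneg (kernel_nonneg ht hx hy)]
      exact kernel_le_gauss ht hx hy)

theorem integral_kernel_le_one {N m : ℕ} {t : ℝ} (ht : 0 < t) {x : EuclideanSpace ℝ (Fin N)}
    (hx : x ∈ closedSector N m) : ∫ y : sector N m, kernel N m t x y ≤ 1 :=
  (integral_mono (integrable_kernel ht hx) (integrable_sector_gauss_sub m ht x) fun y =>
    kernel_le_gauss ht hx (sector_subset_closedSector N m y.2)).trans
    (integral_sector_gauss_sub_le m ht x)

theorem kernel_coe_nonneg {N m : ℕ} {t : ℝ} (ht : 0 < t) (x y : sector N m) :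
    0 ≤ kernel N m t x y :=
  kernel_nonneg ht (sector_subset_closedSector N m x.2) (sector_subset_closedSector N m y.2)

theorem kernel_le_const {N m : ℕ} {t : ℝ} (ht : 0 < t) (x y : sector N m) :
    kernel N m t x y ≤ (4 * Real.pi * t) ^ (-(N : ℝ) / 2) :=
  (kernel_le_gauss ht (sector_subset_closedSector N m x.2)
    (sector_subset_closedSector N m y.2)).trans (gauss_le ht _)

theorem continuous_kernel_coe (N m : ℕ) (t : ℝ) :
    Continuous fun p : sector N m × sector N m => kernel N m t p.1 p.2 :=
  Continuous.comp (g := fun p : EuclideanSpace ℝ (Fin N) × EuclideanSpace ℝ (Fin N) =>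
    kernel N m t p.1 p.2) (f := fun p : sector N m × sector N m =>
    ((p.1 : EuclideanSpace ℝ (Fin N)), (p.2 : EuclideanSpace ℝ (Fin N))))
    (continuous_kernel N m t) (by fun_prop)

/-- Chapman–Kolmogorov and Fubini. Integrating the absolute value in `z` first leaves the kernel at
time `t + s` times `|f|`, so the single hypothesis `hint` justifies the exchange, and `f` may be as
singular as `ψ₀`. -/
theorem heat_heat {N m : ℕ} {t s : ℝ} (ht : 0 < t) (hs : 0 < s) {f : sector N m → ℝ}
    (hf : AEStronglyMeasurable f) (x : sector N m)
    (hint : Integrable fun y : sector N m => kernel N m (t + s) x y * f y) :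
    heat N m t (heat N m s f) x = heat N m (t + s) f x := by
  have hfac : Integrable (Function.uncurry fun z y : sector N m =>
      kernel N m t x z * kernel N m s z y * f y) (volume.prod volume) := by
    rw [integrable_prod_iff']
    · constructor
      · refine .of_forall fun y => ?_
        simp only [Function.uncurry]
        refine Integrable.mul_const ?_ _
        refine (integrable_kernel ht (sector_subset_closedSector N m x.2)).mul_bdd
          (c := (4 * Real.pi * s) ^ (-(N : ℝ) / 2)) ?_ (.of_forall fun z => ?_)
        · simp_rw [kernel_symm N m s _ y]
          exact (continuous_kernel_left s _).aestronglyMeasurable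
        · rw [Real.norm_of_nonneg (kernel_coe_nonneg hs z y)]
          exact kernel_le_const hs z y
      · refine hint.norm.congr (.of_forall fun y => ?_)
        simp only [Function.uncurry, norm_mul]
        rw [integral_mul_const, Real.norm_of_nonneg (kernel_coe_nonneg (add_pos ht hs) x y),
          ← integral_kernel_mul_kernel ht hs]
        congr 1
        refine integral_congr_ae (.of_forall fun z => ?_)
        simp only
        rw [Real.norm_of_nonneg (kernel_coe_nonneg ht x z),
          Real.norm_of_nonneg (kernel_coe_nonneg hs z y)]
    · refine AEStronglyMeasurable.mul ?_ hf.comp_snd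
      exact (((continuous_kernel_left t _).comp continuous_fst).mul
        (continuous_kernel_coe N m s)).aestronglyMeasurable
  calc heat N m t (heat N m s f) x
      = ∫ z : sector N m, ∫ y : sector N m, kernel N m t x z * kernel N m s z y * f y := by
        unfold heat
        refine integral_congr_ae (.of_forall fun z => ?_)
        simp only
        rw [← integral_const_mul]
        simp_rw [mul_assoc]
    _ = ∫ y : sector N m, ∫ z : sector N m, kernel N m t x z * kernel N m s z y * f y :=
        integral_integral_swap hfac
    _ = heat N m (t + s) f x := by
        unfold heat
        refine integral_congr_ae (.of_forall fun y => ?_)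
        simp only
        rw [integral_mul_const, integral_kernel_mul_kernel ht hs]

theorem abs_heat_le_ae {N m : ℕ} {t : ℝ} (ht : 0 < t) {f g : sector N m → ℝ} (x : sector N m)
    (hg : Integrable fun y : sector N m => kernel N m t x y * g y) (hfg : ∀ᵐ y, |f y| ≤ g y) :
    |heat N m t f x| ≤ heat N m t g x := by
  unfold heat
  rw [← Real.norm_eq_abs]
  refine norm_integral_le_of_norm_le hg ?_
  filter_upwards [hfg] with y hy
  rw [norm_mul, Real.norm_of_nonneg (kernel_coe_nonneg ht x y)]
  exact mul_le_mul_of_nonneg_left hy (kernel_coe_nonneg ht x y)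

theorem integrable_kernel_mul {N m : ℕ} {t : ℝ} (ht : 0 < t) (f : C₀(sector N m, ℝ))
    (x : sector N m) : Integrable fun y : sector N m => kernel N m t x y * f y :=
  (heat_zeroAtInfty ht f).1 x (sector_subset_closedSector N m x.2)

theorem abs_heat_le {N m : ℕ} {t : ℝ} (ht : 0 < t) (f : C₀(sector N m, ℝ)) (x : sector N m) :
    |heat N m t f x| ≤ ‖f‖ := by
  have hx := sector_subset_closedSector N m x.2
  refine (abs_heat_le_ae ht (g := fun _ => ‖f‖) x ((integrable_kernel ht hx).mul_const _)
    (.of_forall (abs_apply_le_norm f))).trans ?_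
  unfold heat
  rw [integral_mul_const]
  exact mul_le_of_le_one_left (norm_nonneg _) (integral_kernel_le_one ht hx)

open Classical in
/-- The heat semigroup on `C₀`, extended by the identity to nonpositive times. -/
def heatOp (N m : ℕ) (t : ℝ) : C₀(sector N m, ℝ) →L[ℝ] C₀(sector N m, ℝ) :=
  if ht : 0 < t then
    LinearMap.mkContinuous
      { toFun := fun f => (heat_zeroAtInfty ht f).2.choose
        map_add' := fun f g => by
          ext x
          rw [ZeroAtInftyContinuousMap.add_apply, (heat_zeroAtInfty ht f).2.choose_spec,
            (heat_zeroAtInfty ht g).2.choose_spec, (heat_zeroAtInfty ht (f + g)).2.choose_spec]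
          unfold heat
          rw [← integral_add (integrable_kernel_mul ht f x) (integrable_kernel_mul ht g x)]
          simp [mul_add]
        map_smul' := fun c f => by
          ext x
          rw [RingHom.id_apply, ZeroAtInftyContinuousMap.smul_apply,
            (heat_zeroAtInfty ht f).2.choose_spec, (heat_zeroAtInfty ht (c • f)).2.choose_spec]
          unfold heat
          rw [smul_eq_mul, ← integral_const_mul]
          simp [mul_left_comm] } 1 fun f => by
        rw [one_mul]
        refine norm_le_of_forall (norm_nonneg _) fun x => ?_
        change |(heat_zeroAtInfty ht f).2.choose x| ≤ ‖f‖
        rw [(heat_zeroAtInfty ht f).2.choose_spec]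
        exact abs_heat_le ht f x
  -- With the identity at nonpositive times the family is jointly continuous on the whole line
  -- (`continuous_heatOp`), and time `0` needs no one-sided treatment.
  else ContinuousLinearMap.id ℝ _

theorem heatOp_apply {N m : ℕ} {t : ℝ} (ht : 0 < t) (f : C₀(sector N m, ℝ)) (x : sector N m) :
    heatOp N m t f x = heat N m t f x := by
  rw [heatOp, dif_pos ht]
  exact (heat_zeroAtInfty ht f).2.choose_spec x

theorem heatOp_of_nonpos {N m : ℕ} {t : ℝ} (ht : t ≤ 0) (f : C₀(sector N m, ℝ)) :
    heatOp N m t f = f := by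
  rw [heatOp, dif_neg (not_lt.2 ht)]
  rfl

theorem norm_heatOp_le {N m : ℕ} (t : ℝ) (f : C₀(sector N m, ℝ)) : ‖heatOp N m t f‖ ≤ ‖f‖ := by
  rcases le_or_gt t 0 with ht | ht
  · rw [heatOp_of_nonpos ht]
  · refine norm_le_of_forall (norm_nonneg _) fun x => ?_
    rw [heatOp_apply ht]
    exact abs_heat_le ht f x

theorem abs_heatOp_le {N m : ℕ} (t : ℝ) {f g : C₀(sector N m, ℝ)} (h : ∀ x, |f x| ≤ g x)
    (x : sector N m) : |heatOp N m t f x| ≤ heatOp N m t g x := by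
  rcases le_or_gt t 0 with ht | ht
  · rw [heatOp_of_nonpos ht, heatOp_of_nonpos ht]; exact h x
  · rw [heatOp_apply ht, heatOp_apply ht]
    exact abs_heat_le_ae ht x (integrable_kernel_mul ht g x) (.of_forall h)

theorem heatOp_nonneg {N m : ℕ} (t : ℝ) {f : C₀(sector N m, ℝ)} (h : ∀ x, 0 ≤ f x)
    (x : sector N m) : 0 ≤ heatOp N m t f x :=
  (abs_nonneg _).trans (abs_heatOp_le t (f := f) (fun x => (abs_of_nonneg (h x)).le) x)

theorem heatOp_heatOp {N m : ℕ} {t s : ℝ} (ht : 0 ≤ t) (hs : 0 ≤ s) (f : C₀(sector N m, ℝ)) :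
    heatOp N m t (heatOp N m s f) = heatOp N m (t + s) f := by
  rcases ht.eq_or_lt with rfl | ht
  · rw [heatOp_of_nonpos le_rfl, zero_add]
  rcases hs.eq_or_lt with rfl | hs
  · rw [heatOp_of_nonpos le_rfl, add_zero]
  ext x
  rw [heatOp_apply ht, heatOp_apply (add_pos ht hs), ← heat_heat ht hs
    (map_continuous f).aestronglyMeasurable x (integrable_kernel_mul (add_pos ht hs) f x)]
  congr 1
  ext z
  exact heatOp_apply hs f z

/-! ### Strong continuity of the semigroup at time zero. -/

open Classical in
/-- Extension by zero to the whole space. -/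
def extendZero {N m : ℕ} (f : sector N m → ℝ) (y : EuclideanSpace ℝ (Fin N)) : ℝ :=
  if h : y ∈ sector N m then f ⟨y, h⟩ else 0

theorem extendZero_coe {N m : ℕ} (f : sector N m → ℝ) (y : sector N m) :
    extendZero f y = f y := by
  simp [extendZero]

theorem extendZero_of_notMem {N m : ℕ} (f : sector N m → ℝ) {y : EuclideanSpace ℝ (Fin N)}
    (hy : y ∉ sector N m) : extendZero f y = 0 := by
  simp [extendZero, hy]

theorem exists_isCompact_extendZero_lt {N m : ℕ} (f : C₀(sector N m, ℝ)) {ε : ℝ} (hε : 0 < ε) :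
    ∃ K ⊆ sector N m, IsCompact K ∧ ∀ y ∉ K, |extendZero f y| < ε := by
  have h := (Metric.tendsto_nhds.1 (zero_at_infty f)) ε hε
  rw [Filter.Eventually, mem_cocompact] at h
  obtain ⟨K, hK, hKf⟩ := h
  refine ⟨(↑) '' K, by rintro _ ⟨y, _, rfl⟩; exact y.2, hK.image continuous_subtype_val,
    fun y hy => ?_⟩
  by_cases hys : y ∈ sector N m
  · have h1 : (⟨y, hys⟩ : sector N m) ∈ Kᶜ := fun h => hy ⟨_, h, rfl⟩
    have := hKf h1
    rw [mem_ofPred_eq, dist_zero_right] at this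
    simpa [extendZero, hys] using this
  · rw [extendZero_of_notMem _ hys, abs_zero]; exact hε

theorem continuous_extendZero {N m : ℕ} (f : C₀(sector N m, ℝ)) :
    Continuous (extendZero f) := by
  rw [continuous_iff_continuousAt]
  intro x
  by_cases hx : x ∈ sector N m
  · have h : ContinuousAt (extendZero f ∘ Subtype.val) (⟨x, hx⟩ : sector N m) := by
      have : extendZero f ∘ Subtype.val = f := funext fun y => extendZero_coe f y
      rw [this]
      exact (map_continuous f).continuousAt
    exact ((isOpen_sector N m).isOpenEmbedding_subtypeVal.continuousAt_iff).1 h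
  · rw [ContinuousAt, extendZero_of_notMem _ hx, Metric.tendsto_nhds]
    intro ε hε
    obtain ⟨K, hKs, hK, hlt⟩ := exists_isCompact_extendZero_lt f hε
    filter_upwards [hK.isClosed.isOpen_compl.mem_nhds fun h => hx (hKs h)] with y hy
    rw [dist_zero_right]
    exact hlt y hy

/-- Uniform continuity handles `‖a - b‖ < δ`; beyond that the quadratic term dominates `2‖f‖`. The
quadratic form is chosen so that only the second moment of the Gaussian is needed. -/
theorem exists_modulus_extendZero {N m : ℕ} (f : C₀(sector N m, ℝ)) {ε : ℝ} (hε : 0 < ε) :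
    ∃ C, 0 ≤ C ∧ ∀ a b, |extendZero f a - extendZero f b| ≤ ε + C * ‖a - b‖ ^ 2 := by
  have hlim : Tendsto (extendZero f) (cocompact _) (𝓝 0) := by
    rw [Metric.tendsto_nhds]
    intro ε hε
    obtain ⟨K, -, hK, hlt⟩ := exists_isCompact_extendZero_lt f hε
    filter_upwards [hK.compl_mem_cocompact] with y hy
    rw [dist_zero_right]
    exact hlt y hy
  have hu := (continuous_extendZero f).uniformContinuous_of_tendsto_cocompact hlim
  obtain ⟨δ, hδ, hd⟩ := Metric.uniformContinuous_iff.1 hu ε hε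
  have hb : ∀ y, |extendZero f y| ≤ ‖f‖ := by
    intro y
    by_cases hy : y ∈ sector N m
    · simpa [extendZero, hy] using abs_apply_le_norm f ⟨y, hy⟩
    · rw [extendZero_of_notMem _ hy, abs_zero]; exact norm_nonneg _
  refine ⟨2 * ‖f‖ / δ ^ 2, by positivity, fun a b => ?_⟩
  rcases lt_or_ge ‖a - b‖ δ with h | h
  · have := hd (a := a) (b := b) (by rwa [dist_eq_norm])
    rw [Real.dist_eq] at this
    have h2 : 0 ≤ 2 * ‖f‖ / δ ^ 2 * ‖a - b‖ ^ 2 := by positivity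
    linarith
  · have h1 : |extendZero f a - extendZero f b| ≤ 2 * ‖f‖ := by
      have := abs_sub (extendZero f a) (extendZero f b)
      linarith [hb a, hb b]
    have h2 : 2 * ‖f‖ ≤ 2 * ‖f‖ / δ ^ 2 * ‖a - b‖ ^ 2 := by
      rw [div_mul_eq_mul_div, le_div_iff₀ (by positivity)]
      gcongr
    linarith

theorem abs_gauss_conv_sub_le {N : ℕ} {t : ℝ} (ht : 0 < t) {F : EuclideanSpace ℝ (Fin N) → ℝ}
    {ε C : ℝ} (hC : 0 ≤ C) (hF : Continuous F)
    (hmod : ∀ a b, |F a - F b| ≤ ε + C * ‖a - b‖ ^ 2) (x : EuclideanSpace ℝ (Fin N)) :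
    (Integrable fun y => gauss N t (x - y) * F y) ∧
      |(∫ y, gauss N t (x - y) * F y) - F x| ≤ ε + C * (8 * t * 2 ^ ((N : ℝ) / 2)) := by
  have h2t : 0 < 2 * t := by positivity
  have hb : Integrable fun y => gauss N t (x - y) * ε +
      C * (8 * t * 2 ^ ((N : ℝ) / 2)) * gauss N (2 * t) (x - y) :=
    ((integrable_gauss_sub ht x).mul_const _).add ((integrable_gauss_sub h2t x).const_mul _)
  have hle : ∀ y, ‖gauss N t (x - y) * (F y - F x)‖ ≤ gauss N t (x - y) * ε +
      C * (8 * t * 2 ^ ((N : ℝ) / 2)) * gauss N (2 * t) (x - y) := by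
    intro y
    rw [norm_mul, Real.norm_of_nonneg (gauss_pos ht _).le, Real.norm_eq_abs]
    have h1 := hmod y x
    have h2 := gauss_mul_norm_sq_le ht (x - y)
    rw [norm_sub_rev y x] at h1
    have h3 := gauss_pos (N := N) ht (x - y)
    calc _ ≤ gauss N t (x - y) * (ε + C * ‖x - y‖ ^ 2) := by gcongr
      _ = gauss N t (x - y) * ε + C * (gauss N t (x - y) * ‖x - y‖ ^ 2) := by ring
      _ ≤ gauss N t (x - y) * ε + C * (8 * t * 2 ^ ((N : ℝ) / 2) * gauss N (2 * t) (x - y)) := by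
        gcongr
      _ = _ := by ring
  have hcg : Continuous fun y => gauss N t (x - y) := (continuous_gauss N t).comp (by fun_prop)
  have hi : Integrable fun y => gauss N t (x - y) * (F y - F x) :=
    hb.mono' (hcg.mul (hF.sub continuous_const)).aestronglyMeasurable (.of_forall hle)
  have hi2 : Integrable fun y => gauss N t (x - y) * F x :=
    (integrable_gauss_sub ht x).mul_const _
  have hi3 : Integrable fun y => gauss N t (x - y) * F y := by
    refine (hi.add hi2).congr (.of_forall fun y => ?_)
    simp only [Pi.add_apply]; ring
  refine ⟨hi3, ?_⟩
  have heq : (∫ y, gauss N t (x - y) * F y) - F x = ∫ y, gauss N t (x - y) * (F y - F x) := by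
    simp_rw [mul_sub]
    rw [integral_sub hi3 hi2, integral_mul_const, integral_gauss_sub ht, one_mul]
  rw [heq]
  refine (norm_integral_le_of_norm_le hb (.of_forall hle)).trans_eq ?_
  rw [integral_add ((integrable_gauss_sub ht x).mul_const _)
    ((integrable_gauss_sub h2t x).const_mul _), integral_mul_const, integral_const_mul,
    integral_gauss_sub ht, integral_gauss_sub h2t]
  ring

theorem integral_sector_eq_extendZero {N m : ℕ} (h : EuclideanSpace ℝ (Fin N) → ℝ)
    (f : sector N m → ℝ) :
    ∫ y : sector N m, h y * f y = ∫ y, h y * extendZero f y := by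
  have h1 := integral_sector (m := m) fun y => h y * extendZero f y
  simp_rw [extendZero_coe] at h1
  rw [h1]
  refine setIntegral_eq_integral_of_forall_compl_eq_zero fun y hy => ?_
  rw [extendZero_of_notMem _ hy, mul_zero]

/-- The zero extension is uniformly continuous on the whole space, so its Gaussian averages
converge. The defect of the sector kernel consists of at most `N` averages of `|f|` around reflected
points; these lie outside the sector, where the extension vanishes, so each is bounded by the same
`B`. -/
theorem abs_heat_sub_le {N m : ℕ} {t : ℝ} (ht : 0 < t) (f : C₀(sector N m, ℝ)) {ε C : ℝ}
    (hC : 0 ≤ C) (hmod : ∀ a b, |extendZero f a - extendZero f b| ≤ ε + C * ‖a - b‖ ^ 2)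
    (x : sector N m) :
    |heat N m t f x - f x| ≤ (N + 1) * (ε + C * (8 * t * 2 ^ ((N : ℝ) / 2))) := by
  set B := ε + C * (8 * t * 2 ^ ((N : ℝ) / 2)) with hB
  have hcont := continuous_extendZero f
  have hxc := sector_subset_closedSector N m x.2
  obtain ⟨i1, h1⟩ := abs_gauss_conv_sub_le ht hC hcont hmod x
  have hB0 : 0 ≤ B := (abs_nonneg _).trans h1
  rw [extendZero_coe] at h1
  have habs : ∀ i : Fin N, Integrable (fun y : EuclideanSpace ℝ (Fin N) =>
      gauss N t (reflect i x - y) * |extendZero f y|) ∧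
      (i.val < m → ∫ y, gauss N t (reflect i x - y) * |extendZero f y| ≤ B) := by
    intro i
    obtain ⟨i2, h2⟩ := abs_gauss_conv_sub_le ht hC hcont.abs
      (fun a b => (abs_abs_sub_abs_le_abs_sub _ _).trans (hmod a b)) (reflect i x)
    refine ⟨i2, fun hi => ?_⟩
    have hr : reflect i (x : EuclideanSpace ℝ (Fin N)) ∉ sector N m := by
      intro h
      have h3 := h i hi
      rw [reflect_apply_self] at h3
      linarith [x.2 i hi]
    rw [extendZero_of_notMem _ hr, abs_zero, sub_zero] at h2
    exact (le_abs_self _).trans h2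
  have hsec : ∀ z : EuclideanSpace ℝ (Fin N),
      Integrable (fun y => gauss N t (z - y) * |extendZero f y|) →
      Integrable fun y : sector N m => gauss N t (z - y) * |f y| := by
    intro z hz
    have := integrable_sector_iff.2 (hz.integrableOn (s := sector N m))
    simpa only [extendZero_coe] using this
  have ig : Integrable fun y : sector N m =>
      gauss N t ((x : EuclideanSpace ℝ (Fin N)) - y) * f y := by
    have := integrable_sector_iff.2 (i1.integrableOn (s := sector N m))
    simpa only [extendZero_coe] using this
  have h4 : |heat N m t f x - ∫ y, gauss N t (x - y) * extendZero f y| ≤ N * B := by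
    rw [← integral_sector_eq_extendZero
      (fun y => gauss N t ((x : EuclideanSpace ℝ (Fin N)) - y)) f]
    unfold heat
    rw [← integral_sub (integrable_kernel_mul ht f x) ig]
    have hi : ∀ i : Fin N, Integrable fun y : sector N m =>
        (if i.val < m then gauss N t (reflect i x - y) else 0) * |f y| := by
      intro i
      split_ifs
      · exact hsec _ (habs i).1
      · simp
    rw [← Real.norm_eq_abs]
    calc _ ≤ ∫ y : sector N m, ∑ i : Fin N,
          (if i.val < m then gauss N t (reflect i x - y) else 0) * |f y| := by
          refine norm_integral_le_of_norm_le (integrable_finsetSum _ fun i _ => hi i)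
            (.of_forall fun y => ?_)
          have hy := sector_subset_closedSector N m y.2
          have h5 := gauss_sub_kernel_le ht hxc hy
          have h6 := kernel_le_gauss ht hxc hy
          rw [← sub_mul, norm_mul, ← Finset.sum_mul, Real.norm_eq_abs, Real.norm_eq_abs]
          gcongr
          rw [abs_sub_comm, abs_of_nonneg (by linarith)]
          exact h5
      _ = ∑ i : Fin N, ∫ y : sector N m,
          (if i.val < m then gauss N t (reflect i x - y) else 0) * |f y| :=
          integral_finsetSum _ fun i _ => hi i
      _ ≤ ∑ i : Fin N, B := by
          refine Finset.sum_le_sum fun i _ => ?_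
          split_ifs with him
          · have h7 := integral_sector_eq_extendZero
              (fun y => gauss N t (reflect i (x : EuclideanSpace ℝ (Fin N)) - y)) fun y => |f y|
            have h8 : (extendZero fun y => |f y|) = fun y => |extendZero f y| := by
              funext y
              unfold extendZero
              split_ifs <;> simp
            rw [h7, h8]
            exact (habs i).2 him
          · simpa using hB0
      _ = N * B := by simp
  calc _ ≤ |heat N m t f x - ∫ y, gauss N t (x - y) * extendZero f y| +
        |(∫ y, gauss N t (x - y) * extendZero f y) - f x| := abs_sub_le _ _ _
    _ ≤ N * B + B := add_le_add h4 h1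
    _ = _ := by ring

theorem tendsto_heatOp_zero {N m : ℕ} (f : C₀(sector N m, ℝ)) :
    Tendsto (fun t => ‖heatOp N m t f - f‖) (𝓝 0) (𝓝 0) := by
  rw [Metric.tendsto_nhds]
  intro ε hε
  obtain ⟨C, hC, hmod⟩ := exists_modulus_extendZero f
    (show 0 < ε / (2 * (N + 1)) by positivity)
  have hcont : Tendsto (fun t : ℝ => (N + 1) * (ε / (2 * (N + 1)) +
      C * (8 * t * 2 ^ ((N : ℝ) / 2)))) (𝓝 0) (𝓝 (ε / 2)) := by
    have : Continuous fun t : ℝ => (N + 1) * (ε / (2 * (N + 1)) +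
      C * (8 * t * 2 ^ ((N : ℝ) / 2))) := by fun_prop
    convert this.tendsto 0 using 2
    field_simp
    ring
  filter_upwards [hcont.eventually_lt_const (half_lt_self hε)] with t ht
  rw [dist_zero_right, norm_norm]
  rcases le_or_gt t 0 with h0 | h0
  · rw [heatOp_of_nonpos h0, sub_self, norm_zero]; exact hε
  · refine (norm_le_of_forall ?_ fun x => ?_).trans_lt ht
    · positivity
    · rw [ZeroAtInftyContinuousMap.sub_apply, heatOp_apply h0]
      exact abs_heat_sub_le h0 f hC hmod x

/-- The semigroup law and contractivity reduce continuity at any time to continuity at zero. -/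
theorem norm_heatOp_sub_heatOp_le {N m : ℕ} (t s : ℝ) (f : C₀(sector N m, ℝ)) :
    ‖heatOp N m t f - heatOp N m s f‖ ≤ ‖heatOp N m |max t 0 - max s 0| f - f‖ := by
  have key : ∀ t s : ℝ, s ≤ t → ‖heatOp N m t f - heatOp N m s f‖ ≤
      ‖heatOp N m |max t 0 - max s 0| f - f‖ := by
    intro t s hst
    rcases le_or_gt t 0 with ht | ht
    · rw [heatOp_of_nonpos ht, heatOp_of_nonpos (hst.trans ht), sub_self, norm_zero]
      exact norm_nonneg _
    rcases le_or_gt s 0 with hs | hs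
    · rw [heatOp_of_nonpos hs, max_eq_left ht.le, max_eq_right hs, sub_zero, abs_of_pos ht]
    · rw [max_eq_left ht.le, max_eq_left hs.le, abs_of_nonneg (sub_nonneg.2 hst)]
      have : heatOp N m t f = heatOp N m s (heatOp N m (t - s) f) := by
        rw [heatOp_heatOp hs.le (sub_nonneg.2 hst), add_sub_cancel]
      rw [this, ← map_sub]
      exact norm_heatOp_le s _
  rcases le_total s t with h | h
  · exact key t s h
  · rw [norm_sub_rev, abs_sub_comm]; exact key s t h

theorem continuous_heatOp (N m : ℕ) :
    Continuous fun p : ℝ × C₀(sector N m, ℝ) => heatOp N m p.1 p.2 := by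
  rw [continuous_iff_continuousAt]
  rintro ⟨s, g⟩
  rw [ContinuousAt, tendsto_iff_norm_sub_tendsto_zero]
  have h1 : Tendsto (fun p : ℝ × C₀(sector N m, ℝ) => ‖p.2 - g‖) (𝓝 (s, g)) (𝓝 0) := by
    have : Continuous fun p : ℝ × C₀(sector N m, ℝ) => ‖p.2 - g‖ := by fun_prop
    simpa using this.tendsto (s, g)
  have h2 : Tendsto (fun p : ℝ × C₀(sector N m, ℝ) =>
      ‖heatOp N m |max p.1 0 - max s 0| g - g‖) (𝓝 (s, g)) (𝓝 0) := by
    refine (tendsto_heatOp_zero g).comp ?_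
    have : Continuous fun p : ℝ × C₀(sector N m, ℝ) => |max p.1 0 - max s 0| := by fun_prop
    simpa using this.tendsto (s, g)
  have h3 := h1.add h2
  rw [add_zero] at h3
  refine squeeze_zero (fun _ => norm_nonneg _) (fun p => ?_) h3
  calc ‖heatOp N m p.1 p.2 - heatOp N m s g‖
      = ‖heatOp N m p.1 (p.2 - g) + (heatOp N m p.1 g - heatOp N m s g)‖ := by
        rw [map_sub]; congr 1; abel
    _ ≤ ‖heatOp N m p.1 (p.2 - g)‖ + ‖heatOp N m p.1 g - heatOp N m s g‖ := norm_add_le _ _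
    _ ≤ _ := add_le_add (norm_heatOp_le _ _) (norm_heatOp_sub_heatOp_le _ _ _)

/-! ### The linear flow of the initial values -/

open Classical in
/-- The element of `C₀` with the same values as `f`, if there is one. -/
def toC0 {N m : ℕ} (f : sector N m → ℝ) : C₀(sector N m, ℝ) :=
  if h : ∃ u : C₀(sector N m, ℝ), ∀ x, u x = f x then h.choose else 0

theorem toC0_apply {N m : ℕ} {f : sector N m → ℝ} (h : ∃ u : C₀(sector N m, ℝ), ∀ x, u x = f x)
    (x : sector N m) : toC0 f x = f x := by
  rw [toC0, dif_pos h]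
  exact h.choose_spec x

/-- `ψ` is measurable and `|ψ| ≤ k ψ₀` almost everywhere. -/
structure BoundedByPsi0 (N m : ℕ) (γ k : ℝ) (ψ : sector N m → ℝ) : Prop where
  nonneg : 0 ≤ k
  aesm : AEStronglyMeasurable ψ volume
  le : ∀ᵐ y, |ψ y| ≤ k * psi0 N m γ y

theorem pos_of_lt_cast {N : ℕ} {γ : ℝ} (hγ : 0 < γ) (hγN : γ < N) : 0 < N := by
  rcases Nat.eq_zero_or_pos N with rfl | h
  · simp at hγN; linarith
  · exact h

theorem ae_ne_zero {N : ℕ} (m : ℕ) (hN : 0 < N) :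
    ∀ᵐ y : sector N m, (y : EuclideanSpace ℝ (Fin N)) ≠ 0 := by
  have : Nonempty (Fin N) := ⟨⟨0, hN⟩⟩
  have h : ∀ᵐ y : EuclideanSpace ℝ (Fin N), y ≠ 0 := by
    rw [ae_iff]; simp
  have h2 : ∀ᵐ y ∂((volume : Measure (sector N m)).map Subtype.val), y ≠ 0 := by
    rw [map_volume_sector]; exact ae_restrict_of_ae h
  exact ae_of_ae_map (measurableEmbedding_coe N m).measurable.aemeasurable h2

theorem boundedByPsi0_of_mem_ball {N m : ℕ} {γ K : ℝ} (hγ : 0 < γ) (hγN : γ < N) (hK : 0 ≤ K)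
    {ψ : sector N m → ℝ} (hψ : ψ ∈ ball N m γ K) : BoundedByPsi0 N m γ K ψ := by
  refine ⟨hK, hψ.1.aestronglyMeasurable, ?_⟩
  have h := hψ.2
  rw [xNorm, eLpNorm_exponent_top] at h
  -- The origin, which lies in the sector only if `m = 0`, has to be discarded: there `psi0` takes
  -- the default value `0` and the quotient carries no information.
  filter_upwards [enorm_ae_le_eLpNormEssSup (fun x => ψ x / psi0 N m γ x) volume,
    ae_ne_zero m (pos_of_lt_cast hγ hγN)] with y hy hy0
  have h1 := hy.trans h
  rw [Real.enorm_eq_ofReal_abs, ENNReal.ofReal_le_ofReal_iff hK, abs_div,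
    abs_of_pos (psi0_pos hγ hy0), div_le_iff₀ (psi0_pos hγ hy0)] at h1
  exact h1

theorem BoundedByPsi0.const_mul {N m : ℕ} {γ k : ℝ} {ψ : sector N m → ℝ}
    (h : BoundedByPsi0 N m γ k ψ) {l : ℝ} (hl : 0 ≤ l) :
    BoundedByPsi0 N m γ (l * k) fun x => l * ψ x := by
  refine ⟨mul_nonneg hl h.nonneg, h.aesm.const_mul l, ?_⟩
  filter_upwards [h.le] with y hy
  rw [abs_mul, abs_of_nonneg hl, mul_assoc]
  gcongr

theorem boundedByPsi0_psi0 (N m : ℕ) {γ : ℝ} (hγ : 0 < γ) :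
    BoundedByPsi0 N m γ 1 (psi0 N m γ) :=
  ⟨zero_le_one, (measurable_psi0 N m γ).aestronglyMeasurable, .of_forall fun y => by
    rw [one_mul, abs_of_nonneg (psi0_nonneg hγ y)]⟩

/-- The standing assumptions on the dimensions and the exponent of `ψ₀`. -/
structure Admissible (N m : ℕ) (γ : ℝ) : Prop where
  le : m ≤ N
  pos : 0 < γ
  lt : γ < N

theorem BoundedByPsi0.heat_regular {N m : ℕ} {γ k : ℝ} (hA : Admissible N m γ)
    {ψ : sector N m → ℝ} (h : BoundedByPsi0 N m γ k ψ) {t : ℝ} (ht : 0 < t) :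
    (∀ x : sector N m, Integrable fun y : sector N m => kernel N m t x y * ψ y) ∧
      ∃ u : C₀(sector N m, ℝ), ∀ x, u x = heat N m t ψ x :=
  have := heat_of_le_psi0 hA.le hA.pos hA.lt ht h.aesm h.nonneg h.le
  ⟨fun x => this.1 x (sector_subset_closedSector N m x.2), this.2⟩

/-- `e^{tΔ} ψ` as an element of `C₀`. -/
def flow (N m : ℕ) (ψ : sector N m → ℝ) (t : ℝ) : C₀(sector N m, ℝ) := toC0 (heat N m t ψ)

theorem BoundedByPsi0.flow_apply {N m : ℕ} {γ k : ℝ} (hA : Admissible N m γ)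
    {ψ : sector N m → ℝ} (h : BoundedByPsi0 N m γ k ψ) {t : ℝ} (ht : 0 < t) (x : sector N m) :
    flow N m ψ t x = heat N m t ψ x :=
  toC0_apply (h.heat_regular hA ht).2 x

theorem flow_psi0_apply {N m : ℕ} {γ : ℝ} (hA : Admissible N m γ) {t : ℝ} (ht : 0 < t)
    (x : sector N m) : flow N m (psi0 N m γ) t x = Psi N m γ t x :=
  (boundedByPsi0_psi0 N m hA.pos).flow_apply hA ht x

theorem BoundedByPsi0.abs_flow_le {N m : ℕ} {γ k : ℝ} (hA : Admissible N m γ)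
    {ψ : sector N m → ℝ} (h : BoundedByPsi0 N m γ k ψ) {t : ℝ} (ht : 0 < t) (x : sector N m) :
    |flow N m ψ t x| ≤ k * Psi N m γ t x := by
  rw [h.flow_apply hA ht]
  refine (abs_heat_le_ae ht x ?_ h.le).trans_eq ?_
  · refine ((((boundedByPsi0_psi0 N m hA.pos).heat_regular hA ht).1 x).const_mul k).congr
      (.of_forall fun y => ?_)
    simp only; ring
  · unfold Psi heat
    rw [← integral_const_mul]
    refine integral_congr_ae (.of_forall fun y => ?_)
    simp only; ring

theorem BoundedByPsi0.heatOp_flow {N m : ℕ} {γ k : ℝ} (hA : Admissible N m γ)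
    {ψ : sector N m → ℝ} (h : BoundedByPsi0 N m γ k ψ) {s t : ℝ} (hs : 0 ≤ s) (ht : 0 < t) :
    heatOp N m s (flow N m ψ t) = flow N m ψ (s + t) := by
  rcases hs.eq_or_lt with rfl | hs
  · rw [heatOp_of_nonpos le_rfl, zero_add]
  ext x
  have hst := add_pos hs ht
  rw [heatOp_apply hs, h.flow_apply hA hst, ← heat_heat hs ht h.aesm x ((h.heat_regular hA hst).1 x)]
  congr 1
  ext z
  exact h.flow_apply hA ht z

/-- Near `t` the flow is the semigroup applied to its own value at time `t / 2`, which is already in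
`C₀`. -/
theorem BoundedByPsi0.continuousOn_flow {N m : ℕ} {γ k : ℝ} (hA : Admissible N m γ)
    {ψ : sector N m → ℝ} (h : BoundedByPsi0 N m γ k ψ) : ContinuousOn (flow N m ψ) (Ioi 0) := by
  intro t (ht : 0 < t)
  refine ContinuousAt.continuousWithinAt ?_
  have h1 : Continuous fun s => heatOp N m (s - t / 2) (flow N m ψ (t / 2)) :=
    (continuous_heatOp N m).comp (by fun_prop :
      Continuous fun s : ℝ => (s - t / 2, flow N m ψ (t / 2)))
  refine h1.continuousAt.congr ?_
  filter_upwards [lt_mem_nhds (half_lt_self ht)] with s hs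
  rw [h.heatOp_flow hA (by linarith) (by linarith), sub_add_cancel]

theorem Psi_pos {N m : ℕ} {γ : ℝ} (hA : Admissible N m γ) {t : ℝ} (ht : 0 < t) (x : sector N m) :
    0 < Psi N m γ t x := by
  unfold Psi heat
  have hnn : ∀ y : sector N m, 0 ≤ kernel N m t x y * psi0 N m γ y := fun y =>
    mul_nonneg (kernel_coe_nonneg ht x y) (psi0_nonneg hA.pos y)
  rw [integral_pos_iff_support_of_nonneg hnn
    (((boundedByPsi0_psi0 N m hA.pos).heat_regular hA ht).1 x)]
  have hae : (Function.support fun y : sector N m => kernel N m t x y * psi0 N m γ y)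
      =ᵐ[volume] univ := by
    rw [eventuallyEq_univ]
    filter_upwards [ae_ne_zero m (pos_of_lt_cast hA.pos hA.lt)] with y hy
    exact (mul_pos (kernel_pos ht x.2 y.2) (psi0_pos hA.pos hy)).ne'
  rw [measure_congr hae]
  exact isOpen_univ.measure_pos _ ⟨x, mem_univ x⟩

theorem nonempty_sector (N m : ℕ) : Nonempty (sector N m) :=
  ⟨⟨WithLp.toLp 2 fun _ => 1, fun i _ => by simp⟩⟩

/-! ### Scaling -/

theorem smul_mem_sector {N m : ℕ} {c : ℝ} (hc : 0 < c) {x : EuclideanSpace ℝ (Fin N)}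
    (hx : x ∈ sector N m) : c • x ∈ sector N m := fun i hi => by
  simpa using mul_pos hc (hx i hi)

/-- The dilation by the positive number `c`. -/
def dil {N m : ℕ} {c : ℝ} (hc : 0 < c) (x : sector N m) : sector N m :=
  ⟨c • (x : EuclideanSpace ℝ (Fin N)), smul_mem_sector hc x.2⟩

theorem dil_dil {N m : ℕ} {c d : ℝ} (hc : 0 < c) (hd : 0 < d) (h : c * d = 1) (x : sector N m) :
    dil hc (dil hd x) = x := by
  apply Subtype.ext
  simp [dil, smul_smul, h]

theorem kernel_smul {N m : ℕ} {c t : ℝ} (hc : 0 < c) (ht : 0 < t)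
    (x y : EuclideanSpace ℝ (Fin N)) :
    c ^ N * kernel N m (c ^ 2 * t) (c • x) (c • y) = kernel N m t x y := by
  have he : ∀ a : ℝ, Real.exp (-(c * a) ^ 2 / (4 * (c ^ 2 * t))) = Real.exp (-a ^ 2 / (4 * t)) := by
    intro a; congr 1; field_simp
  have h1 : c ^ N * (4 * Real.pi * (c ^ 2 * t)) ^ (-(N : ℝ) / 2) =
      (4 * Real.pi * t) ^ (-(N : ℝ) / 2) := by
    rw [show 4 * Real.pi * (c ^ 2 * t) = c ^ 2 * (4 * Real.pi * t) by ring,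
      Real.mul_rpow (by positivity) (by positivity), ← mul_assoc, ← Real.rpow_natCast c 2,
      ← Real.rpow_mul hc.le, ← Real.rpow_natCast, ← Real.rpow_add hc]
    rw [show (N : ℝ) + (2 : ℕ) * (-(N : ℝ) / 2) = 0 by push_cast; ring, Real.rpow_zero, one_mul]
  unfold kernel
  rw [← mul_assoc, h1]
  congr 1
  refine Finset.prod_congr rfl fun i _ => ?_
  simp only [PiLp.smul_apply, smul_eq_mul, ← mul_sub, ← mul_add, he]

open scoped Pointwise in
theorem smul_sector {N m : ℕ} {c : ℝ} (hc : 0 < c) : c • sector N m = sector N m := by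
  ext x
  rw [Set.mem_smul_set_iff_inv_smul_mem₀ hc.ne']
  constructor
  · intro h
    simpa [smul_smul, hc.ne'] using smul_mem_sector hc h
  · exact smul_mem_sector (inv_pos.2 hc)

theorem integral_dil {N m : ℕ} {c : ℝ} (hc : 0 < c) (f : sector N m → ℝ) :
    ∫ y : sector N m, f y = c ^ N * ∫ y : sector N m, f (dil hc y) := by
  have h1 : ∀ f : sector N m → ℝ, ∫ y : sector N m, f y = ∫ y in sector N m, extendZero f y := by
    intro f
    rw [← integral_sector]
    simp_rw [extendZero_coe]
  have h2 : ∫ y : sector N m, f (dil hc y) = ∫ y in sector N m, extendZero f (c • y) := by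
    rw [← integral_sector fun y => extendZero f (c • y)]
    refine integral_congr_ae (.of_forall fun y => ?_)
    exact (extendZero_coe f (dil hc y)).symm
  rw [h1, h2, Measure.setIntegral_comp_smul_of_pos _ _ _ hc, smul_sector hc, finrank_euclideanSpace,
    Fintype.card_fin, smul_eq_mul, mul_inv_cancel_left₀ (by positivity)]

theorem heat_dil {N m : ℕ} {c t : ℝ} (hc : 0 < c) (ht : 0 < t) (f : sector N m → ℝ)
    (x : sector N m) :
    heat N m (c ^ 2 * t) f (dil hc x) = heat N m t (fun y => f (dil hc y)) x := by
  unfold heat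
  rw [integral_dil hc, ← integral_const_mul]
  refine integral_congr_ae (.of_forall fun y => ?_)
  simp only [← mul_assoc]
  congr 1
  exact kernel_smul hc ht _ _

theorem psi0_dil {N m : ℕ} {γ c : ℝ} (hm : m ≤ N) (hc : 0 < c) (x : sector N m) :
    psi0 N m γ (dil hc x) = c ^ (-(γ + m)) * psi0 N m γ x := by
  have h : (∏ i : Fin N, if i.val < m then (dil hc x : EuclideanSpace ℝ (Fin N)) i else 1) =
      c ^ m * ∏ i : Fin N, if i.val < m then (x : EuclideanSpace ℝ (Fin N)) i else 1 := by
    have h1 : ∀ i : Fin N, (if i.val < m then (dil hc x : EuclideanSpace ℝ (Fin N)) i else 1) =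
        (if i.val < m then c else 1) *
          if i.val < m then (x : EuclideanSpace ℝ (Fin N)) i else 1 := by
      intro i
      split_ifs
      · simp [dil]
      · simp
    simp_rw [h1]
    rw [Finset.prod_mul_distrib, Finset.prod_ite, Finset.prod_const, Finset.prod_const, one_pow,
      mul_one, card_filter_lt hm]
  unfold psi0
  rw [h]
  have h2 : ‖(dil hc x : EuclideanSpace ℝ (Fin N))‖ = c * ‖(x : EuclideanSpace ℝ (Fin N))‖ := by
    simp [dil, norm_smul, abs_of_pos hc]
  have h3 : c ^ m * c ^ (-γ - 2 * (m : ℝ)) = c ^ (-(γ + m)) := by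
    rw [← Real.rpow_natCast, ← Real.rpow_add hc]; congr 1; ring
  rw [h2, Real.mul_rpow hc.le (norm_nonneg _), ← h3]
  ring

theorem heat_const_mul {N m : ℕ} (t l : ℝ) (f : sector N m → ℝ) (x : sector N m) :
    heat N m t (fun y => l * f y) x = l * heat N m t f x := by
  unfold heat
  rw [← integral_const_mul]
  refine integral_congr_ae (.of_forall fun y => ?_)
  simp only; ring

theorem Psi_dil {N m : ℕ} {γ c t : ℝ} (hm : m ≤ N) (hc : 0 < c) (ht : 0 < t) (x : sector N m) :
    Psi N m γ (c ^ 2 * t) (dil hc x) = c ^ (-(γ + m)) * Psi N m γ t x := by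
  unfold Psi
  rw [heat_dil hc ht]
  simp_rw [psi0_dil hm hc]
  rw [heat_const_mul]

theorem Psi_sqrt {N m : ℕ} {γ t : ℝ} (hm : m ≤ N) (ht : 0 < t) (x : sector N m) :
    Psi N m γ t (dil (Real.sqrt_pos.2 ht) x) = t ^ (-((γ + m) / 2)) * Psi N m γ 1 x := by
  have := Psi_dil (γ := γ) hm (Real.sqrt_pos.2 ht) one_pos x
  rw [Real.sq_sqrt ht.le, mul_one] at this
  rw [this, Real.sqrt_eq_rpow, ← Real.rpow_mul ht.le]
  congr 2
  ring

/-- Self-similarity: the dilation by `√t` is a bijection of the sector and turns `Psi` at time `1`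
into `Psi` at time `t` up to the power of `t`. -/
theorem norm_flow_psi0 {N m : ℕ} {γ : ℝ} (hA : Admissible N m γ) {t : ℝ} (ht : 0 < t) :
    ‖flow N m (psi0 N m γ) t‖ = t ^ (-((γ + m) / 2)) * ‖flow N m (psi0 N m γ) 1‖ := by
  apply le_antisymm
  · refine norm_le_of_forall (by positivity) fun x => ?_
    have hs := Real.sqrt_pos.2 ht
    rw [flow_psi0_apply hA ht, ← dil_dil hs (inv_pos.2 hs) (mul_inv_cancel₀ hs.ne') x,
      Psi_sqrt hA.le ht, abs_mul, abs_of_pos (Real.rpow_pos_of_pos ht _),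
      ← flow_psi0_apply hA one_pos]
    gcongr
    exact abs_apply_le_norm _ _
  · rw [← le_div_iff₀' (Real.rpow_pos_of_pos ht _)]
    refine norm_le_of_forall (by positivity) fun x => ?_
    rw [le_div_iff₀' (Real.rpow_pos_of_pos ht _), flow_psi0_apply hA one_pos,
      ← abs_of_pos (Real.rpow_pos_of_pos ht (-((γ + m) / 2))), ← abs_mul, ← Psi_sqrt hA.le ht,
      ← flow_psi0_apply hA ht]
    exact abs_apply_le_norm _ _

/-- Nonempty open sets have positive measure, so for a continuous function the essential supremum is
the supremum. -/
theorem eLpNorm_zeroAtInfty {N m : ℕ} (f : C₀(sector N m, ℝ)) :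
    eLpNorm f ⊤ volume = ENNReal.ofReal ‖f‖ := by
  rw [eLpNorm_exponent_top]
  apply le_antisymm
  · refine eLpNormEssSup_le_of_ae_bound (.of_forall fun x => ?_)
    exact abs_apply_le_norm f x
  · set c := eLpNormEssSup f volume with hc
    rcases eq_or_ne c ⊤ with h | h
    · rw [h]; exact le_top
    have hopen : IsOpen {y | c < ‖f y‖ₑ} :=
      isOpen_lt continuous_const (map_continuous f).enorm
    have h0 : volume {y | c < ‖f y‖ₑ} = 0 := by
      have := enorm_ae_le_eLpNormEssSup f volume
      rw [ae_iff] at this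
      simpa only [not_le] using this
    have hemp := hopen.eq_empty_of_measure_zero h0
    refine ENNReal.ofReal_le_of_le_toReal (norm_le_of_forall ENNReal.toReal_nonneg fun x => ?_)
    have hx : ¬ c < ‖f x‖ₑ := fun h => by
      have : x ∈ {y | c < ‖f y‖ₑ} := h
      rw [hemp] at this
      exact this
    rw [not_lt, Real.enorm_eq_ofReal_abs] at hx
    exact (ENNReal.ofReal_le_iff_le_toReal h).1 hx

theorem PsiIntegral_eq {N m : ℕ} {γ α T : ℝ} (hA : Admissible N m γ) (hα : 0 < α)
    (hα' : α * ((γ + m) / 2) < 1) (hT : 0 < T) :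
    PsiIntegral N m γ α T = ENNReal.ofReal (‖flow N m (psi0 N m γ) 1‖ ^ α *
      (T ^ (1 - α * ((γ + m) / 2)) / (1 - α * ((γ + m) / 2)))) := by
  set c := ‖flow N m (psi0 N m γ) 1‖ with hc
  set β := (γ + m) / 2 with hβ
  have h1 : PsiIntegral N m γ α T =
      ∫⁻ σ in Ioc 0 T, ENNReal.ofReal (c ^ α * σ ^ (-(α * β))) := by
    refine setLIntegral_congr_fun measurableSet_Ioc fun σ hσ => ?_
    have h2 : Psi N m γ σ = flow N m (psi0 N m γ) σ :=
      funext fun x => (flow_psi0_apply hA hσ.1 x).symm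
    rw [h2, eLpNorm_zeroAtInfty, ENNReal.ofReal_rpow_of_nonneg (norm_nonneg _) hα.le,
      norm_flow_psi0 hA hσ.1, Real.mul_rpow (Real.rpow_nonneg hσ.1.le _) (norm_nonneg _),
      ← Real.rpow_mul hσ.1.le, mul_comm]
    congr 3
    ring
  have hint : IntervalIntegrable (fun σ : ℝ => σ ^ (-(α * β))) volume 0 T :=
    intervalIntegral.intervalIntegrable_rpow' (by linarith)
  rw [h1, ← ofReal_integral_eq_lintegral_ofReal, integral_const_mul,
    ← intervalIntegral.integral_of_le hT.le, integral_rpow (Or.inl (by linarith))]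
  · congr 3
    · rw [neg_add_eq_sub, Real.zero_rpow (by linarith), sub_zero]
    · ring
  · exact (hint.1).const_mul _
  · filter_upwards [ae_restrict_mem measurableSet_Ioc] with σ hσ
    have := hσ.1
    exact mul_nonneg (by positivity) (Real.rpow_nonneg hσ.1.le _)

/-! ### The nonlinearity -/

/-- For equal signs this is the mean value inequality for `s ^ (α + 1)` on `[0, R]`; for opposite
signs `|a - b| = |a| + |b|`, and each term is bounded separately. -/
theorem abs_rpow_mul_self_sub_le {α R a b : ℝ} (hα : 0 < α) (ha : |a| ≤ R) (hb : |b| ≤ R) :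
    |(|a| ^ α * a) - |b| ^ α * b| ≤ (α + 1) * R ^ α * |a - b| := by
  have hR : 0 ≤ R := (abs_nonneg a).trans ha
  have hpos : ∀ a b : ℝ, 0 ≤ a → 0 ≤ b → a ≤ R → b ≤ R →
      |(|a| ^ α * a) - |b| ^ α * b| ≤ (α + 1) * R ^ α * |a - b| := by
    intro a b ha hb haR hbR
    have hmul : ∀ a : ℝ, 0 ≤ a → |a| ^ α * a = a ^ (α + 1) := fun a ha => by
      rw [abs_of_nonneg ha, Real.rpow_add_one' ha (by linarith)]
    rw [hmul a ha, hmul b hb]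
    have h := Convex.norm_image_sub_le_of_norm_hasDerivWithin_le (𝕜 := ℝ) (s := Icc 0 R)
      (f := fun s : ℝ => s ^ (α + 1)) (f' := fun s => (α + 1) * s ^ (α + 1 - 1))
      (C := (α + 1) * R ^ α)
      (fun s _ => (Real.hasDerivAt_rpow_const (Or.inr (by linarith))).hasDerivWithinAt)
      (fun s hs => by
        rw [add_sub_cancel_right, Real.norm_of_nonneg
          (mul_nonneg (by linarith) (Real.rpow_nonneg hs.1 _))]
        have := hs.1
        gcongr
        exact hs.2)
      (convex_Icc 0 R) ⟨hb, hbR⟩ ⟨ha, haR⟩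
    exact h
  have hopp : ∀ a b : ℝ, 0 ≤ a → b ≤ 0 → |a| ≤ R → |b| ≤ R →
      |(|a| ^ α * a) - |b| ^ α * b| ≤ (α + 1) * R ^ α * |a - b| := by
    intro a b ha hb haR hbR
    have h1 : |a| ^ α ≤ R ^ α := by gcongr
    have h2 : |b| ^ α ≤ R ^ α := by gcongr
    have h3 : 0 ≤ R ^ α := by positivity
    have h4 : 0 ≤ |a| ^ α := by positivity
    have h5 : 0 ≤ |b| ^ α := by positivity
    rw [abs_of_nonneg (by linarith : 0 ≤ a - b), abs_of_nonneg (by nlinarith)]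
    nlinarith [mul_nonneg hα.le (mul_nonneg h3 (by linarith : 0 ≤ a - b)),
      mul_le_mul_of_nonneg_right h1 ha, mul_le_mul_of_nonneg_right h2 (neg_nonneg.2 hb)]
  rcases le_total 0 a with h0 | h0 <;> rcases le_total 0 b with h1 | h1
  · exact hpos a b h0 h1 ((le_abs_self a).trans ha) ((le_abs_self b).trans hb)
  · exact hopp a b h0 h1 ha hb
  · rw [abs_sub_comm, abs_sub_comm a]; exact hopp b a h1 h0 hb ha
  · have := hpos (-a) (-b) (by linarith) (by linarith) ((neg_le_abs a).trans ha)
      ((neg_le_abs b).trans hb)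
    rw [abs_neg, abs_neg] at this
    rw [← abs_neg, ← abs_neg (a - b)]
    convert this using 2 <;> ring_nf

/-- The nonlinearity as a map of `C₀`. -/
def nl {N m : ℕ} (α : ℝ) (u : C₀(sector N m, ℝ)) : C₀(sector N m, ℝ) := toC0 (nonlin α u)

theorem nl_apply {N m : ℕ} {α : ℝ} (hα : 0 < α) (u : C₀(sector N m, ℝ)) (x : sector N m) :
    nl α u x = |u x| ^ α * u x := by
  have hc : Continuous fun r : ℝ => |r| ^ α * r :=
    (continuous_abs.rpow_const fun _ => Or.inr hα.le).mul continuous_id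
  refine toC0_apply (f := nonlin α u) ⟨⟨⟨fun x => |u x| ^ α * u x, hc.comp (map_continuous u)⟩, ?_⟩,
    fun x => rfl⟩ x
  have h := (hc.tendsto 0).comp (zero_at_infty u)
  rw [mul_zero] at h
  exact h

theorem coe_nl {N m : ℕ} {α : ℝ} (hα : 0 < α) (u : C₀(sector N m, ℝ)) :
    ⇑(nl α u) = nonlin α u := funext (nl_apply hα u)

theorem abs_nl_apply {N m : ℕ} {α : ℝ} (hα : 0 < α) (u : C₀(sector N m, ℝ)) (x : sector N m) :
    |nl α u x| = |u x| ^ α * |u x| := by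
  rw [nl_apply hα, abs_mul, abs_of_nonneg (by positivity : 0 ≤ |u x| ^ α)]

theorem norm_nl_sub_le {N m : ℕ} {α R : ℝ} (hα : 0 < α) {u v : C₀(sector N m, ℝ)}
    (hu : ‖u‖ ≤ R) (hv : ‖v‖ ≤ R) : ‖nl α u - nl α v‖ ≤ (α + 1) * R ^ α * ‖u - v‖ := by
  have hR : 0 ≤ R := (norm_nonneg u).trans hu
  refine norm_le_of_forall (by positivity) fun x => ?_
  rw [ZeroAtInftyContinuousMap.sub_apply, nl_apply hα, nl_apply hα]
  refine (abs_rpow_mul_self_sub_le hα ((abs_apply_le_norm u x).trans hu)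
    ((abs_apply_le_norm v x).trans hv)).trans ?_
  gcongr
  exact abs_apply_le_norm (u - v) x

theorem continuous_nl {N m : ℕ} {α : ℝ} (hα : 0 < α) :
    Continuous (nl α : C₀(sector N m, ℝ) → C₀(sector N m, ℝ)) := by
  rw [continuous_iff_continuousAt]
  intro v
  rw [ContinuousAt, tendsto_iff_norm_sub_tendsto_zero]
  have h1 : Tendsto (fun u : C₀(sector N m, ℝ) => (α + 1) * (‖v‖ + 1) ^ α * ‖u - v‖)
      (𝓝 v) (𝓝 0) := by
    have : Continuous fun u : C₀(sector N m, ℝ) => (α + 1) * (‖v‖ + 1) ^ α * ‖u - v‖ := by fun_prop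
    simpa using this.tendsto v
  refine squeeze_zero' (.of_forall fun _ => norm_nonneg _) ?_ h1
  filter_upwards [Metric.ball_mem_nhds v one_pos] with u hu
  rw [mem_ball_iff_norm] at hu
  refine norm_nl_sub_le hα ?_ (by linarith)
  have := norm_add_le (u - v) v
  rw [sub_add_cancel] at this
  linarith

/-! ### Weights and the Duhamel integral -/

/-- Evaluation at a point. -/
def evalCLM {N m : ℕ} (x : sector N m) : C₀(sector N m, ℝ) →L[ℝ] ℝ :=
  LinearMap.mkContinuous ⟨⟨fun f => f x, fun _ _ => rfl⟩, fun _ _ => rfl⟩ 1 fun f => by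
    rw [one_mul]; exact abs_apply_le_norm f x

theorem evalCLM_apply {N m : ℕ} (x : sector N m) (f : C₀(sector N m, ℝ)) :
    evalCLM x f = f x := rfl

theorem integral_apply {N m : ℕ} {s : Set ℝ} {h : ℝ → C₀(sector N m, ℝ)}
    (hh : IntegrableOn h s) (x : sector N m) : (∫ σ in s, h σ) x = ∫ σ in s, h σ x :=
  ((evalCLM x).integral_comp_comm hh).symm

/-- A weight compatible with the heat semigroup whose size at time `t` is at most `c t^{-β}`. -/
structure IsWeight {N m : ℕ} (W : ℝ → sector N m → ℝ) (c β : ℝ) : Prop where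
  const_nonneg : 0 ≤ c
  nonneg : ∀ t, 0 < t → ∀ x, 0 ≤ W t x
  le : ∀ t, 0 < t → ∀ x, W t x ≤ c * t ^ (-β)
  heat : ∀ σ t k, 0 < σ → σ ≤ t → 0 ≤ k → ∀ h : C₀(sector N m, ℝ),
    (∀ x, |h x| ≤ k * W σ x) → ∀ x, |heatOp N m (t - σ) h x| ≤ k * W t x

theorem isWeight_one (N m : ℕ) : IsWeight (fun _ (_ : sector N m) => 1) 1 0 where
  const_nonneg := zero_le_one
  nonneg _ _ _ := zero_le_one
  le _ _ _ := by simp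
  heat σ t k _ _ hk h hh x := by
    rw [mul_one]
    exact (abs_apply_le_norm _ x).trans ((norm_heatOp_le _ h).trans
      (norm_le_of_forall hk fun x => (hh x).trans_eq (mul_one k)))

/-- Compatibility with the semigroup is positivity of the kernel together with `e^{(t-σ)Δ} Psi σ =
Psi t`; the size is `norm_flow_psi0`. -/
theorem isWeight_Psi {N m : ℕ} {γ : ℝ} (hA : Admissible N m γ) :
    IsWeight (Psi N m γ) ‖flow N m (psi0 N m γ) 1‖ ((γ + m) / 2) where
  const_nonneg := norm_nonneg _
  nonneg t ht x := (Psi_pos hA ht x).le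
  le t ht x := by
    rw [← flow_psi0_apply hA ht, mul_comm, ← norm_flow_psi0 hA ht]
    exact (le_abs_self _).trans (abs_apply_le_norm _ x)
  heat σ t k hσ hσt hk h hh x := by
    have h1 := abs_heatOp_le (t - σ) (f := h) (g := k • flow N m (psi0 N m γ) σ) (fun x => by
      rw [ZeroAtInftyContinuousMap.smul_apply, flow_psi0_apply hA hσ]; exact hh x) x
    rwa [map_smul, (boundedByPsi0_psi0 N m hA.pos).heatOp_flow hA (sub_nonneg.2 hσt) hσ,
      sub_add_cancel, ZeroAtInftyContinuousMap.smul_apply, flow_psi0_apply hA (hσ.trans_le hσt)]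
      at h1

/-- The Duhamel integral `∫₀ᵗ e^{(t-σ)Δ} h(σ) dσ`. -/
def duhamel {N m : ℕ} (h : ℝ → C₀(sector N m, ℝ)) (t : ℝ) : C₀(sector N m, ℝ) :=
  ∫ σ in Ioo 0 t, heatOp N m (t - σ) (h σ)

theorem integrableOn_rpow_Ioo {p t : ℝ} (hp : p < 1) (ht : 0 < t) :
    IntegrableOn (fun σ : ℝ => σ ^ (-p)) (Ioo 0 t) := by
  rw [intervalIntegral.integrableOn_Ioo_rpow_iff ht]
  linarith

theorem integral_rpow_Ioo {p t : ℝ} (hp : p < 1) (ht : 0 < t) :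
    ∫ σ in Ioo 0 t, σ ^ (-p) = t ^ (1 - p) / (1 - p) := by
  rw [← integral_Ioc_eq_integral_Ioo, ← intervalIntegral.integral_of_le ht.le,
    integral_rpow (Or.inl (by linarith)), neg_add_eq_sub, Real.zero_rpow (by linarith), sub_zero]

theorem continuousOn_heatOp_comp {N m : ℕ} {h : ℝ → C₀(sector N m, ℝ)} {s : Set ℝ}
    (hh : ContinuousOn h s) (t : ℝ) : ContinuousOn (fun σ => heatOp N m (t - σ) (h σ)) s :=
  (continuous_heatOp N m).comp_continuousOn
    ((continuousOn_const.sub continuousOn_id).prodMk hh)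

section Duhamel

variable {N m : ℕ} {W : ℝ → sector N m → ℝ} {c β p B T : ℝ} {h : ℝ → C₀(sector N m, ℝ)}

theorem IsWeight.norm_heatOp_le (hW : IsWeight W c β) (hB : 0 ≤ B)
    (hb : ∀ σ ∈ Ioo 0 T, ∀ x, |h σ x| ≤ B * σ ^ (-p) * W σ x) {t σ : ℝ} (hσ : σ ∈ Ioo 0 T)
    (hσt : σ ≤ t) : ‖heatOp N m (t - σ) (h σ)‖ ≤ B * σ ^ (-p) * (c * t ^ (-β)) := by
  have h0 : 0 ≤ B * σ ^ (-p) := mul_nonneg hB (Real.rpow_nonneg hσ.1.le _)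
  have ht := hσ.1.trans_le hσt
  have := hW.const_nonneg
  refine norm_le_of_forall (mul_nonneg h0 (by positivity)) fun x => ?_
  exact (hW.heat σ t _ hσ.1 hσt h0 _ (hb σ hσ) x).trans
    (mul_le_mul_of_nonneg_left (hW.le t ht x) h0)

theorem IsWeight.integrableOn_heatOp (hW : IsWeight W c β) (hB : 0 ≤ B) (hp : p < 1)
    (hc : ContinuousOn h (Ioo 0 T))
    (hb : ∀ σ ∈ Ioo 0 T, ∀ x, |h σ x| ≤ B * σ ^ (-p) * W σ x) {t : ℝ} (ht : t ∈ Ioo 0 T) :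
    IntegrableOn (fun σ => heatOp N m (t - σ) (h σ)) (Ioo 0 t) := by
  have hsub : Ioo 0 t ⊆ Ioo 0 T := Ioo_subset_Ioo_right ht.2.le
  refine Integrable.mono' (((integrableOn_rpow_Ioo hp ht.1).const_mul B).mul_const (c * t ^ (-β)))
    ((continuousOn_heatOp_comp (hc.mono hsub) t).aestronglyMeasurable measurableSet_Ioo) ?_
  filter_upwards [ae_restrict_mem measurableSet_Ioo] with σ hσ
  exact hW.norm_heatOp_le hB hb (hsub hσ) hσ.2.le

theorem IsWeight.abs_duhamel_le (hW : IsWeight W c β) (hB : 0 ≤ B) (hp : p < 1)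
    (hc : ContinuousOn h (Ioo 0 T))
    (hb : ∀ σ ∈ Ioo 0 T, ∀ x, |h σ x| ≤ B * σ ^ (-p) * W σ x) {t : ℝ} (ht : t ∈ Ioo 0 T)
    (x : sector N m) : |duhamel h t x| ≤ B * (t ^ (1 - p) / (1 - p)) * W t x := by
  have hsub : Ioo 0 t ⊆ Ioo 0 T := Ioo_subset_Ioo_right ht.2.le
  rw [duhamel, integral_apply (hW.integrableOn_heatOp hB hp hc hb ht), ← Real.norm_eq_abs]
  refine (norm_integral_le_of_norm_le (((integrableOn_rpow_Ioo hp ht.1).const_mul B).mul_const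
    (W t x)) ?_).trans_eq ?_
  · filter_upwards [ae_restrict_mem measurableSet_Ioo] with σ hσ
    exact hW.heat σ t _ hσ.1 hσ.2.le (mul_nonneg hB (Real.rpow_nonneg hσ.1.le _)) _
      (hb σ (hsub hσ)) x
  · rw [integral_mul_const, integral_const_mul, integral_rpow_Ioo hp ht.1]

/-- The moving endpoint is put into an indicator over the fixed interval `(0, T)`, and dominated
convergence applies: the integrand is continuous in `t` at `t₀` except for `σ = t₀`, a null set. -/
theorem IsWeight.continuousOn_duhamel (hW : IsWeight W c β) (hB : 0 ≤ B) (hp : p < 1) (hβ : 0 ≤ β)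
    (hc : ContinuousOn h (Ioo 0 T))
    (hb : ∀ σ ∈ Ioo 0 T, ∀ x, |h σ x| ≤ B * σ ^ (-p) * W σ x) :
    ContinuousOn (duhamel h) (Ioo 0 T) := by
  intro t₀ ht₀
  refine ContinuousAt.continuousWithinAt ?_
  have hT : 0 < T := ht₀.1.trans ht₀.2
  have hcn := hW.const_nonneg
  have hnear : ∀ᶠ t in 𝓝 t₀, t ∈ Ioo (t₀ / 2) T :=
    Ioo_mem_nhds (half_lt_self ht₀.1) ht₀.2
  have heq : (fun t => ∫ σ in Ioo 0 T, (Ioo 0 t).indicator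
      (fun σ => heatOp N m (t - σ) (h σ)) σ) =ᶠ[𝓝 t₀] duhamel h := by
    filter_upwards [hnear] with t ht
    rw [duhamel, setIntegral_indicator measurableSet_Ioo,
      inter_eq_self_of_subset_right (Ioo_subset_Ioo_right ht.2.le)]
  refine ContinuousAt.congr ?_ heq
  refine continuousAt_of_dominated (bound := fun σ => B * σ ^ (-p) * (c * (t₀ / 2) ^ (-β)))
    ?_ ?_ (((integrableOn_rpow_Ioo hp hT).const_mul B).mul_const _) ?_
  · refine .of_forall fun t => AEStronglyMeasurable.indicator ?_ measurableSet_Ioo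
    exact (continuousOn_heatOp_comp hc t).aestronglyMeasurable measurableSet_Ioo
  · filter_upwards [hnear] with t ht
    filter_upwards [ae_restrict_mem measurableSet_Ioo] with σ hσ
    have h2 : 0 ≤ B * σ ^ (-p) := mul_nonneg hB (Real.rpow_nonneg hσ.1.le _)
    by_cases hσt : σ ∈ Ioo 0 t
    · rw [indicator_of_mem hσt]
      refine (hW.norm_heatOp_le hB hb hσ hσt.2.le).trans (mul_le_mul_of_nonneg_left ?_ h2)
      exact mul_le_mul_of_nonneg_left
        (Real.rpow_le_rpow_of_nonpos (half_pos ht₀.1) ht.1.le (by linarith)) hcn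
    · rw [indicator_of_notMem hσt, norm_zero]
      exact mul_nonneg h2 (mul_nonneg hcn (Real.rpow_nonneg (half_pos ht₀.1).le _))
  · have hne : ∀ᵐ σ ∂(volume.restrict (Ioo 0 T)), σ ≠ t₀ :=
      ae_restrict_of_ae (by rw [ae_iff]; simp)
    filter_upwards [hne, ae_restrict_mem measurableSet_Ioo] with σ hσ hσT
    rcases lt_or_gt_of_ne hσ with hlt | hgt
    · have h1 : Continuous fun t => heatOp N m (t - σ) (h σ) :=
        (continuous_heatOp N m).comp (by fun_prop : Continuous fun t : ℝ => (t - σ, h σ))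
      refine h1.continuousAt.congr ?_
      filter_upwards [lt_mem_nhds hlt] with t ht
      rw [indicator_of_mem (show σ ∈ Ioo 0 t from ⟨hσT.1, ht⟩)]
    · refine (continuousAt_const (y := (0 : C₀(sector N m, ℝ)))).congr ?_
      filter_upwards [gt_mem_nhds hgt] with t ht
      rw [indicator_of_notMem fun hmem => absurd hmem.2 (not_lt.2 ht.le)]

end Duhamel

/-! ### Mild solutions in weighted spaces -/

/-- `u` solves `u(t) = U(t) + a ∫₀ᵗ e^{(t-σ)Δ} |u|^α u dσ` on `(0, T)` with `|u| ≤ k W`. -/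
structure IsMild {N m : ℕ} (α a : ℝ) (W : ℝ → sector N m → ℝ) (U : ℝ → C₀(sector N m, ℝ))
    (T k : ℝ) (u : ℝ → C₀(sector N m, ℝ)) : Prop where
  cont : ContinuousOn u (Ioo 0 T)
  bound : ∀ t ∈ Ioo 0 T, ∀ x, |u t x| ≤ k * W t x
  eqn : ∀ t ∈ Ioo 0 T, u t = U t + a • duhamel (fun σ => nl α (u σ)) t

section Mild

variable {N m : ℕ} {α : ℝ} {W : ℝ → sector N m → ℝ} {c β k T : ℝ} {u v : ℝ → C₀(sector N m, ℝ)}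

theorem IsWeight.mul_rpow_le (hW : IsWeight W c β) (hα : 0 < α) (hk : 0 ≤ k) {σ : ℝ} (hσ : 0 < σ)
    (x : sector N m) : (k * W σ x) ^ α ≤ k ^ α * c ^ α * σ ^ (-(α * β)) := by
  have h0 := hW.nonneg σ hσ x
  have hc := hW.const_nonneg
  calc (k * W σ x) ^ α ≤ (k * (c * σ ^ (-β))) ^ α := by
        gcongr
        exact hW.le σ hσ x
    _ = k ^ α * c ^ α * σ ^ (-(α * β)) := by
        rw [Real.mul_rpow hk (by positivity), Real.mul_rpow hc (by positivity),
          ← Real.rpow_mul hσ.le, mul_assoc]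
        congr 3; ring

/-- One factor `W` is kept for the semigroup; the other `α` are replaced by the sup bound, which
produces the integrable singularity in `σ`. -/
theorem IsWeight.abs_nl_le (hW : IsWeight W c β) (hα : 0 < α) (hk : 0 ≤ k)
    (hu : ∀ t ∈ Ioo 0 T, ∀ x, |u t x| ≤ k * W t x) :
    ∀ σ ∈ Ioo 0 T, ∀ x, |nl α (u σ) x| ≤ k ^ (α + 1) * c ^ α * σ ^ (-(α * β)) * W σ x := by
  intro σ hσ x
  have h0 := hW.nonneg σ hσ.1 x
  rw [abs_nl_apply hα]
  calc _ ≤ (k * W σ x) ^ α * (k * W σ x) := by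
        gcongr
        exacts [hu σ hσ x, hu σ hσ x]
    _ ≤ k ^ α * c ^ α * σ ^ (-(α * β)) * (k * W σ x) := by
        gcongr
        exact hW.mul_rpow_le hα hk hσ.1 x
    _ = _ := by rw [Real.rpow_add_one' hk (by linarith)]; ring

theorem IsWeight.abs_nl_sub_le (hW : IsWeight W c β) (hα : 0 < α) (hk : 0 ≤ k) {d : ℝ}
    (hu : ∀ t ∈ Ioo 0 T, ∀ x, |u t x| ≤ k * W t x)
    (hv : ∀ t ∈ Ioo 0 T, ∀ x, |v t x| ≤ k * W t x)
    (huv : ∀ t ∈ Ioo 0 T, ∀ x, |u t x - v t x| ≤ d * W t x) :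
    ∀ σ ∈ Ioo 0 T, ∀ x, |(nl α (u σ) - nl α (v σ)) x| ≤
      (α + 1) * k ^ α * c ^ α * d * σ ^ (-(α * β)) * W σ x := by
  intro σ hσ x
  have h0 := hW.nonneg σ hσ.1 x
  have hd : 0 ≤ d * W σ x := (abs_nonneg _).trans (huv σ hσ x)
  rw [ZeroAtInftyContinuousMap.sub_apply, nl_apply hα, nl_apply hα]
  calc _ ≤ (α + 1) * (k * W σ x) ^ α * |u σ x - v σ x| :=
        abs_rpow_mul_self_sub_le hα (hu σ hσ x) (hv σ hσ x)
    _ ≤ (α + 1) * (k ^ α * c ^ α * σ ^ (-(α * β))) * (d * W σ x) := by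
        gcongr
        · have := hσ.1
          have := hW.const_nonneg
          positivity
        · exact hW.mul_rpow_le hα hk hσ.1 x
        · exact huv σ hσ x
    _ = _ := by ring

theorem IsWeight.integrableOn_nl (hW : IsWeight W c β) (hα : 0 < α) (hαβ : α * β < 1) (hk : 0 ≤ k)
    (hc : ContinuousOn u (Ioo 0 T)) (hu : ∀ t ∈ Ioo 0 T, ∀ x, |u t x| ≤ k * W t x) {t : ℝ}
    (ht : t ∈ Ioo 0 T) :
    IntegrableOn (fun σ => heatOp N m (t - σ) (nl α (u σ))) (Ioo 0 t) := by
  have := hW.const_nonneg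
  exact hW.integrableOn_heatOp (by positivity) hαβ ((continuous_nl hα).comp_continuousOn hc)
    (hW.abs_nl_le hα hk hu) ht

theorem IsWeight.abs_duhamel_nl_le (hW : IsWeight W c β) (hα : 0 < α) (hαβ : α * β < 1)
    (hk : 0 ≤ k) (hc : ContinuousOn u (Ioo 0 T))
    (hu : ∀ t ∈ Ioo 0 T, ∀ x, |u t x| ≤ k * W t x) {t : ℝ} (ht : t ∈ Ioo 0 T) (x : sector N m) :
    |duhamel (fun σ => nl α (u σ)) t x| ≤
      k ^ (α + 1) * (c ^ α * (T ^ (1 - α * β) / (1 - α * β))) * W t x := by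
  have hcn := hW.const_nonneg
  have h0 := hW.nonneg t ht.1 x
  have h1 : 0 < 1 - α * β := by linarith
  refine (hW.abs_duhamel_le (by positivity) hαβ ((continuous_nl hα).comp_continuousOn hc)
    (hW.abs_nl_le hα hk hu) ht x).trans ?_
  rw [mul_assoc (k ^ (α + 1))]
  have := ht.1
  gcongr
  exact ht.2.le

theorem IsWeight.abs_duhamel_nl_sub_le (hW : IsWeight W c β) (hα : 0 < α) (hαβ : α * β < 1)
    (hk : 0 ≤ k) {d : ℝ} (hd : 0 ≤ d) (huc : ContinuousOn u (Ioo 0 T))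
    (hvc : ContinuousOn v (Ioo 0 T))
    (hu : ∀ t ∈ Ioo 0 T, ∀ x, |u t x| ≤ k * W t x) (hv : ∀ t ∈ Ioo 0 T, ∀ x, |v t x| ≤ k * W t x)
    (huv : ∀ t ∈ Ioo 0 T, ∀ x, |u t x - v t x| ≤ d * W t x) {t : ℝ} (ht : t ∈ Ioo 0 T)
    (x : sector N m) :
    |duhamel (fun σ => nl α (u σ)) t x - duhamel (fun σ => nl α (v σ)) t x| ≤
      (α + 1) * k ^ α * (c ^ α * (T ^ (1 - α * β) / (1 - α * β))) * d * W t x := by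
  have hcn := hW.const_nonneg
  have h0 := hW.nonneg t ht.1 x
  have h1 : 0 < 1 - α * β := by linarith
  have hnc := continuous_nl (N := N) (m := m) hα
  have heq : duhamel (fun σ => nl α (u σ)) t - duhamel (fun σ => nl α (v σ)) t =
      duhamel (fun σ => nl α (u σ) - nl α (v σ)) t := by
    unfold duhamel
    rw [← integral_sub (hW.integrableOn_nl hα hαβ hk huc hu ht)
      (hW.integrableOn_nl hα hαβ hk hvc hv ht)]
    simp_rw [map_sub]
  rw [← ZeroAtInftyContinuousMap.sub_apply, heq]
  refine (hW.abs_duhamel_le (by positivity) hαβ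
    ((hnc.comp_continuousOn huc).sub (hnc.comp_continuousOn hvc))
    (hW.abs_nl_sub_le hα hk hu hv huv) ht x).trans ?_
  have := ht.1
  calc _ ≤ (α + 1) * k ^ α * c ^ α * d * (T ^ (1 - α * β) / (1 - α * β)) * W t x := by
        gcongr
        exact ht.2.le
    _ = _ := by ring

/-- Substituting the equation into itself multiplies the weighted bound for the difference by `θ <
1`, starting from `2 * k`; letting the number of substitutions grow gives zero without setting up a
complete metric space. -/
theorem IsMild.eq_of_lt_one {a : ℝ} {U : ℝ → C₀(sector N m, ℝ)} (hW : IsWeight W c β) (hα : 0 < α)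
    (hαβ : α * β < 1) (hk : 0 ≤ k) (ha : |a| ≤ 1)
    (hθ : (α + 1) * k ^ α * (c ^ α * (T ^ (1 - α * β) / (1 - α * β))) < 1)
    (hu : IsMild α a W U T k u) (hv : IsMild α a W U T k v) : ∀ t ∈ Ioo 0 T, u t = v t := by
  intro t₀ ht₀
  have hT : 0 < T := ht₀.1.trans ht₀.2
  set θ := (α + 1) * k ^ α * (c ^ α * (T ^ (1 - α * β) / (1 - α * β))) with hθd
  have hcn := hW.const_nonneg
  have h1 : 0 < 1 - α * β := by linarith
  have hθ0 : 0 ≤ θ := by positivity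
  have key : ∀ n : ℕ, ∀ t ∈ Ioo 0 T, ∀ x, |u t x - v t x| ≤ θ ^ n * (2 * k) * W t x := by
    intro n
    induction n with
    | zero =>
      intro t ht x
      have := abs_sub (u t x) (v t x)
      have h2 := hu.bound t ht x
      have h3 := hv.bound t ht x
      rw [pow_zero, one_mul]
      linarith
    | succ n ih =>
      intro t ht x
      have h2 := hW.abs_duhamel_nl_sub_le hα hαβ hk (by positivity) hu.cont hv.cont hu.bound
        hv.bound ih ht x
      rw [hu.eqn t ht, hv.eqn t ht]
      simp only [ZeroAtInftyContinuousMap.add_apply, ZeroAtInftyContinuousMap.smul_apply,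
        add_sub_add_left_eq_sub, smul_eq_mul, ← mul_sub, abs_mul]
      refine (mul_le_of_le_one_left (abs_nonneg _) ha).trans (h2.trans_eq ?_)
      rw [← hθd]; ring
  ext x
  have hlim : Tendsto (fun n : ℕ => θ ^ n * (2 * k) * W t₀ x) atTop (𝓝 0) := by
    have := ((tendsto_pow_atTop_nhds_zero_of_lt_one hθ0 hθ).mul_const (2 * k)).mul_const (W t₀ x)
    simpa using this
  have := ge_of_tendsto' hlim fun n => key n t₀ ht₀ x
  exact sub_eq_zero.1 (abs_nonpos_iff.1 this)

/-- The Picard iterates. -/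
def picard (α a : ℝ) (U : ℝ → C₀(sector N m, ℝ)) : ℕ → ℝ → C₀(sector N m, ℝ)
  | 0 => U
  | n + 1 => fun t => U t + a • duhamel (fun σ => nl α (picard α a U n σ)) t

/-- Picard iteration: `hK` keeps the iterates in the ball of radius `k` for the weighted norm, and
`hθ` makes consecutive differences decay geometrically. -/
theorem exists_isMild {a K : ℝ} {U : ℝ → C₀(sector N m, ℝ)} (hW : IsWeight W c β) (hα : 0 < α)
    (hβ : 0 ≤ β) (hαβ : α * β < 1) (hk : 0 ≤ k) (ha : |a| ≤ 1)
    (hUc : ContinuousOn U (Ioo 0 T)) (hU : ∀ t ∈ Ioo 0 T, ∀ x, |U t x| ≤ K * W t x)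
    (hK : K + k ^ (α + 1) * (c ^ α * (T ^ (1 - α * β) / (1 - α * β))) ≤ k)
    (hθ : (α + 1) * k ^ α * (c ^ α * (T ^ (1 - α * β) / (1 - α * β))) < 1) (hT : 0 < T) :
    ∃ u, IsMild α a W U T k u := by
  set θ := (α + 1) * k ^ α * (c ^ α * (T ^ (1 - α * β) / (1 - α * β))) with hθd
  have hcn := hW.const_nonneg
  have h1 : 0 < 1 - α * β := by linarith
  have hθ0 : 0 ≤ θ := by positivity
  have hnc := continuous_nl (N := N) (m := m) hα
  have hstep : ∀ w : ℝ → C₀(sector N m, ℝ), ContinuousOn w (Ioo 0 T) →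
      (∀ t ∈ Ioo 0 T, ∀ x, |w t x| ≤ k * W t x) → ∀ t ∈ Ioo 0 T, ∀ x,
      |(U t + a • duhamel (fun σ => nl α (w σ)) t) x| ≤ k * W t x := by
    intro w hwc hw t ht x
    have h2 := hW.abs_duhamel_nl_le hα hαβ hk hwc hw ht x
    rw [ZeroAtInftyContinuousMap.add_apply, ZeroAtInftyContinuousMap.smul_apply, smul_eq_mul]
    refine (abs_add_le _ _).trans ?_
    rw [abs_mul]
    have h3 : |a| * |duhamel (fun σ => nl α (w σ)) t x| ≤ |duhamel (fun σ => nl α (w σ)) t x| :=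
      mul_le_of_le_one_left (abs_nonneg _) ha
    have h4 := hU t ht x
    have h5 := mul_le_mul_of_nonneg_right hK (hW.nonneg t ht.1 x)
    linarith
  have hP : ∀ n, ContinuousOn (picard α a U n) (Ioo 0 T) ∧
      ∀ t ∈ Ioo 0 T, ∀ x, |picard α a U n t x| ≤ k * W t x := by
    intro n
    induction n with
    | zero =>
      refine ⟨hUc, fun t ht x => (hU t ht x).trans ?_⟩
      refine mul_le_mul_of_nonneg_right ?_ (hW.nonneg t ht.1 x)
      have : 0 ≤ k ^ (α + 1) * (c ^ α * (T ^ (1 - α * β) / (1 - α * β))) := by positivity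
      linarith
    | succ n ih =>
      refine ⟨hUc.add (ContinuousOn.const_smul ?_ a), hstep _ ih.1 ih.2⟩
      exact hW.continuousOn_duhamel (by positivity) hαβ hβ (hnc.comp_continuousOn ih.1)
        (hW.abs_nl_le hα hk ih.2)
  have hD : ∀ n, ∀ t ∈ Ioo 0 T, ∀ x,
      |picard α a U n t x - picard α a U (n + 1) t x| ≤ 2 * k * θ ^ n * W t x := by
    intro n
    induction n with
    | zero =>
      intro t ht x
      have := abs_sub (picard α a U 0 t x) (picard α a U 1 t x)
      have h2 := (hP 0).2 t ht x
      have h3 := (hP 1).2 t ht x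
      rw [pow_zero, mul_one]
      linarith
    | succ n ih =>
      intro t ht x
      have h2 := hW.abs_duhamel_nl_sub_le hα hαβ hk (by positivity) (hP n).1 (hP (n + 1)).1
        (hP n).2 (hP (n + 1)).2 ih ht x
      change |(U t + a • duhamel (fun σ => nl α (picard α a U n σ)) t) x -
        (U t + a • duhamel (fun σ => nl α (picard α a U (n + 1) σ)) t) x| ≤ _
      simp only [ZeroAtInftyContinuousMap.add_apply, ZeroAtInftyContinuousMap.smul_apply,
        add_sub_add_left_eq_sub, smul_eq_mul, ← mul_sub, abs_mul]
      refine (mul_le_of_le_one_left (abs_nonneg _) ha).trans (h2.trans_eq ?_)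
      rw [← hθd]; ring
  have hlim : ∀ t ∈ Ioo 0 T, ∃ l, Tendsto (fun n => picard α a U n t) atTop (𝓝 l) := by
    intro t ht
    refine cauchySeq_tendsto_of_complete (cauchySeq_of_le_geometric θ
      (2 * k * (c * t ^ (-β))) hθ fun n => ?_)
    have htp := ht.1
    rw [dist_eq_norm]
    refine norm_le_of_forall (by positivity) fun x => ?_
    rw [ZeroAtInftyContinuousMap.sub_apply]
    refine (hD n t ht x).trans ?_
    have := hW.le t ht.1 x
    calc _ = 2 * k * θ ^ n * W t x := rfl
      _ ≤ 2 * k * θ ^ n * (c * t ^ (-β)) := by gcongr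
      _ = _ := by ring
  choose! u hu using hlim
  have hux : ∀ t ∈ Ioo 0 T, ∀ x, Tendsto (fun n => picard α a U n t x) atTop (𝓝 (u t x)) :=
    fun t ht x => ((evalCLM x).continuous.tendsto _).comp (hu t ht)
  have herr : ∀ n, ∀ t ∈ Ioo 0 T, ∀ x,
      |picard α a U n t x - u t x| ≤ 2 * k / (1 - θ) * θ ^ n * W t x := by
    intro n t ht x
    have h2 := dist_le_of_le_geometric_of_tendsto θ (2 * k * W t x) hθ
      (fun n => by
        rw [Real.dist_eq]
        exact (hD n t ht x).trans_eq (by ring)) (hux t ht x) n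
    rw [Real.dist_eq] at h2
    exact h2.trans_eq (by ring)
  have hθ1 : 0 < 1 - θ := by linarith
  have hbound : ∀ t ∈ Ioo 0 T, ∀ x, |u t x| ≤ k * W t x := fun t ht x =>
    le_of_tendsto' (hux t ht x).abs fun n => (hP n).2 t ht x
  have hcont : ContinuousOn u (Ioo 0 T) := by
    intro t₀ ht₀
    -- The weight is unbounded as `t → 0` in general, so convergence in sup norm is made uniform
    -- only away from `0`; that suffices for continuity on the open interval.
    have hU' : TendstoUniformlyOn (fun n t => picard α a U n t) u atTop (Ioo (t₀ / 2) T) := by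
      rw [Metric.tendstoUniformlyOn_iff]
      intro ε hε
      have h2 : Tendsto (fun n : ℕ => 2 * k / (1 - θ) * θ ^ n * (c * (t₀ / 2) ^ (-β)))
          atTop (𝓝 0) := by
        have := ((tendsto_pow_atTop_nhds_zero_of_lt_one hθ0 hθ).const_mul
          (2 * k / (1 - θ))).mul_const (c * (t₀ / 2) ^ (-β))
        simpa using this
      filter_upwards [h2.eventually_lt_const hε] with n hn t ht
      have ht2 : 0 < t₀ / 2 := half_pos ht₀.1
      have ht' : t ∈ Ioo 0 T := ⟨ht2.trans ht.1, ht.2⟩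
      rw [dist_comm, dist_eq_norm]
      refine (norm_le_of_forall (by positivity) fun x => ?_).trans_lt hn
      rw [ZeroAtInftyContinuousMap.sub_apply]
      refine (herr n t ht' x).trans ?_
      gcongr
      exact (hW.le t ht'.1 x).trans (mul_le_mul_of_nonneg_left
        (Real.rpow_le_rpow_of_nonpos ht2 ht.1.le (by linarith)) hcn)
    have h3 : ContinuousOn u (Ioo (t₀ / 2) T) := hU'.continuousOn
      (.of_forall fun n => (hP n).1.mono (Ioo_subset_Ioo_left (half_pos ht₀.1).le))
    exact (h3.continuousAt (Ioo_mem_nhds (half_lt_self ht₀.1) ht₀.2)).continuousWithinAt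
  refine ⟨u, hcont, hbound, fun t ht => ?_⟩
  ext x
  refine tendsto_nhds_unique ((tendsto_add_atTop_iff_nat 1).2 (hux t ht x)) ?_
  rw [tendsto_iff_norm_sub_tendsto_zero]
  have h2 : Tendsto (fun n : ℕ => θ * (2 * k / (1 - θ) * θ ^ n) * W t x) atTop (𝓝 0) := by
    have := (((tendsto_pow_atTop_nhds_zero_of_lt_one hθ0 hθ).const_mul
      (2 * k / (1 - θ))).const_mul θ).mul_const (W t x)
    simpa using this
  refine squeeze_zero (fun _ => norm_nonneg _) (fun n => ?_) h2
  have h3 := hW.abs_duhamel_nl_sub_le hα hαβ hk (by positivity) (hP n).1 hcont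
        (hP n).2 hbound (herr n) ht x
  change |(U t + a • duhamel (fun σ => nl α (picard α a U n σ)) t) x -
    (U t + a • duhamel (fun σ => nl α (u σ)) t) x| ≤ _
  simp only [ZeroAtInftyContinuousMap.add_apply, ZeroAtInftyContinuousMap.smul_apply,
    add_sub_add_left_eq_sub, smul_eq_mul, ← mul_sub, abs_mul]
  exact (mul_le_of_le_one_left (abs_nonneg _) ha).trans h3

end Mild

/-! ### Solutions as `C₀`-valued functions -/

theorem exists_real_gt_of_ofReal_lt {t : ℝ} {S : ℝ≥0∞} (ht : 0 ≤ t) (h : ENNReal.ofReal t < S) :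
    ∃ t₂, t < t₂ ∧ ENNReal.ofReal t₂ < S := by
  obtain ⟨r, h1, h2⟩ := ENNReal.lt_iff_exists_nnreal_btwn.1 h
  refine ⟨r, ?_, by rwa [ENNReal.ofReal_coe_nnreal]⟩
  rw [← ENNReal.ofReal_coe_nnreal] at h1
  exact (ENNReal.ofReal_lt_ofReal_iff_of_nonneg ht).1 h1

theorem ofReal_lt_of_le {s t : ℝ} {S : ℝ≥0∞} (hst : s ≤ t) (h : ENNReal.ofReal t < S) :
    ENNReal.ofReal s < S :=
  (ENNReal.ofReal_le_ofReal hst).trans_lt h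

theorem exists_pos_forall_mul_rpow_lt (C : ℝ) {p : ℝ} (hp : 0 < p) :
    ∃ δ > 0, ∀ τ, 0 < τ → τ ≤ δ → C * τ ^ p < 1 := by
  have h : Tendsto (fun τ : ℝ => C * τ ^ p) (𝓝 0) (𝓝 0) := by
    have hc : Continuous fun τ : ℝ => C * τ ^ p :=
      continuous_const.mul (continuous_id.rpow_const fun _ => Or.inr hp.le)
    have := hc.tendsto 0
    rwa [Real.zero_rpow hp.ne', mul_zero] at this
  obtain ⟨δ, hδ, hd⟩ := Metric.eventually_nhds_iff.1 (h.eventually_lt_const one_pos)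
  refine ⟨δ / 2, half_pos hδ, fun τ h0 hτ => hd ?_⟩
  rw [Real.dist_eq, sub_zero, abs_of_pos h0]
  linarith

theorem C0_smul_add {N m : ℕ} (a : ℝ) (f g : C₀(sector N m, ℝ)) :
    a • (f + g) = a • f + a • g := by
  ext x
  simp [mul_add]

/-- The mild equation in `C₀`, with Bochner integrals. -/
structure IsVecSolution (N m : ℕ) (γ α a : ℝ) (ψ : sector N m → ℝ) (S : ℝ≥0∞)
    (u : ℝ → C₀(sector N m, ℝ)) : Prop where
  continuousOn : ContinuousOn u {t | 0 < t ∧ ENNReal.ofReal t < S}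
  bound : ∃ τ k : ℝ, 0 < τ ∧ 0 ≤ k ∧ ENNReal.ofReal τ < S ∧
    ∀ t ∈ Ioc 0 τ, ∀ x, |u t x| ≤ k * Psi N m γ t x
  eqn : ∀ t, 0 < t → ENNReal.ofReal t < S →
    u t = flow N m ψ t + a • duhamel (fun σ => nl α (u σ)) t

/-- The standing assumptions on all parameters. -/
structure Params (N m : ℕ) (γ α : ℝ) : Prop extends Admissible N m γ where
  α_pos : 0 < α
  lt_one : α * ((γ + m) / 2) < 1

section

variable {N m : ℕ} {γ α a : ℝ} {ψ : sector N m → ℝ} {S : ℝ≥0∞} {u v : ℝ → C₀(sector N m, ℝ)}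

theorem Params.β_nonneg (hP : Params N m γ α) : 0 ≤ (γ + m) / 2 := by
  have := hP.pos; positivity

/-- The bound by `Psi` is available only up to `τ`. On `(0, r)` with `r < τ` the weighted estimate
at time `r` is transported by `e^{(t-r)Δ}`; on `[r, t]` the integrand is continuous. -/
theorem Params.integrableOn (hP : Params N m γ α)
    (hc : ContinuousOn u {t | 0 < t ∧ ENNReal.ofReal t < S}) {τ k : ℝ} (hτ : 0 < τ) (hk : 0 ≤ k)
    (hb : ∀ t ∈ Ioc 0 τ, ∀ x, |u t x| ≤ k * Psi N m γ t x) (hτS : ENNReal.ofReal τ < S)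
    {t : ℝ} (ht : 0 < t) (htS : ENNReal.ofReal t < S) :
    IntegrableOn (fun σ => heatOp N m (t - σ) (nl α (u σ))) (Ioo 0 t) := by
  set r := min τ t / 2 with hr
  have hm : 0 < min τ t := lt_min hτ ht
  have hr0 : 0 < r := half_pos hm
  have hrτ : r < τ := (half_lt_self hm).trans_le (min_le_left _ _)
  have hrt : r < t := (half_lt_self hm).trans_le (min_le_right _ _)
  have h1 : IntegrableOn (fun σ => heatOp N m (r - σ) (nl α (u σ))) (Ioo 0 r) :=
    (isWeight_Psi hP.toAdmissible).integrableOn_nl (T := τ) hP.α_pos hP.lt_one hk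
      (hc.mono fun s hs => ⟨hs.1, ofReal_lt_of_le hs.2.le hτS⟩)
      (fun s hs => hb s ⟨hs.1, hs.2.le⟩) ⟨hr0, hrτ⟩
  have h2 : IntegrableOn (fun σ => heatOp N m (t - σ) (nl α (u σ))) (Ioo 0 r) := by
    refine IntegrableOn.congr_fun (f := fun σ => heatOp N m (t - r)
      (heatOp N m (r - σ) (nl α (u σ)))) ((heatOp N m (t - r)).integrable_comp h1)
      (fun σ hσ => ?_) measurableSet_Ioo
    simp only
    rw [heatOp_heatOp (by linarith) (by linarith [hσ.2])]
    congr 2; ring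
  have h3 : IntegrableOn (fun σ => heatOp N m (t - σ) (nl α (u σ))) (Icc r t) := by
    refine (continuousOn_heatOp_comp ((continuous_nl hP.α_pos).comp_continuousOn
      (hc.mono fun s hs => ?_)) t).integrableOn_Icc
    exact ⟨hr0.trans_le hs.1, ofReal_lt_of_le hs.2 htS⟩
  refine (h2.union h3).mono_set fun s hs => ?_
  rcases lt_or_ge s r with h | h
  · exact Or.inl ⟨hs.1, h⟩
  · exact Or.inr ⟨h, hs.2.le⟩

theorem IsVecSolution.integrableOn (hP : Params N m γ α) (hu : IsVecSolution N m γ α a ψ S u)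
    {t : ℝ} (ht : 0 < t) (htS : ENNReal.ofReal t < S) :
    IntegrableOn (fun σ => heatOp N m (t - σ) (nl α (u σ))) (Ioo 0 t) := by
  obtain ⟨τ, k, hτ, hk, hτS, hb⟩ := hu.bound
  exact hP.integrableOn hu.continuousOn hτ hk hb hτS ht htS

theorem heat_nonlin_eq (hα : 0 < α) (u : ℝ → C₀(sector N m, ℝ)) {t σ : ℝ} (h : σ < t) :
    heat N m (t - σ) (nonlin α (u σ)) = heatOp N m (t - σ) (nl α (u σ)) := by
  ext x
  rw [heatOp_apply (sub_pos.2 h), coe_nl hα]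

/-- The pointwise integral equation and the Bochner one agree because evaluation at a point is a
continuous functional. Absolute convergence is automatic from continuity and the bound near `0`. -/
theorem isSolution_iff {k₀ : ℝ} (hP : Params N m γ α) (hψ : BoundedByPsi0 N m γ k₀ ψ) :
    IsSolution N m γ α a ψ S u ↔ IsVecSolution N m γ α a ψ S u := by
  have key : ∀ t, 0 < t → IntegrableOn (fun σ => heatOp N m (t - σ) (nl α (u σ))) (Ioo 0 t) →
      ∀ x, (flow N m ψ t + a • duhamel (fun σ => nl α (u σ)) t) x =
        heat N m t ψ x + a * ∫ σ in Ioo 0 t, heat N m (t - σ) (nonlin α (u σ)) x := by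
    intro t ht hi x
    rw [ZeroAtInftyContinuousMap.add_apply, ZeroAtInftyContinuousMap.smul_apply, smul_eq_mul,
      hψ.flow_apply hP.toAdmissible ht, duhamel, integral_apply hi]
    congr 2
    refine setIntegral_congr_fun measurableSet_Ioo fun σ hσ => ?_
    rw [heat_nonlin_eq hP.α_pos u hσ.2]
  constructor
  · intro h
    obtain ⟨τ, k, hτ, hτS, hb⟩ := h.bound
    -- `IsSolution` does not prescribe the sign of its constant; the weighted estimates need a
    -- nonnegative one.
    have hb' : ∀ t ∈ Ioc 0 τ, ∀ x, |u t x| ≤ max k 0 * Psi N m γ t x := fun t ht x =>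
      (hb t ht x).trans (mul_le_mul_of_nonneg_right (le_max_left _ _)
        (Psi_pos hP.toAdmissible ht.1 x).le)
    refine ⟨h.continuousOn, ⟨τ, max k 0, hτ, le_max_right _ _, hτS, hb'⟩, fun t ht htS => ?_⟩
    ext x
    rw [key t ht (hP.integrableOn h.continuousOn hτ (le_max_right _ _) hb' hτS ht htS),
      h.eqn t ht htS]
  · intro h
    obtain ⟨τ, k, hτ, hk, hτS, hb⟩ := h.bound
    refine ⟨h.continuousOn, ⟨τ, k, hτ, hτS, hb⟩, fun t ht htS => ?_, fun t ht htS x => ?_⟩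
    · have h1 := (h.integrableOn hP ht htS).hasFiniteIntegral
      rw [HasFiniteIntegral] at h1
      refine lt_of_eq_of_lt (setLIntegral_congr_fun measurableSet_Ioo fun σ hσ => ?_) h1
      rw [heat_nonlin_eq hP.α_pos u hσ.2, eLpNorm_zeroAtInfty, ofReal_norm]
    · rw [← key t ht (h.integrableOn hP ht htS), ← h.eqn t ht htS]

/-! ### Restarting at a positive time -/

theorem duhamel_eq_intervalIntegral {h : ℝ → C₀(sector N m, ℝ)} {t : ℝ} (ht : 0 ≤ t) :
    duhamel h t = ∫ σ in (0 : ℝ)..t, heatOp N m (t - σ) (h σ) := by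
  rw [duhamel, intervalIntegral.integral_of_le ht, integral_Ioc_eq_integral_Ioo]

theorem duhamel_add {h : ℝ → C₀(sector N m, ℝ)} {t₀ s : ℝ} (ht₀ : 0 ≤ t₀) (hs : 0 ≤ s)
    (h0 : IntegrableOn (fun σ => heatOp N m (t₀ - σ) (h σ)) (Ioo 0 t₀))
    (h1 : IntegrableOn (fun σ => heatOp N m (t₀ + s - σ) (h σ)) (Ioo 0 (t₀ + s))) :
    duhamel h (t₀ + s) = heatOp N m s (duhamel h t₀) + duhamel (fun σ => h (t₀ + σ)) s := by
  have hi : IntervalIntegrable (fun σ => heatOp N m (t₀ + s - σ) (h σ)) volume 0 (t₀ + s) := by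
    rw [intervalIntegrable_iff_integrableOn_Ioo_of_le (by linarith)]; exact h1
  have hi0 : IntervalIntegrable (fun σ => heatOp N m (t₀ + s - σ) (h σ)) volume 0 t₀ :=
    hi.mono_set (by
      rw [uIcc_of_le ht₀, uIcc_of_le (by linarith)]; exact Icc_subset_Icc_right (by linarith))
  have hi1 : IntervalIntegrable (fun σ => heatOp N m (t₀ + s - σ) (h σ)) volume t₀ (t₀ + s) :=
    hi.mono_set (by
      rw [uIcc_of_le (by linarith), uIcc_of_le (by linarith)]; exact Icc_subset_Icc_left ht₀)
  rw [duhamel_eq_intervalIntegral (by linarith), duhamel_eq_intervalIntegral hs,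
    ← intervalIntegral.integral_add_adjacent_intervals hi0 hi1]
  congr 1
  · rw [intervalIntegral.integral_of_le ht₀, integral_Ioc_eq_integral_Ioo, duhamel,
      ← (heatOp N m s).integral_comp_comm h0]
    refine setIntegral_congr_fun measurableSet_Ioo fun σ hσ => ?_
    rw [heatOp_heatOp hs (by linarith [hσ.2])]
    congr 2; ring
  · have := intervalIntegral.integral_comp_add_left (a := 0) (b := s)
      (fun σ => heatOp N m (t₀ + s - σ) (h σ)) t₀
    rw [add_zero] at this
    rw [← this]
    simp_rw [add_sub_add_left_eq_sub]

/-- From a positive time on, the solution solves the same equation with initial value in `C₀`, so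
the weight `1` can replace `Psi`. -/
theorem IsVecSolution.restart {k₀ : ℝ} (hP : Params N m γ α) (hψ : BoundedByPsi0 N m γ k₀ ψ)
    (hu : IsVecSolution N m γ α a ψ S u) {t₀ s : ℝ} (ht₀ : 0 < t₀) (hs : 0 ≤ s)
    (hS : ENNReal.ofReal (t₀ + s) < S) :
    u (t₀ + s) = heatOp N m s (u t₀) + a • duhamel (fun σ => nl α (u (t₀ + σ))) s := by
  have h0 : ENNReal.ofReal t₀ < S := ofReal_lt_of_le (by linarith) hS
  rw [hu.eqn _ (by linarith) hS, hu.eqn t₀ ht₀ h0, duhamel_add ht₀.le hs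
    (hu.integrableOn hP ht₀ h0) (hu.integrableOn hP (by linarith) hS), map_add, map_smul,
    hψ.heatOp_flow hP.toAdmissible hs ht₀, C0_smul_add, add_assoc, add_comm s]

theorem IsVecSolution.exists_norm_le (hu : IsVecSolution N m γ α a ψ S u) {t₀ t₁ : ℝ}
    (ht₀ : 0 < t₀) (hS : ENNReal.ofReal t₁ < S) :
    ∃ R, 0 < R ∧ ∀ t ∈ Icc t₀ t₁, ‖u t‖ ≤ R := by
  obtain ⟨R, hR⟩ := isCompact_Icc.exists_bound_of_continuousOn (s := Icc t₀ t₁)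
    (hu.continuousOn.mono fun t ht => ⟨ht₀.trans_le ht.1, ofReal_lt_of_le ht.2 hS⟩)
  exact ⟨max R 1, lt_max_of_lt_right one_pos, fun t ht => (hR t ht).trans (le_max_left _ _)⟩

theorem IsVecSolution.isMild_restart {k₀ : ℝ} (hP : Params N m γ α)
    (hψ : BoundedByPsi0 N m γ k₀ ψ) (hu : IsVecSolution N m γ α a ψ S u) {t₀ t₁ T R : ℝ}
    (ht₀ : 0 < t₀) (hS : ENNReal.ofReal t₁ < S) (hR : ∀ t ∈ Icc t₀ t₁, ‖u t‖ ≤ R)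
    (hT : t₀ + T ≤ t₁) :
    IsMild α a (fun _ _ => 1) (fun s => heatOp N m s (u t₀)) T R fun s => u (t₀ + s) := by
  refine ⟨?_, fun s hs x => ?_, fun s hs => ?_⟩
  · refine hu.continuousOn.comp (by fun_prop) fun s hs => ?_
    exact ⟨by linarith [hs.1], ofReal_lt_of_le (by linarith [hs.2]) hS⟩
  · rw [mul_one]
    exact (abs_apply_le_norm _ x).trans (hR _ ⟨by linarith [hs.1], by linarith [hs.2]⟩)
  · exact hu.restart hP hψ ht₀ hs.1.le (ofReal_lt_of_le (by linarith [hs.2]) hS)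

theorem exists_contraction_time (α R : ℝ) :
    ∃ δ > 0, ∀ T, 0 < T → T ≤ δ →
      (α + 1) * R ^ α * ((1 : ℝ) ^ α * (T ^ (1 - α * 0) / (1 - α * 0))) < 1 := by
  obtain ⟨δ, hδ, h⟩ := exists_pos_forall_mul_rpow_lt ((α + 1) * R ^ α) one_pos
  refine ⟨δ, hδ, fun T h0 hT => ?_⟩
  simpa using h T h0 hT

/-! ### Uniqueness -/

theorem IsVecSolution.isMild (hu : IsVecSolution N m γ α a ψ S u) {τ k : ℝ}
    (hτS : ENNReal.ofReal τ < S) (hb : ∀ t ∈ Ioc 0 τ, ∀ x, |u t x| ≤ k * Psi N m γ t x) :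
    IsMild α a (Psi N m γ) (flow N m ψ) τ k u :=
  ⟨hu.continuousOn.mono fun _ ht => ⟨ht.1, ofReal_lt_of_le ht.2.le hτS⟩,
    fun t ht => hb t ⟨ht.1, ht.2.le⟩,
    fun t ht => hu.eqn t ht.1 (ofReal_lt_of_le ht.2.le hτS)⟩

/-- Both solutions are in one ball of the `Psi`-weighted space, of radius the larger constant, and
the contraction factor is below `1` on a short enough interval. -/
theorem IsVecSolution.eq_near_zero (hP : Params N m γ α) (ha : |a| ≤ 1) {S' : ℝ≥0∞}
    (hu : IsVecSolution N m γ α a ψ S u) (hv : IsVecSolution N m γ α a ψ S' v) :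
    ∃ τ > 0, ∀ t ∈ Ioo 0 τ, u t = v t := by
  obtain ⟨τ₁, k₁, hτ₁, hk₁, hS₁, hb₁⟩ := hu.bound
  obtain ⟨τ₂, k₂, hτ₂, hk₂, hS₂, hb₂⟩ := hv.bound
  have hW := isWeight_Psi hP.toAdmissible
  have hκ : 0 < 1 - α * ((γ + m) / 2) := by linarith [hP.lt_one]
  set k := max k₁ k₂ with hk
  set c := ‖flow N m (psi0 N m γ) 1‖ with hc
  obtain ⟨δ, hδ, hd⟩ := exists_pos_forall_mul_rpow_lt
    ((α + 1) * k ^ α * (c ^ α / (1 - α * ((γ + m) / 2)))) hκ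
  set τ := min δ (min τ₁ τ₂) with hτ
  have hτ0 : 0 < τ := lt_min hδ (lt_min hτ₁ hτ₂)
  have hτ1 : τ ≤ τ₁ := (min_le_right _ _).trans (min_le_left _ _)
  have hτ2 : τ ≤ τ₂ := (min_le_right _ _).trans (min_le_right _ _)
  refine ⟨τ, hτ0, IsMild.eq_of_lt_one (k := k) hW hP.α_pos hP.lt_one
    (hk₁.trans (le_max_left _ _)) ha ?_
    (hu.isMild (k := k) (ofReal_lt_of_le hτ1 hS₁) fun t ht x => ?_)
    (hv.isMild (k := k) (ofReal_lt_of_le hτ2 hS₂) fun t ht x => ?_)⟩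
  · refine lt_of_eq_of_lt ?_ (hd τ hτ0 (min_le_left _ _))
    ring
  · exact (hb₁ t ⟨ht.1, ht.2.trans hτ1⟩ x).trans (mul_le_mul_of_nonneg_right (le_max_left _ _)
      (hW.nonneg t ht.1 x))
  · exact (hb₂ t ⟨ht.1, ht.2.trans hτ2⟩ x).trans (mul_le_mul_of_nonneg_right (le_max_right _ _)
      (hW.nonneg t ht.1 x))

theorem IsVecSolution.unique {k₀ : ℝ} (hP : Params N m γ α) (hψ : BoundedByPsi0 N m γ k₀ ψ)
    (ha : |a| ≤ 1) {S' : ℝ≥0∞} (hu : IsVecSolution N m γ α a ψ S u)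
    (hv : IsVecSolution N m γ α a ψ S' v) {t : ℝ} (ht : 0 < t) (htS : ENNReal.ofReal t < S)
    (htS' : ENNReal.ofReal t < S') : u t = v t := by
  obtain ⟨τ, hτ, hτe⟩ := hu.eq_near_zero hP ha hv
  obtain ⟨t₁, ht₁, ht₁S⟩ := exists_real_gt_of_ofReal_lt ht.le (lt_min htS htS')
  have h1 := lt_of_lt_of_le ht₁S (min_le_left _ _)
  have h2 := lt_of_lt_of_le ht₁S (min_le_right _ _)
  set t₀ := τ / 2 with ht₀
  have ht₀0 : 0 < t₀ := half_pos hτ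
  obtain ⟨R₁, hR₁0, hR₁⟩ := hu.exists_norm_le ht₀0 h1
  obtain ⟨R₂, hR₂0, hR₂⟩ := hv.exists_norm_le ht₀0 h2
  set R := max R₁ R₂ with hR
  have hR0 : 0 ≤ R := hR₁0.le.trans (le_max_left _ _)
  obtain ⟨δ, hδ, hd⟩ := exists_contraction_time α R
  -- Both solutions are bounded by `R` on `[t₀, t₁]`, so the contraction length `δ` is the same at
  -- every restart. Advancing by `δ / 2` keeps the new endpoint inside the open interval of
  -- uniqueness.
  have key : ∀ n : ℕ, ∀ s, 0 < s → s ≤ t₀ + n * (δ / 2) → s < t₁ → u s = v s := by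
    intro n
    induction n with
    | zero =>
      intro s hs0 hs _
      refine hτe s ⟨hs0, ?_⟩
      rw [Nat.cast_zero, zero_mul, add_zero] at hs
      exact hs.trans_lt (half_lt_self hτ)
    | succ n ih =>
      intro s hs0 hs hst
      rcases le_or_gt s (t₀ + n * (δ / 2)) with h | h
      · exact ih s hs0 h hst
      set s₀ := t₀ + n * (δ / 2) with hs₀
      have hs₀t : t₀ ≤ s₀ := by rw [hs₀]; exact le_add_of_nonneg_right (by positivity)
      have hs₀0 : 0 < s₀ := ht₀0.trans_le hs₀t
      have he : u s₀ = v s₀ := ih s₀ hs₀0 le_rfl (h.trans hst)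
      have hT0 : 0 < min δ (t₁ - s₀) := lt_min hδ (by linarith)
      have hT1 : s₀ + min δ (t₁ - s₀) ≤ t₁ := by linarith [min_le_right δ (t₁ - s₀)]
      have m1 := hu.isMild_restart hP hψ hs₀0 h1
        (fun r hr => (hR₁ r ⟨hs₀t.trans hr.1, hr.2⟩).trans (le_max_left R₁ R₂)) hT1
      have m2 := hv.isMild_restart hP hψ hs₀0 h2
        (fun r hr => (hR₂ r ⟨hs₀t.trans hr.1, hr.2⟩).trans (le_max_right R₁ R₂)) hT1
      rw [← he] at m2
      have := IsMild.eq_of_lt_one (isWeight_one N m) hP.α_pos (by simp) hR0 ha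
        (hd _ hT0 (min_le_left _ _)) m1 m2 (s - s₀) ⟨by linarith, lt_min ?_ (by linarith)⟩
      · simpa using this
      · push_cast at hs
        linarith
  obtain ⟨n, hn⟩ := exists_nat_ge ((t - t₀) / (δ / 2))
  refine key n t ht ?_ ht₁
  rw [div_le_iff₀ (half_pos hδ)] at hn
  linarith

/-! ### Extension -/

/-- A lower bound for the length of the existence interval of solutions starting in the ball of
radius `R` of `C₀`. -/
def stepLength (α R : ℝ) : ℝ := 1 / (2 * (α + 1) * (2 * R) ^ α)

theorem stepLength_pos {R : ℝ} (hα : 0 < α) (hR : 0 < R) : 0 < stepLength α R := by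
  unfold stepLength; positivity

/-- With radius `2 * R`, the choice of `stepLength` makes the contraction factor exactly `1 / 2` and
the Duhamel term at most `R`. -/
theorem exists_isMild_one {R : ℝ} (hα : 0 < α) (hR : 0 < R) (ha : |a| ≤ 1)
    {v₀ : C₀(sector N m, ℝ)} (hv₀ : ‖v₀‖ ≤ R) :
    ∃ v, IsMild α a (fun _ _ => 1) (fun s => heatOp N m s v₀) (stepLength α R) (2 * R) v := by
  have hδ := stepLength_pos hα hR
  have hx : (2 * R) ^ α * stepLength α R = 1 / (2 * (α + 1)) := by
    unfold stepLength; field_simp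
  have hx2 : 1 / (2 * (α + 1)) ≤ 1 / 2 := by
    apply one_div_le_one_div_of_le two_pos; linarith
  refine exists_isMild (K := R) (isWeight_one N m) hα le_rfl (by simp) (by positivity) ha ?_ ?_ ?_ ?_
    hδ
  · exact ((continuous_heatOp N m).comp (by fun_prop :
      Continuous fun s : ℝ => (s, v₀))).continuousOn
  · intro t _ x
    rw [mul_one]
    exact (abs_apply_le_norm _ x).trans ((norm_heatOp_le _ _).trans hv₀)
  · simp only [mul_zero, sub_zero, Real.one_rpow, one_mul, Real.rpow_one, div_one]
    rw [Real.rpow_add_one (by positivity), mul_right_comm, hx]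
    nlinarith
  · simp only [mul_zero, sub_zero, Real.one_rpow, one_mul, Real.rpow_one, div_one]
    rw [mul_assoc, hx]
    have : (α + 1) * (1 / (2 * (α + 1))) = 1 / 2 := by field_simp
    linarith

/-- The solution restarted at `t₀` is glued to `u`. They coincide on a short interval after `t₀` by
uniqueness, which gives continuity across the junction; the equation after `t₀` follows from
`duhamel_add`. -/
theorem IsVecSolution.exists_extension {k₀ R t₀ : ℝ} (hP : Params N m γ α)
    (hψ : BoundedByPsi0 N m γ k₀ ψ) (ha : |a| ≤ 1) (hu : IsVecSolution N m γ α a ψ S u)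
    (hR : 0 < R) (ht₀ : 0 < t₀) (ht₀S : ENNReal.ofReal t₀ < S) (hu₀ : ‖u t₀‖ ≤ R) :
    ∃ w, IsVecSolution N m γ α a ψ (ENNReal.ofReal (t₀ + stepLength α R)) w := by
  set δ := stepLength α R with hδ
  have hδ0 : 0 < δ := stepLength_pos hP.α_pos hR
  obtain ⟨v, hv⟩ := exists_isMild_one hP.α_pos hR ha hu₀
  obtain ⟨t₁, ht₁, ht₁S⟩ := exists_real_gt_of_ofReal_lt ht₀.le ht₀S
  obtain ⟨R₁, -, hR₁⟩ := hu.exists_norm_le ht₀ ht₁S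
  set R' := max R₁ (2 * R) with hR'
  obtain ⟨δ', hδ', hd⟩ := exists_contraction_time α R'
  set T := min δ' (min δ (t₁ - t₀)) with hT
  have hT0 : 0 < T := lt_min hδ' (lt_min hδ0 (by linarith))
  have hTδ : T ≤ δ := (min_le_right _ _).trans (min_le_left _ _)
  have hTt : t₀ + T ≤ t₁ := by
    have : T ≤ t₁ - t₀ := (min_le_right _ _).trans (min_le_right _ _)
    linarith
  have heq : ∀ s ∈ Ioo 0 T, u (t₀ + s) = v s := by
    refine IsMild.eq_of_lt_one (isWeight_one N m) hP.α_pos (by simp)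
      ((mul_nonneg zero_le_two hR.le).trans (le_max_right _ _)) ha (hd T hT0 (min_le_left _ _))
      (hu.isMild_restart hP hψ ht₀ ht₁S (fun t ht => (hR₁ t ht).trans (le_max_left _ _)) hTt)
      ⟨hv.cont.mono (Ioo_subset_Ioo_right hTδ), fun t ht x => ?_, fun t ht =>
        hv.eqn t ⟨ht.1, ht.2.trans_le hTδ⟩⟩
    exact (hv.bound t ⟨ht.1, ht.2.trans_le hTδ⟩ x).trans
      (mul_le_mul_of_nonneg_right (le_max_right _ _) zero_le_one)
  set w : ℝ → C₀(sector N m, ℝ) := fun t => if t ≤ t₀ then u t else v (t - t₀) with hw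
  have hwu : ∀ t, t < t₀ + T → w t = u t := by
    intro t ht
    by_cases h : t ≤ t₀
    · simp only [hw, h, if_true]
    · simp only [hw, h, if_false]
      rw [← heq (t - t₀) ⟨by linarith, by linarith⟩, add_sub_cancel]
  have hwv : ∀ t, t₀ < t → w t = v (t - t₀) := fun t ht => by
    simp only [hw, not_le.2 ht, if_false]
  have hlt : ∀ t, ENNReal.ofReal t < ENNReal.ofReal (t₀ + δ) → t < t₀ + δ := fun t h =>
    (ENNReal.ofReal_lt_ofReal_iff (by linarith)).1 h
  have hwc : ContinuousOn w {t | 0 < t ∧ ENNReal.ofReal t < ENNReal.ofReal (t₀ + δ)} := by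
    rintro t ⟨ht, htS⟩
    have htδ := hlt t htS
    refine ContinuousAt.continuousWithinAt ?_
    rcases lt_or_ge t (t₀ + T) with h | h
    · have h1 : ContinuousAt u t := by
        refine ContinuousOn.continuousAt (s := Ioo 0 t₁) (hu.continuousOn.mono fun s hs =>
          ⟨hs.1, ofReal_lt_of_le hs.2.le ht₁S⟩) (Ioo_mem_nhds ht (by linarith))
      refine h1.congr ?_
      filter_upwards [gt_mem_nhds h] with s hs
      exact (hwu s hs).symm
    · have htt : t₀ < t := by linarith
      have h1 : ContinuousAt (fun s => v (s - t₀)) t :=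
        ContinuousAt.comp (g := v) (f := fun s => s - t₀)
          (hv.cont.continuousAt (Ioo_mem_nhds (by linarith) (by linarith))) (by fun_prop)
      refine h1.congr ?_
      filter_upwards [lt_mem_nhds htt] with s hs
      exact (hwv s hs).symm
  obtain ⟨τ, k, hτ, hk, hτS, hb⟩ := hu.bound
  have hmS : ENNReal.ofReal (min τ t₀) < ENNReal.ofReal (t₀ + δ) := by
    rw [ENNReal.ofReal_lt_ofReal_iff (by linarith)]
    linarith [min_le_right τ t₀]
  have hwb : ∀ t ∈ Ioc 0 (min τ t₀), ∀ x, |w t x| ≤ k * Psi N m γ t x := by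
    intro t ht x
    rw [hwu t (by linarith [ht.2.trans (min_le_right _ _)])]
    exact hb t ⟨ht.1, ht.2.trans (min_le_left _ _)⟩ x
  have hwi := fun t => hP.integrableOn (t := t) hwc (lt_min hτ ht₀) hk hwb hmS
  have hduh : ∀ t, t ≤ t₀ → duhamel (fun σ => nl α (w σ)) t = duhamel (fun σ => nl α (u σ)) t := by
    intro t ht
    refine setIntegral_congr_fun measurableSet_Ioo fun σ hσ => ?_
    simp only
    rw [hwu σ (by linarith [hσ.2])]
  refine ⟨w, hwc, ⟨min τ t₀, k, lt_min hτ ht₀, hk, hmS, hwb⟩, fun t ht htS => ?_⟩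
  rcases le_or_gt t t₀ with h | h
  · rw [hwu t (by linarith), hduh t h]
    exact hu.eqn t ht (ofReal_lt_of_le h ht₀S)
  · obtain ⟨s, rfl⟩ : ∃ s, t = t₀ + s := ⟨t - t₀, by ring⟩
    have hs0 : 0 < s := by linarith
    have hsδ : s < δ := by linarith [hlt _ htS]
    have hd2 : duhamel (fun σ => nl α (w (t₀ + σ))) s = duhamel (fun σ => nl α (v σ)) s := by
      refine setIntegral_congr_fun measurableSet_Ioo fun σ hσ => ?_
      simp only
      rw [hwv (t₀ + σ) (by linarith [hσ.1]), add_sub_cancel_left]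
    rw [hwv _ h, add_sub_cancel_left, hv.eqn s ⟨hs0, hsδ⟩, duhamel_add ht₀.le hs0.le
      (hwi t₀ ht₀ (ofReal_lt_of_le (by linarith) htS)) (hwi _ ht htS), hd2, hduh t₀ le_rfl,
      hu.eqn t₀ ht₀ ht₀S, map_add, map_smul, hψ.heatOp_flow hP.toAdmissible hs0.le ht₀, C0_smul_add,
      add_assoc, add_comm s]

end

section

variable {N m : ℕ} {γ α a : ℝ} {ψ : sector N m → ℝ} {S : ℝ≥0∞} {u v : ℝ → C₀(sector N m, ℝ)}

/-! ### Local existence and the maximal solution -/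

theorem IsMild.isVecSolution {T k : ℝ} (hT : 0 < T) (hk : 0 ≤ k)
    (hu : IsMild α a (Psi N m γ) (flow N m ψ) T k u) :
    IsVecSolution N m γ α a ψ (ENNReal.ofReal T) u := by
  have hlt : ∀ t, ENNReal.ofReal t < ENNReal.ofReal T → t < T := fun t h =>
    (ENNReal.ofReal_lt_ofReal_iff hT).1 h
  refine ⟨hu.cont.mono fun t ht => ⟨ht.1, hlt t ht.2⟩, ⟨T / 2, k, half_pos hT, hk,
    (ENNReal.ofReal_lt_ofReal_iff hT).2 (half_lt_self hT), fun t ht => hu.bound t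
    ⟨ht.1, ht.2.trans_lt (half_lt_self hT)⟩⟩, fun t ht htS => hu.eqn t ⟨ht, hlt t htS⟩⟩

theorem BoundedByPsi0.exists_solution {K M T : ℝ} (hP : Params N m γ α)
    (hψ : BoundedByPsi0 N m γ K ψ) (ha : |a| ≤ 1) (hM : 0 < M) (hT : 0 < T)
    (h1 : K + 2 * (α + 1) * M ^ (α + 1) * (‖flow N m (psi0 N m γ) 1‖ ^ α *
      (T ^ (1 - α * ((γ + m) / 2)) / (1 - α * ((γ + m) / 2)))) ≤ M)
    (h2 : 2 * (α + 1) * M ^ α * (‖flow N m (psi0 N m γ) 1‖ ^ α *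
      (T ^ (1 - α * ((γ + m) / 2)) / (1 - α * ((γ + m) / 2)))) < 1) :
    ∃ T', T < T' ∧ ∃ u, IsMild α a (Psi N m γ) (flow N m ψ) T' M u := by
  set κ := 1 - α * ((γ + m) / 2) with hκ
  have hκ0 : 0 < κ := by linarith [hP.lt_one]
  have hα := hP.α_pos
  -- The factor `2` in the smallness hypotheses is spent on a longer interval: the time integral
  -- doubles from `T` to `T'`. This gives strict inequality `T < Tmax` and the bound at `t = T`
  -- itself.
  set T' := 2 ^ (1 / κ) * T with hT'
  have hTκ : T' ^ κ = 2 * T ^ κ := by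
    rw [hT', Real.mul_rpow (by positivity) hT.le, ← Real.rpow_mul zero_le_two, one_div,
      inv_mul_cancel₀ hκ0.ne', Real.rpow_one]
  have hTT : T < T' := lt_mul_of_one_lt_left hT (Real.one_lt_rpow one_lt_two (by positivity))
  refine ⟨T', hTT, exists_isMild (isWeight_Psi hP.toAdmissible) hP.α_pos hP.β_nonneg
    hP.lt_one hM.le ha ((hψ.continuousOn_flow hP.toAdmissible).mono fun t ht => ht.1)
    (fun t ht x => hψ.abs_flow_le hP.toAdmissible ht.1 x) ?_ ?_ (hT.trans hTT)⟩
  · rw [← hκ, hTκ]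
    refine le_trans ?_ h1
    have h3 : 0 ≤ M ^ (α + 1) * (‖flow N m (psi0 N m γ) 1‖ ^ α * (T ^ κ / κ)) := by positivity
    have h4 : 2 * T ^ κ / κ = 2 * (T ^ κ / κ) := by ring
    rw [h4]
    nlinarith
  · rw [← hκ, hTκ]
    refine lt_of_eq_of_lt ?_ h2
    ring

theorem IsVecSolution.le_Tmax {k₀ : ℝ} (hP : Params N m γ α) (hψ : BoundedByPsi0 N m γ k₀ ψ)
    (hu : IsVecSolution N m γ α a ψ S u) : S ≤ Tmax N m γ α a ψ :=
  le_sSup ⟨u, (isSolution_iff hP hψ).2 hu⟩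

/-- For each `t` below `Tmax` a solution `w t` alive at time `t` is chosen; by uniqueness the
diagonal `w t t` agrees with every solution where that one lives, so it is itself a solution. -/
theorem exists_maximal_of_exists {k₀ : ℝ} (hP : Params N m γ α) (hψ : BoundedByPsi0 N m γ k₀ ψ)
    (ha : |a| ≤ 1) (hex : ∃ S u, IsVecSolution N m γ α a ψ S u) :
    ∃ u, IsVecSolution N m γ α a ψ (Tmax N m γ α a ψ) u ∧
      IsMaximalSolution N m γ α a ψ (Tmax N m γ α a ψ) u := by
  have hsol : ∀ t, ENNReal.ofReal t < Tmax N m γ α a ψ →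
      ∃ v S, IsVecSolution N m γ α a ψ S v ∧ ENNReal.ofReal t < S := by
    intro t ht
    obtain ⟨S, ⟨v, hv⟩, hS⟩ := lt_sSup_iff.1 ht
    exact ⟨v, S, (isSolution_iff hP hψ).1 hv, hS⟩
  choose! w S hw hS using hsol
  have heq : ∀ v S', IsVecSolution N m γ α a ψ S' v → ∀ t, 0 < t → ENNReal.ofReal t < S' →
      v t = w t t := by
    intro v S' hv t ht htS
    have htm := htS.trans_le (hv.le_Tmax hP hψ)
    exact hv.unique hP hψ ha (hw t htm) ht htS (hS t htm)
  have hvec : IsVecSolution N m γ α a ψ (Tmax N m γ α a ψ) fun t => w t t := by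
    refine ⟨?_, ?_, fun t ht htS => ?_⟩
    · rintro t ⟨ht, htS⟩
      obtain ⟨t₂, ht₂, ht₂S⟩ := exists_real_gt_of_ofReal_lt ht.le htS
      have h1 : ContinuousOn (w t₂) (Ioo 0 t₂) := (hw t₂ ht₂S).continuousOn.mono fun s hs =>
        ⟨hs.1, ofReal_lt_of_le hs.2.le (hS t₂ ht₂S)⟩
      have hmem : Ioo 0 t₂ ∈ 𝓝 t := Ioo_mem_nhds ht ht₂
      refine ((h1.continuousAt hmem).congr ?_).continuousWithinAt
      filter_upwards [hmem] with s hs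
      exact heq _ _ (hw t₂ ht₂S) s hs.1 (ofReal_lt_of_le hs.2.le (hS t₂ ht₂S))
    · obtain ⟨S', v, hv⟩ := hex
      obtain ⟨τ, k, hτ, hk, hτS, hb⟩ := hv.bound
      refine ⟨τ, k, hτ, hk, hτS.trans_le (hv.le_Tmax hP hψ), fun t ht x => ?_⟩
      rw [← heq v S' hv t ht.1 (ofReal_lt_of_le ht.2 hτS)]
      exact hb t ht x
    · have h1 := (hw t htS).eqn t ht (hS t htS)
      refine h1.trans ?_
      congr 2
      refine setIntegral_congr_fun measurableSet_Ioo fun σ hσ => ?_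
      simp only
      rw [heq _ _ (hw t htS) σ hσ.1 (ofReal_lt_of_le hσ.2.le (hS t htS))]
  exact ⟨fun t => w t t, hvec, (isSolution_iff hP hψ).2 hvec,
    fun S' v hv => ((isSolution_iff hP hψ).1 hv).le_Tmax hP hψ,
    fun S' v hv => heq v S' ((isSolution_iff hP hψ).1 hv)⟩

/-- The dichotomy for bounded solutions: if the norms stay bounded, the solution is global. -/
theorem Tmax_eq_top_of_bounded {k₀ R t₀ : ℝ} (hP : Params N m γ α)
    (hψ : BoundedByPsi0 N m γ k₀ ψ) (ha : |a| ≤ 1)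
    (hu : IsVecSolution N m γ α a ψ (Tmax N m γ α a ψ) u) (hR : 0 < R)
    (ht₀S : ENNReal.ofReal t₀ < Tmax N m γ α a ψ)
    (hb : ∀ t, t₀ ≤ t → ENNReal.ofReal t < Tmax N m γ α a ψ → ‖u t‖ ≤ R) :
    Tmax N m γ α a ψ = ⊤ := by
  by_contra hne
  set S := Tmax N m γ α a ψ with hS
  have hS0 : 0 < S := bot_lt_iff_ne_bot.2 (ne_bot_of_gt ht₀S)
  have hSr : S = ENNReal.ofReal S.toReal := (ENNReal.ofReal_toReal hne).symm
  have hSp : 0 < S.toReal := ENNReal.toReal_pos hS0.ne' hne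
  have hδ := stepLength_pos hP.α_pos hR
  have ht₀' : t₀ < S.toReal := by
    rw [hSr] at ht₀S
    exact (ENNReal.ofReal_lt_ofReal_iff hSp).1 ht₀S
  -- A positive time within half a step of the supposed end; restarting there overshoots `Tmax`. The
  -- entry `S.toReal / 2` only secures positivity.
  set t₁ := max (max t₀ (S.toReal / 2)) (S.toReal - stepLength α R / 2) with ht₁
  have h1 : 0 < t₁ := lt_max_of_lt_left (lt_max_of_lt_right (half_pos hSp))
  have h2 : t₁ < S.toReal := max_lt (max_lt ht₀' (half_lt_self hSp)) (by linarith)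
  have h3 : ENNReal.ofReal t₁ < S := by
    rw [hSr]; exact (ENNReal.ofReal_lt_ofReal_iff hSp).2 h2
  obtain ⟨w, hw⟩ := hu.exists_extension hP hψ ha hR h1 h3
    (hb t₁ ((le_max_left _ _).trans (le_max_left _ _)) h3)
  have h4 := hw.le_Tmax hP hψ
  rw [← hS, hSr, ENNReal.ofReal_le_ofReal_iff hSp.le] at h4
  have := le_max_right (max t₀ (S.toReal / 2)) (S.toReal - stepLength α R / 2)
  linarith

/-! ### Absorption: global existence -/

theorem norm_sub_smul_nl_le (hα : 0 < α) (f : C₀(sector N m, ℝ)) {h : ℝ} (hh : 0 ≤ h)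
    (hf : h * ‖f‖ ^ α ≤ 1) : ‖f - h • nl α f‖ ≤ ‖f‖ := by
  refine norm_le_of_forall (norm_nonneg _) fun x => ?_
  rw [ZeroAtInftyContinuousMap.sub_apply, ZeroAtInftyContinuousMap.smul_apply, nl_apply hα,
    smul_eq_mul, show f x - h * (|f x| ^ α * f x) = (1 - h * |f x| ^ α) * f x by ring, abs_mul]
  have h1 : h * |f x| ^ α ≤ 1 := by
    refine le_trans ?_ hf
    gcongr
    exact abs_apply_le_norm f x
  have h2 : 0 ≤ h * |f x| ^ α := by positivity
  rw [abs_of_nonneg (by linarith)]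
  refine (mul_le_of_le_one_left (abs_nonneg _) (by linarith)).trans (abs_apply_le_norm f x)

/-- An Euler step: `u(t+h)` is `e^{hΔ}(u(t) - h|u(t)|^α u(t))` up to an error `h * r`, and neither
the semigroup nor `norm_sub_smul_nl_le` increases the norm. -/
theorem eventually_norm_le {k₀ : ℝ} (hP : Params N m γ α) (hψ : BoundedByPsi0 N m γ k₀ ψ)
    (hu : IsVecSolution N m γ α (-1) ψ S u) {t r : ℝ} (ht : 0 < t) (htS : ENNReal.ofReal t < S)
    (hr : 0 < r) : ∀ᶠ h in 𝓝[>] 0, ‖u (t + h)‖ ≤ ‖u t‖ + h * r := by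
  obtain ⟨t₁, ht₁, ht₁S⟩ := exists_real_gt_of_ofReal_lt ht.le htS
  have hut : ContinuousAt u t := ContinuousOn.continuousAt (s := Ioo 0 t₁)
    (hu.continuousOn.mono fun s hs => ⟨hs.1, ofReal_lt_of_le hs.2.le ht₁S⟩) (Ioo_mem_nhds ht ht₁)
  have hut0 : ContinuousAt (fun σ : ℝ => u (t + σ)) 0 :=
    ContinuousAt.comp (g := u) (f := fun σ => t + σ) (by rwa [add_zero]) (by fun_prop)
  have hjoint : ContinuousAt (fun p : ℝ × ℝ => heatOp N m p.1 (nl α (u (t + p.2)))) (0, 0) := by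
    have h1 : ContinuousAt (fun p : ℝ × ℝ => (p.1, nl α (u (t + p.2)))) (0, 0) :=
      continuousAt_fst.prodMk ((continuous_nl hP.α_pos).continuousAt.comp
        (ContinuousAt.comp (g := fun σ : ℝ => u (t + σ)) (f := Prod.snd) hut0 continuousAt_snd))
    exact (continuous_heatOp N m).continuousAt.comp h1
  have hj := Metric.tendsto_nhds.1 hjoint (r / 2) (half_pos hr)
  rw [Metric.eventually_nhds_iff] at hj
  obtain ⟨δ, hδ, hd⟩ := hj
  have hsm : ∀ᶠ h in 𝓝[>] (0 : ℝ), h * ‖u t‖ ^ α < 1 := by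
    have h1 : Tendsto (fun h : ℝ => h * ‖u t‖ ^ α) (𝓝 0) (𝓝 0) := by
      have : Continuous fun h : ℝ => h * ‖u t‖ ^ α := by fun_prop
      simpa using this.tendsto 0
    exact (h1.eventually_lt_const one_pos).filter_mono nhdsWithin_le_nhds
  have hlt : ∀ᶠ h in 𝓝[>] (0 : ℝ), h < min δ (t₁ - t) :=
    (gt_mem_nhds (lt_min hδ (by linarith))).filter_mono nhdsWithin_le_nhds
  filter_upwards [hsm, hlt, self_mem_nhdsWithin] with h h1 h2 (h0 : 0 < h)
  have hhδ : h < δ := h2.trans_le (min_le_left _ _)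
  have hht : t + h < t₁ := by linarith [h2.trans_le (min_le_right δ (t₁ - t))]
  have hcl : ∀ s σ : ℝ, |s| < δ → |σ| < δ →
      dist (heatOp N m s (nl α (u (t + σ)))) (nl α (u t)) < r / 2 := by
    intro s σ hs hσ
    have := hd (y := (s, σ)) (by
      rw [Prod.dist_eq, max_lt_iff, Real.dist_eq, Real.dist_eq, sub_zero, sub_zero]
      exact ⟨hs, hσ⟩)
    simp only [heatOp_of_nonpos le_rfl, add_zero] at this
    exact this
  have hS' := ofReal_lt_of_le hht.le ht₁S
  have hre := hu.restart hP hψ ht h0.le hS'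
  -- The nonlinearity frozen at time `t`. Joint continuity of the semigroup puts the true integrand
  -- within `r` of `A` on `(0, h)`.
  set A := heatOp N m h (nl α (u t)) with hA
  have hmild := hu.isMild_restart hP hψ ht ht₁S (R := 0 + (hu.exists_norm_le ht ht₁S).choose)
    (fun s hs => by
      rw [zero_add]; exact (hu.exists_norm_le ht ht₁S).choose_spec.2 s hs) (T := t₁ - t) (by linarith)
  have hint : IntegrableOn (fun σ => heatOp N m (h - σ) (nl α (u (t + σ)))) (Ioo 0 h) :=
    (isWeight_one N m).integrableOn_nl hP.α_pos (by simp)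
      (by rw [zero_add]; exact (hu.exists_norm_le ht ht₁S).choose_spec.1.le) hmild.cont hmild.bound
      ⟨h0, by linarith⟩
  have hrem : ‖duhamel (fun σ => nl α (u (t + σ))) h - h • A‖ ≤ r * h := by
    have h3 : h • A = ∫ _σ in Ioo 0 h, A := by
      rw [setIntegral_const, Measure.real, Real.volume_Ioo, sub_zero, ENNReal.toReal_ofReal h0.le]
    rw [h3, duhamel, ← integral_sub hint (by simp)]
    have h4 := norm_setIntegral_le_of_norm_le_const (μ := volume) (s := Ioo 0 h) (C := r)
      (f := fun σ => heatOp N m (h - σ) (nl α (u (t + σ))) - A) (by simp) fun σ hσ => by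
        rw [← dist_eq_norm]
        have h5 := hcl (h - σ) σ (by rw [abs_lt]; constructor <;> linarith [hσ.1, hσ.2])
          (by rw [abs_lt]; constructor <;> linarith [hσ.1, hσ.2])
        have h6 := hcl h 0 (by rw [abs_lt]; constructor <;> linarith) (by rwa [abs_zero])
        rw [add_zero] at h6
        refine (dist_triangle_right _ _ (nl α (u t))).trans ?_
        linarith
    rwa [Measure.real, Real.volume_Ioo, sub_zero, ENNReal.toReal_ofReal h0.le] at h4
  have hsplit : u (t + h) = heatOp N m h (u t - h • nl α (u t)) -
      (duhamel (fun σ => nl α (u (t + σ))) h - h • A) := by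
    rw [hre, map_sub, map_smul, ← hA]
    ext x
    simp only [ZeroAtInftyContinuousMap.add_apply, ZeroAtInftyContinuousMap.sub_apply,
      ZeroAtInftyContinuousMap.smul_apply, smul_eq_mul]
    ring
  rw [hsplit]
  refine (norm_sub_le _ _).trans (add_le_add ((norm_heatOp_le _ _).trans
    (norm_sub_smul_nl_le hP.α_pos _ h0.le h1.le)) (hrem.trans_eq (mul_comm _ _)))

/-- `eventually_norm_le` says that the upper right Dini derivative of the norm is nonpositive; a
continuous function with this property does not increase. -/
theorem IsVecSolution.norm_antitone {k₀ : ℝ} (hP : Params N m γ α)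
    (hψ : BoundedByPsi0 N m γ k₀ ψ) (hu : IsVecSolution N m γ α (-1) ψ S u) {t₀ t₁ : ℝ}
    (ht₀ : 0 < t₀) (h01 : t₀ ≤ t₁) (hS : ENNReal.ofReal t₁ < S) : ‖u t₁‖ ≤ ‖u t₀‖ := by
  have hc : ContinuousOn (fun t => ‖u t‖) (Icc t₀ t₁) := (hu.continuousOn.mono fun t ht =>
    ⟨ht₀.trans_le ht.1, ofReal_lt_of_le ht.2 hS⟩).norm
  refine image_le_of_liminf_slope_right_le_deriv_boundary (B := fun _ => ‖u t₀‖)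
    (B' := fun _ => 0) hc le_rfl continuousOn_const (fun t _ => hasDerivWithinAt_const _ _ _)
    (fun t ht r hr => ?_) ⟨h01, le_rfl⟩
  have hev := eventually_norm_le hP hψ hu (ht₀.trans_le ht.1) (ofReal_lt_of_le ht.2.le hS)
    (half_pos hr)
  have hev2 : ∀ᶠ z in 𝓝[>] t, slope (fun t => ‖u t‖) t z < r := by
    have htend : Tendsto (fun z => z - t) (𝓝[>] t) (𝓝[>] 0) := by
      refine tendsto_nhdsWithin_of_tendsto_nhds_of_eventually_within _ ?_ ?_
      · have : Continuous fun z : ℝ => z - t := by fun_prop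
        simpa using (this.tendsto t).mono_left nhdsWithin_le_nhds
      · filter_upwards [self_mem_nhdsWithin] with z (hz : t < z)
        show (0 : ℝ) < z - t
        exact sub_pos.2 hz
    filter_upwards [htend.eventually hev, self_mem_nhdsWithin] with z hz (hz0 : t < z)
    rw [add_sub_cancel] at hz
    have h0 : 0 < z - t := sub_pos.2 hz0
    rw [slope_def_field, div_lt_iff₀ h0]
    nlinarith
  exact hev2.frequently

theorem Tmax_eq_top_of_neg_one {k₀ : ℝ} (hP : Params N m γ α) (hψ : BoundedByPsi0 N m γ k₀ ψ)
    (hu : IsVecSolution N m γ α (-1) ψ (Tmax N m γ α (-1) ψ) u) :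
    Tmax N m γ α (-1) ψ = ⊤ := by
  obtain ⟨τ, k, hτ, -, hτS, -⟩ := hu.bound
  refine Tmax_eq_top_of_bounded (R := ‖u τ‖ + 1) (t₀ := τ) hP hψ (by simp) hu (by positivity) hτS
    fun t ht htS => ?_
  have := hu.norm_antitone hP hψ hτ ht htS
  linarith

/-! ### Lower bound for the existence time -/

theorem exists_lt_Tmax_const_mul {K : ℝ} (hP : Params N m γ α) (hψ : BoundedByPsi0 N m γ K ψ)
    (hK : 0 < K) (ha : |a| ≤ 1) :
    ∃ c : ℝ, 0 < c ∧ ∀ l : ℝ, 0 < l → ENNReal.ofReal c <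
      ENNReal.ofReal (l ^ (1 / α - (γ + m) / 2)⁻¹) * Tmax N m γ α a (fun x => l * ψ x) := by
  set κ := 1 - α * ((γ + m) / 2) with hκ
  have hκ0 : 0 < κ := by linarith [hP.lt_one]
  have hα := hP.α_pos
  set c₀ := ‖flow N m (psi0 N m γ) 1‖ ^ α with hc₀
  have hc₀0 : 0 ≤ c₀ := by positivity
  -- With `M = 2lK` and `T ^ κ = D * l ^ (-α)` the powers of `l` cancel in `M ^ α * T ^ κ`, and `D`
  -- makes the contraction quantity at most `1 / 4`. The summand `1` in `c₀ + 1` avoids dividing by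
  -- zero.
  set D := κ / (4 * (α + 1) * (2 * K) ^ α * (c₀ + 1)) with hD
  have hD0 : 0 < D := by positivity
  have hq : (1 / α - (γ + m) / 2)⁻¹ = α / κ := by
    rw [hκ]
    have : 1 / α - (γ + m) / 2 = (1 - α * ((γ + m) / 2)) / α := by field_simp
    rw [this, inv_div]
  refine ⟨D ^ (1 / κ), by positivity, fun l hl => ?_⟩
  set T := D ^ (1 / κ) * l ^ (-(α / κ)) with hT
  have hT0 : 0 < T := by positivity
  have hTκ : T ^ κ = D * l ^ (-α) := by
    rw [hT, Real.mul_rpow (by positivity) (by positivity), ← Real.rpow_mul hD0.le,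
      ← Real.rpow_mul hl.le]
    congr 2
    · rw [one_div, inv_mul_cancel₀ hκ0.ne', Real.rpow_one]
    · field_simp
  set M := 2 * (l * K) with hM
  have hM0 : 0 < M := by positivity
  have hMα : M ^ α * T ^ κ = (2 * K) ^ α * D := by
    rw [hTκ, hM, show 2 * (l * K) = (2 * K) * l by ring, Real.mul_rpow (by positivity) hl.le,
      Real.rpow_neg hl.le]
    field_simp
  have hI : (α + 1) * M ^ α * (c₀ * (T ^ κ / κ)) ≤ 1 / 4 := by
    have h1 : (α + 1) * M ^ α * (c₀ * (T ^ κ / κ)) = (α + 1) * c₀ / κ * (M ^ α * T ^ κ) := by ring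
    have h2 : (α + 1) * c₀ / κ * (M ^ α * T ^ κ) = c₀ / (4 * (c₀ + 1)) := by
      rw [hMα, hD]; field_simp
    rw [h1, h2, div_le_div_iff₀ (by positivity) (by positivity)]
    linarith
  obtain ⟨T', hTT', u, hu⟩ := (hψ.const_mul hl.le).exists_solution (a := a) (M := M) hP ha hM0 hT0
    (by
      rw [← hκ, ← hc₀, Real.rpow_add_one hM0.ne']
      have : 2 * (α + 1) * (M ^ α * M) * (c₀ * (T ^ κ / κ)) =
        2 * M * ((α + 1) * M ^ α * (c₀ * (T ^ κ / κ))) := by ring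
      rw [this]
      nlinarith)
    (by
      rw [← hκ, ← hc₀]
      have : 2 * (α + 1) * M ^ α * (c₀ * (T ^ κ / κ)) =
        2 * ((α + 1) * M ^ α * (c₀ * (T ^ κ / κ))) := by ring
      rw [this]; linarith)
  have hlt : ENNReal.ofReal T < Tmax N m γ α a fun x => l * ψ x :=
    ((ENNReal.ofReal_lt_ofReal_iff (hT0.trans hTT')).2 hTT').trans_le
      ((hu.isVecSolution (hT0.trans hTT') hM0.le).le_Tmax hP (hψ.const_mul hl.le))
  have hlq : 0 < l ^ (α / κ) := by positivity
  have hc : D ^ (1 / κ) = l ^ (α / κ) * T := by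
    rw [hT, Real.rpow_neg hl.le]; field_simp
  rw [hq, hc, ENNReal.ofReal_mul hlq.le]
  exact (ENNReal.mul_lt_mul_iff_right (ENNReal.ofReal_pos.2 hlq).ne' ENNReal.ofReal_ne_top).2 hlt

end

/-! ### Scaling -/

/-- Dilations as homeomorphisms of the sector. -/
def dilHomeomorph (N m : ℕ) {c : ℝ} (hc : 0 < c) : sector N m ≃ₜ sector N m where
  toFun := dil hc
  invFun := dil (inv_pos.2 hc)
  left_inv := dil_dil (inv_pos.2 hc) hc (inv_mul_cancel₀ hc.ne')
  right_inv := dil_dil hc (inv_pos.2 hc) (mul_inv_cancel₀ hc.ne')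
  continuous_toFun := (continuous_subtype_val.const_smul c).subtype_mk _
  continuous_invFun := (continuous_subtype_val.const_smul c⁻¹).subtype_mk _

/-- Composition with a dilation. -/
def dilOp (N m : ℕ) {c : ℝ} (hc : 0 < c) : C₀(sector N m, ℝ) →L[ℝ] C₀(sector N m, ℝ) :=
  LinearMap.mkContinuous
    (ZeroAtInftyContinuousMap.compLinearMap (dilHomeomorph N m hc).toCocompactMap) 1 fun f => by
      rw [one_mul]
      exact norm_le_of_forall (norm_nonneg f) fun x => abs_apply_le_norm f (dil hc x)

theorem dilOp_apply {N m : ℕ} {c : ℝ} (hc : 0 < c) (f : C₀(sector N m, ℝ)) (x : sector N m) :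
    dilOp N m hc f x = f (dil hc x) := rfl

theorem nonlin_const_mul {X : Type*} {α k : ℝ} (hα : 0 < α) (hk : 0 ≤ k) (v : X → ℝ) (x : X) :
    nonlin α (fun x => k * v x) x = k ^ (α + 1) * nonlin α v x := by
  unfold nonlin
  rw [abs_mul, abs_of_nonneg hk, Real.mul_rpow hk (abs_nonneg _),
    Real.rpow_add_one' hk (by linarith)]
  ring

theorem setIntegral_Ioo_mul_left {c t : ℝ} (hc : 0 < c) (ht : 0 ≤ t) (f : ℝ → ℝ) :
    ∫ σ in Ioo 0 (c * t), f σ = c * ∫ σ in Ioo 0 t, f (c * σ) := by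
  rw [← integral_Ioc_eq_integral_Ioo, ← integral_Ioc_eq_integral_Ioo,
    ← intervalIntegral.integral_of_le (by positivity), ← intervalIntegral.integral_of_le ht,
    intervalIntegral.mul_integral_comp_mul_left, mul_zero]

section

variable {N m : ℕ} {γ α a : ℝ} {S : ℝ≥0∞} {u : ℝ → C₀(sector N m, ℝ)}

/-- The equation is invariant because `(c ^ (2 / α)) ^ (α + 1) = c ^ (2 / α) * c ^ 2`, where `c ^ 2`
is the Jacobian of the time change; the factor on the initial value combines this amplitude with the
homogeneity of `psi0`. -/
theorem IsVecSolution.dilate {l c : ℝ} (hP : Params N m γ α) (hl : 0 ≤ l) (hc : 0 < c)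
    (hu : IsVecSolution N m γ α a (fun x => l * psi0 N m γ x) S u) :
    IsVecSolution N m γ α a (fun x => c ^ (2 / α - (γ + m)) * l * psi0 N m γ x)
      (S / ENNReal.ofReal (c ^ 2)) fun t => c ^ (2 / α) • dilOp N m hc (u (c ^ 2 * t)) := by
  have hc2 : 0 < c ^ 2 := by positivity
  have hα := hP.α_pos
  have hb0 := boundedByPsi0_psi0 N m hP.pos
  have hψ := hb0.const_mul hl
  have hψ' := hb0.const_mul (by positivity : 0 ≤ c ^ (2 / α - (γ + m)) * l)
  have hlt : ∀ t, ENNReal.ofReal t < S / ENNReal.ofReal (c ^ 2) ↔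
      ENNReal.ofReal (c ^ 2 * t) < S := fun t => by
    rw [ENNReal.lt_div_iff_mul_lt (Or.inl (ENNReal.ofReal_pos.2 hc2).ne')
      (Or.inl ENNReal.ofReal_ne_top), mul_comm, ENNReal.ofReal_mul hc2.le]
  have hexp : c ^ (2 / α) = c ^ (2 / α - (γ + m)) * c ^ (γ + m) := by
    rw [← Real.rpow_add hc, sub_add_cancel]
  have hcont : ContinuousOn (fun t => c ^ (2 / α) • dilOp N m hc (u (c ^ 2 * t)))
      {t | 0 < t ∧ ENNReal.ofReal t < S / ENNReal.ofReal (c ^ 2)} := by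
    have h1 : ContinuousOn (fun t => u (c ^ 2 * t))
        {t | 0 < t ∧ ENNReal.ofReal t < S / ENNReal.ofReal (c ^ 2)} :=
      hu.continuousOn.comp (by fun_prop) fun t ht => ⟨mul_pos hc2 ht.1, (hlt t).1 ht.2⟩
    exact ((dilOp N m hc).continuous.comp_continuousOn h1).const_smul (c ^ (2 / α))
  obtain ⟨τ, k, hτ, hk, hτS, hb⟩ := hu.bound
  have hτ' : 0 < τ / c ^ 2 := by positivity
  have hcτ : c ^ 2 * (τ / c ^ 2) = τ := by field_simp
  have hk' : 0 ≤ c ^ (2 / α - (γ + m)) * k := by positivity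
  have hτS' : ENNReal.ofReal (τ / c ^ 2) < S / ENNReal.ofReal (c ^ 2) := by
    rwa [hlt, hcτ]
  have hbound : ∀ t ∈ Ioc 0 (τ / c ^ 2), ∀ x, |(c ^ (2 / α) • dilOp N m hc (u (c ^ 2 * t))) x| ≤
      c ^ (2 / α - (γ + m)) * k * Psi N m γ t x := by
    intro t ht x
    have h1 := hb (c ^ 2 * t) ⟨mul_pos hc2 ht.1, by rw [← hcτ]; gcongr; exact ht.2⟩ (dil hc x)
    rw [Psi_dil hP.le hc ht.1] at h1
    rw [ZeroAtInftyContinuousMap.smul_apply, smul_eq_mul, dilOp_apply, abs_mul,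
      abs_of_pos (by positivity)]
    refine (mul_le_mul_of_nonneg_left h1 (by positivity)).trans_eq ?_
    have : c ^ (-(γ + m)) * c ^ (γ + m) = 1 := by rw [← Real.rpow_add hc]; simp
    rw [hexp]
    linear_combination c ^ (2 / α - (γ + m)) * k * Psi N m γ t x * this
  refine ⟨hcont, ⟨_, _, hτ', hk', hτS', hbound⟩, fun t ht htS => ?_⟩
  ext x
  have hct : 0 < c ^ 2 * t := mul_pos hc2 ht
  rw [ZeroAtInftyContinuousMap.add_apply, ZeroAtInftyContinuousMap.smul_apply,
    ZeroAtInftyContinuousMap.smul_apply, smul_eq_mul, smul_eq_mul,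
    hψ'.flow_apply hP.toAdmissible ht, duhamel,
    integral_apply (hP.integrableOn hcont hτ' hk' hbound hτS' ht htS), dilOp_apply,
    ((isSolution_iff hP hψ).2 hu).eqn _ hct ((hlt t).1 htS), heat_dil hc ht,
    setIntegral_Ioo_mul_left hc2 ht.le, mul_add]
  congr 1
  · simp_rw [psi0_dil hP.le hc]
    rw [← heat_const_mul]
    congr 1
    ext y
    have : c ^ (2 / α) * c ^ (-(γ + m)) = c ^ (2 / α - (γ + m)) := by
      rw [← Real.rpow_add hc, sub_eq_add_neg]
    linear_combination l * psi0 N m γ y * this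
  · have hpow : (c ^ (2 / α)) ^ (α + 1) = c ^ (2 / α) * c ^ 2 := by
      rw [Real.rpow_add_one (by positivity), ← Real.rpow_mul hc.le, div_mul_cancel₀ _ hα.ne',
        Real.rpow_two, mul_comm]
    rw [mul_left_comm, ← mul_assoc (c ^ (2 / α)), ← hpow, ← integral_const_mul]
    congr 1
    refine setIntegral_congr_fun measurableSet_Ioo fun σ hσ => ?_
    have h1 : 0 < t - σ := sub_pos.2 hσ.2
    rw [← mul_sub, heat_dil hc h1, ← heat_const_mul, heatOp_apply h1]
    congr 1
    ext y
    rw [coe_nl hα, ← nonlin_const_mul hα (by positivity)]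
    rfl

theorem Tmax_const_mul_psi0_le {l c : ℝ} (hP : Params N m γ α) (hl : 0 ≤ l) (hc : 0 < c) :
    Tmax N m γ α a (fun x => l * psi0 N m γ x) ≤ ENNReal.ofReal (c ^ 2) *
      Tmax N m γ α a (fun x => c ^ (2 / α - (γ + m)) * l * psi0 N m γ x) := by
  have hb0 := boundedByPsi0_psi0 N m hP.pos
  refine sSup_le fun S ⟨u, hu⟩ => ?_
  have h := (((isSolution_iff hP (hb0.const_mul hl)).1 hu).dilate hP hl hc).le_Tmax hP
    (hb0.const_mul (by positivity))
  rwa [ENNReal.div_le_iff' (ENNReal.ofReal_pos.2 (by positivity)).ne' ENNReal.ofReal_ne_top] at h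

/-- Dilation turns `psi0` into `l * psi0` when `c ^ (2 * r) = l`, that is `c = l ^ (r⁻¹ / 2)`. The
inverse dilation gives the opposite inequality. -/
theorem Tmax_const_mul_psi0 {l : ℝ} (hP : Params N m γ α) (hl : 0 < l) :
    ENNReal.ofReal (l ^ (1 / α - (γ + m) / 2)⁻¹) * Tmax N m γ α a (fun x => l * psi0 N m γ x) =
      Tmax N m γ α a (psi0 N m γ) := by
  have hα := hP.α_pos
  set r := 1 / α - (γ + m) / 2 with hr
  have hr0 : 0 < r := by
    rw [hr, sub_pos, lt_div_iff₀ hα, mul_comm]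
    exact hP.lt_one
  have h2r : 2 / α - (γ + m) = 2 * r := by rw [hr]; ring
  have h1 := Tmax_const_mul_psi0_le (a := a) (c := l ^ (r⁻¹ / 2)) hP zero_le_one (by positivity)
  have h2 := Tmax_const_mul_psi0_le (a := a) (c := (l ^ (r⁻¹ / 2))⁻¹) hP hl.le (by positivity)
  have hsq : (l ^ (r⁻¹ / 2)) ^ 2 = l ^ r⁻¹ := by
    rw [← Real.rpow_natCast, ← Real.rpow_mul hl.le]; congr 1; push_cast; ring
  have hpow : (l ^ (r⁻¹ / 2)) ^ (2 * r) = l := by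
    rw [← Real.rpow_mul hl.le, show r⁻¹ / 2 * (2 * r) = 1 by field_simp, Real.rpow_one]
  have hq : 0 < l ^ r⁻¹ := by positivity
  rw [h2r, hsq, hpow] at h1
  rw [h2r, inv_pow, hsq, Real.inv_rpow (by positivity), hpow, inv_mul_cancel₀ hl.ne'] at h2
  simp only [one_mul, mul_one] at h1 h2
  refine le_antisymm ?_ h1
  calc _ ≤ ENNReal.ofReal (l ^ r⁻¹) * (ENNReal.ofReal (l ^ r⁻¹)⁻¹ * Tmax N m γ α a (psi0 N m γ)) := by
        gcongr
    _ = _ := by rw [← mul_assoc, ← ENNReal.ofReal_mul hq.le, mul_inv_cancel₀ hq.ne',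
        ENNReal.ofReal_one, one_mul]

end

/-! ### Positivity -/

/-- The negative part. -/
def negPart {N m : ℕ} (f : C₀(sector N m, ℝ)) : C₀(sector N m, ℝ) := toC0 fun x => max (-f x) 0

theorem negPart_apply {N m : ℕ} (f : C₀(sector N m, ℝ)) (x : sector N m) :
    negPart f x = max (-f x) 0 := by
  have hc : Continuous fun r : ℝ => max (-r) 0 := by fun_prop
  refine toC0_apply (f := fun x => max (-f x) 0)
    ⟨⟨⟨fun x => max (-f x) 0, hc.comp (map_continuous f)⟩, ?_⟩, fun x => rfl⟩ x
  have h := (hc.tendsto 0).comp (zero_at_infty f)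
  rw [neg_zero, max_self] at h
  exact h

theorem heatOp_mono {N m : ℕ} (t : ℝ) {f g : C₀(sector N m, ℝ)} (h : ∀ x, f x ≤ g x)
    (x : sector N m) : heatOp N m t f x ≤ heatOp N m t g x := by
  have := heatOp_nonneg t (f := g - f) (fun x => sub_nonneg.2 (h x)) x
  rwa [map_sub, ZeroAtInftyContinuousMap.sub_apply, sub_nonneg] at this

theorem nl_nonneg {N m : ℕ} {α : ℝ} (hα : 0 < α) {u : C₀(sector N m, ℝ)} (hu : ∀ x, 0 ≤ u x)
    (x : sector N m) : 0 ≤ nl α u x := by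
  rw [nl_apply hα]
  exact mul_nonneg (by positivity) (hu x)

section

variable {N m : ℕ} {α : ℝ} {W : ℝ → sector N m → ℝ} {c β k T : ℝ} {u : ℝ → C₀(sector N m, ℝ)}
  {U : ℝ → C₀(sector N m, ℝ)}

theorem IsWeight.neg_le_heatOp (hW : IsWeight W c β) {σ t : ℝ} (hσ : 0 < σ) (hσt : σ ≤ t)
    (hk : 0 ≤ k) {h : C₀(sector N m, ℝ)} (hh : ∀ x, -(k * W σ x) ≤ h x) (x : sector N m) :
    -(k * W t x) ≤ heatOp N m (t - σ) h x := by
  have h1 := hW.heat σ t k hσ hσt hk (negPart h) (fun x => by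
    rw [negPart_apply, abs_of_nonneg (le_max_right _ _)]
    exact max_le (by linarith [hh x]) (mul_nonneg hk (hW.nonneg σ hσ x))) x
  have h2 := heatOp_nonneg (t - σ) (f := h + negPart h) (fun x => by
    rw [ZeroAtInftyContinuousMap.add_apply, negPart_apply]
    linarith [le_max_left (-h x) 0]) x
  rw [map_add, ZeroAtInftyContinuousMap.add_apply] at h2
  linarith [le_abs_self (heatOp N m (t - σ) (negPart h) x)]

/-- A one-sided version of the contraction: if `u ≥ -(θ ^ n * k * W)`, then where `u` is negative
the nonlinearity is bounded below by its Lipschitz constant times this bound, and the equation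
improves `n` to `n + 1`. -/
theorem IsMild.nonneg (hW : IsWeight W c β) (hα : 0 < α) (hαβ : α * β < 1) (hk : 0 ≤ k)
    (hθ : (α + 1) * k ^ α * (c ^ α * (T ^ (1 - α * β) / (1 - α * β))) < 1)
    (hU : ∀ t ∈ Ioo 0 T, ∀ x, 0 ≤ U t x) (hu : IsMild α 1 W U T k u) :
    ∀ t ∈ Ioo 0 T, ∀ x, 0 ≤ u t x := by
  intro t₀ ht₀ x₀
  have hT : 0 < T := ht₀.1.trans ht₀.2
  set θ := (α + 1) * k ^ α * (c ^ α * (T ^ (1 - α * β) / (1 - α * β))) with hθd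
  have hcn := hW.const_nonneg
  have h1 : 0 < 1 - α * β := by linarith
  have hθ0 : 0 ≤ θ := by positivity
  have key : ∀ n : ℕ, ∀ t ∈ Ioo 0 T, ∀ x, -(θ ^ n * k * W t x) ≤ u t x := by
    intro n
    induction n with
    | zero =>
      intro t ht x
      rw [pow_zero, one_mul]
      exact (abs_le.1 (hu.bound t ht x)).1
    | succ n ih =>
      intro t ht x
      set B := (α + 1) * (k ^ α * c ^ α) * (θ ^ n * k) with hB
      have hB0 : 0 ≤ B := by positivity
      have hWt := hW.nonneg t ht.1 x
      have hnl : ∀ σ ∈ Ioo 0 t, ∀ y, -(B * σ ^ (-(α * β)) * W σ y) ≤ nl α (u σ) y := by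
        intro σ hσ y
        have hσT : σ ∈ Ioo 0 T := ⟨hσ.1, hσ.2.trans ht.2⟩
        have hWσ := hW.nonneg σ hσ.1 y
        have hσp : 0 ≤ σ ^ (-(α * β)) := Real.rpow_nonneg hσ.1.le _
        rw [nl_apply hα]
        rcases le_or_gt 0 (u σ y) with h0 | h0
        · have h2 : 0 ≤ |u σ y| ^ α * u σ y := mul_nonneg (by positivity) h0
          have h3 : 0 ≤ B * σ ^ (-(α * β)) * W σ y := by positivity
          linarith
        · have h2 : |u σ y| ^ α ≤ (α + 1) * (k ^ α * c ^ α) * σ ^ (-(α * β)) := by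
            have h3 : |u σ y| ^ α ≤ (k * W σ y) ^ α := by
              gcongr
              exact hu.bound σ hσT y
            have h4 : 0 ≤ k ^ α * c ^ α * σ ^ (-(α * β)) := by positivity
            have := hW.mul_rpow_le hα hk hσ.1 y
            nlinarith
          have h5 := mul_le_mul h2 (neg_le.1 (ih σ hσT y)) (neg_nonneg.2 h0.le) (by positivity)
          have h6 : (α + 1) * (k ^ α * c ^ α) * σ ^ (-(α * β)) * (θ ^ n * k * W σ y) =
            B * σ ^ (-(α * β)) * W σ y := by rw [hB]; ring
          linarith
      have hi := hW.integrableOn_nl hα hαβ hk hu.cont hu.bound ht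
      have hduh : -(B * (t ^ (1 - α * β) / (1 - α * β)) * W t x) ≤
          duhamel (fun σ => nl α (u σ)) t x := by
        rw [duhamel, integral_apply hi, ← integral_rpow_Ioo hαβ ht.1, ← integral_const_mul,
          ← integral_mul_const, ← integral_neg]
        refine setIntegral_mono_on
          (((integrableOn_rpow_Ioo hαβ ht.1).const_mul B).mul_const (W t x)).neg
          ((evalCLM x).integrable_comp hi) measurableSet_Ioo fun σ hσ => ?_
        exact hW.neg_le_heatOp hσ.1 hσ.2.le (mul_nonneg hB0 (Real.rpow_nonneg hσ.1.le _))
          (hnl σ hσ) x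
      have h7 : B * (t ^ (1 - α * β) / (1 - α * β)) * W t x ≤ θ ^ (n + 1) * k * W t x := by
        refine mul_le_mul_of_nonneg_right ?_ hWt
        calc B * (t ^ (1 - α * β) / (1 - α * β)) ≤ B * (T ^ (1 - α * β) / (1 - α * β)) := by
              have := ht.1
              gcongr
              exact ht.2.le
          _ = θ ^ (n + 1) * k := by rw [hB, pow_succ, hθd]; ring
      have h8 := hU t ht x
      rw [hu.eqn t ht, one_smul, ZeroAtInftyContinuousMap.add_apply]
      linarith
  have hlim : Tendsto (fun n : ℕ => -(θ ^ n * k * W t₀ x₀)) atTop (𝓝 0) := by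
    have := (((tendsto_pow_atTop_nhds_zero_of_lt_one hθ0 hθ).mul_const k).mul_const (W t₀ x₀)).neg
    simpa using this
  exact le_of_tendsto' hlim fun n => key n t₀ ht₀ x₀

end

section

variable {N m : ℕ} {γ α : ℝ} {ψ : sector N m → ℝ} {S : ℝ≥0∞} {u : ℝ → C₀(sector N m, ℝ)}

/-- Near `0` the weight `Psi` applies. Afterwards the set of times at which `u ≥ 0` is closed, and a
restart from such a time in the weight `1` shows that it extends to the right. -/
theorem IsVecSolution.nonneg {k₀ : ℝ} (hP : Params N m γ α) (hψ : BoundedByPsi0 N m γ k₀ ψ)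
    (hψ0 : ∀ t, 0 < t → ∀ x, 0 ≤ flow N m ψ t x) (hu : IsVecSolution N m γ α 1 ψ S u) {t : ℝ}
    (ht : 0 < t) (htS : ENNReal.ofReal t < S) (x : sector N m) : 0 ≤ u t x := by
  obtain ⟨τ₁, k, hτ₁, hk, hS₁, hb⟩ := hu.bound
  have hκ : 0 < 1 - α * ((γ + m) / 2) := by linarith [hP.lt_one]
  set c := ‖flow N m (psi0 N m γ) 1‖ with hc
  obtain ⟨δ, hδ, hd⟩ := exists_pos_forall_mul_rpow_lt
    ((α + 1) * k ^ α * (c ^ α / (1 - α * ((γ + m) / 2)))) hκ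
  set τ := min δ τ₁ with hτ
  have hτ0 : 0 < τ := lt_min hδ hτ₁
  have hτ1 : τ ≤ τ₁ := min_le_right _ _
  have hnear : ∀ s ∈ Ioo 0 τ, ∀ x, 0 ≤ u s x := by
    refine IsMild.nonneg (isWeight_Psi hP.toAdmissible) hP.α_pos hP.lt_one hk ?_
      (fun s hs => hψ0 s hs.1)
      (hu.isMild (ofReal_lt_of_le hτ1 hS₁) fun s hs => hb s ⟨hs.1, hs.2.trans hτ1⟩)
    refine lt_of_eq_of_lt ?_ (hd τ hτ0 (min_le_left _ _))
    ring
  rcases lt_or_ge t τ with h | h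
  · exact hnear t ⟨ht, h⟩ x
  obtain ⟨R, hR0, hR⟩ := hu.exists_norm_le (half_pos hτ0) htS
  obtain ⟨δ', hδ', hd'⟩ := exists_contraction_time α R
  have hcont : ContinuousOn u (Icc (τ / 2) t) := hu.continuousOn.mono fun s hs =>
    ⟨(half_pos hτ0).trans_le hs.1, ofReal_lt_of_le hs.2 htS⟩
  have hcl : IsClosed ({s | ∀ x, 0 ≤ u s x} ∩ Icc (τ / 2) t) := by
    have h1 : {s | ∀ x, 0 ≤ u s x} ∩ Icc (τ / 2) t =
        Icc (τ / 2) t ∩ u ⁻¹' ⋂ x, (evalCLM x) ⁻¹' Ici 0 := by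
      ext s
      simp [evalCLM_apply, and_comm]
    rw [h1]
    exact hcont.preimage_isClosed_of_isClosed isClosed_Icc
      (isClosed_iInter fun x => isClosed_Ici.preimage (evalCLM x).continuous)
  refine hcl.Icc_subset_of_forall_exists_gt (hnear _ ⟨half_pos hτ0, half_lt_self hτ0⟩)
    (fun s hs y (hy : s < y) => ?_) ⟨by linarith, le_rfl⟩ x
  obtain ⟨hs1, hs2⟩ := hs
  have hT0 : 0 < min δ' (t - s) := lt_min hδ' (by linarith [hs2.2])
  have hmild := hu.isMild_restart hP hψ ((half_pos hτ0).trans_le hs2.1) htS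
    (fun r hr => hR r ⟨hs2.1.trans hr.1, hr.2⟩) (T := min δ' (t - s))
    (by linarith [min_le_right δ' (t - s)])
  have hpos := IsMild.nonneg (isWeight_one N m) hP.α_pos (by simp) hR0.le
    (hd' _ hT0 (min_le_left _ _)) (fun r _ => heatOp_nonneg r hs1) hmild
  set r := min (min δ' (t - s)) (y - s) / 2 with hr
  have hm : 0 < min (min δ' (t - s)) (y - s) := lt_min hT0 (by linarith)
  have hr0 : 0 < r := half_pos hm
  have hr1 : r < min δ' (t - s) := (half_lt_self hm).trans_le (min_le_left _ _)
  have hr2 : r < y - s := (half_lt_self hm).trans_le (min_le_right _ _)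
  exact ⟨s + r, hpos r ⟨hr0, hr1⟩, by linarith, by linarith⟩

/-! ### Blow-up -/

/-- The graph of the convex function `r ^ (α + 1)` lies above its tangent at `A`; this is
Bernoulli's inequality for `r / A`. -/
theorem tangent_le_rpow {α A r : ℝ} (hα : 0 < α) (hA : 0 ≤ A) (hr : 0 ≤ r) :
    (α + 1) * A ^ α * r - α * A ^ (α + 1) ≤ r ^ (α + 1) := by
  rcases hA.eq_or_lt with rfl | hA
  · rw [Real.zero_rpow hα.ne', Real.zero_rpow (by linarith)]
    simp only [mul_zero, zero_mul, sub_zero]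
    positivity
  have h := one_add_mul_self_le_rpow_one_add (s := r / A - 1) (p := α + 1)
    (by linarith [div_nonneg hr hA.le]) (by linarith)
  rw [add_sub_cancel, Real.div_rpow hr hA.le, le_div_iff₀ (by positivity)] at h
  refine le_trans (le_of_eq ?_) h
  rw [Real.rpow_add_one hA.ne']
  field_simp
  ring

/-- Jensen's inequality: the tangent at the average `A` is integrated against the kernel. Total mass
below `1` does no harm, because the constant term of the tangent is nonpositive. -/
theorem rpow_heatOp_le (hα : 0 < α) (t : ℝ) {v : C₀(sector N m, ℝ)} (hv : ∀ x, 0 ≤ v x)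
    (x : sector N m) : heatOp N m t v x ^ (α + 1) ≤ heatOp N m t (nl α v) x := by
  have hnl : ∀ y, nl α v y = v y ^ (α + 1) := fun y => by
    rw [nl_apply hα, abs_of_nonneg (hv y), Real.rpow_add_one' (hv y) (by linarith)]
  rcases le_or_gt t 0 with ht | ht
  · rw [heatOp_of_nonpos ht, heatOp_of_nonpos ht, hnl]
  set A := heatOp N m t v x with hA
  have hA0 : 0 ≤ A := heatOp_nonneg t hv x
  have hx := sector_subset_closedSector N m x.2
  have hi1 := (integrable_kernel_mul ht v x).const_mul ((α + 1) * A ^ α)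
  have hi2 := (integrable_kernel ht hx).const_mul (α * A ^ (α + 1))
  have h1 : (α + 1) * A ^ α * A - α * A ^ (α + 1) * ∫ y : sector N m, kernel N m t x y ≤
      heatOp N m t (nl α v) x := by
    rw [heatOp_apply ht (nl α v), heat]
    nth_rewrite 2 [hA]
    rw [heatOp_apply ht, heat, ← integral_const_mul, ← integral_const_mul, ← integral_sub hi1 hi2]
    refine integral_mono (hi1.sub hi2) (integrable_kernel_mul ht (nl α v) x) fun y => ?_
    have := mul_le_mul_of_nonneg_left (tangent_le_rpow hα hA0 (hv y)) (kernel_coe_nonneg ht x y)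
    simp only [hnl]
    linarith
  have h2 := mul_le_mul_of_nonneg_left (integral_kernel_le_one ht hx)
    (by positivity : 0 ≤ α * A ^ (α + 1))
  have h3 : A ^ (α + 1) = A ^ α * A := Real.rpow_add_one' hA0 (by linarith)
  rw [h3] at h1 h2 ⊢
  nlinarith

/-- The inequality `g' ≥ g ^ (α + 1)` makes `g ^ (-α) + α * r` nonincreasing, and `g ^ (-α)` stays
nonnegative, so `L` is bounded by the initial value. -/
theorem mul_le_rpow_neg_of_rpow_le {g q : ℝ → ℝ} {A L : ℝ} (hα : 0 < α) (hA : 0 < A) (hL : 0 ≤ L)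
    (hq : ContinuousOn q (Icc 0 L)) (hg : ∀ r ∈ Icc 0 L, g r = g 0 + ∫ σ in (0 : ℝ)..r, q σ)
    (hg0 : A ≤ g 0) (hpos : ∀ r ∈ Icc 0 L, 0 ≤ g r)
    (hqg : ∀ r ∈ Icc 0 L, g r ^ (α + 1) ≤ q r) : α * L ≤ A ^ (-α) := by
  have hq0 : ∀ r ∈ Icc 0 L, 0 ≤ q r := fun r hr =>
    (Real.rpow_nonneg (hpos r hr) _).trans (hqg r hr)
  have hgA : ∀ r ∈ Icc 0 L, A ≤ g r := by
    intro r hr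
    rw [hg r hr]
    have := intervalIntegral.integral_nonneg (μ := volume) hr.1 fun σ hσ =>
      hq0 σ ⟨hσ.1, hσ.2.trans hr.2⟩
    linarith
  have hder : ∀ r ∈ Ioo 0 L, HasDerivAt g (q r) r := by
    intro r hr
    have h1 : HasDerivAt (fun r => g 0 + ∫ σ in (0 : ℝ)..r, q σ) (q r) r := by
      refine (intervalIntegral.integral_hasDerivAt_right ?_ ?_ ?_).const_add _
      · refine ContinuousOn.intervalIntegrable ?_
        rw [uIcc_of_le hr.1.le]
        exact hq.mono (Icc_subset_Icc_right hr.2.le)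
      · exact (hq.mono Ioo_subset_Icc_self).stronglyMeasurableAtFilter isOpen_Ioo r hr
      · exact hq.continuousAt (Icc_mem_nhds hr.1 hr.2)
    refine h1.congr_of_eventuallyEq ?_
    filter_upwards [Ioo_mem_nhds hr.1 hr.2] with s hs
    exact hg s ⟨hs.1.le, hs.2.le⟩
  have hgc : ContinuousOn g (Icc 0 L) := by
    have h1 : ContinuousOn (fun r => g 0 + ∫ σ in (0 : ℝ)..r, q σ) (Icc 0 L) := by
      refine continuousOn_const.add ?_
      have := intervalIntegral.continuousOn_primitive_interval (μ := volume) (f := q) (a := 0)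
        (b := L) (by rw [uIcc_of_le hL]; exact hq.integrableOn_Icc)
      rwa [uIcc_of_le hL] at this
    exact h1.congr hg
  have hder2 : ∀ r ∈ Ioo 0 L, HasDerivAt (fun r => g r ^ (-α) + α * r)
      (q r * -α * g r ^ (-α - 1) + α * 1) r := fun r hr =>
    ((hder r hr).rpow_const (Or.inl (hA.trans_le (hgA r ⟨hr.1.le, hr.2.le⟩)).ne')).add
      ((hasDerivAt_id r).const_mul α)
  have hanti : AntitoneOn (fun r => g r ^ (-α) + α * r) (Icc 0 L) := by
    refine antitoneOn_of_deriv_nonpos (convex_Icc 0 L) ?_ ?_ ?_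
    · exact (hgc.rpow_const fun r hr => Or.inl (hA.trans_le (hgA r hr)).ne').add (by fun_prop)
    · rw [interior_Icc]
      exact fun r hr => (hder2 r hr).differentiableAt.differentiableWithinAt
    · rw [interior_Icc]
      intro r hr
      have hr' : r ∈ Icc 0 L := ⟨hr.1.le, hr.2.le⟩
      have hgr := hA.trans_le (hgA r hr')
      rw [(hder2 r hr).deriv]
      have h1 := mul_le_mul_of_nonneg_right (hqg r hr') (Real.rpow_nonneg hgr.le (-α - 1))
      rw [← Real.rpow_add hgr, show α + 1 + (-α - 1) = 0 by ring, Real.rpow_zero] at h1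
      nlinarith
  have h1 := hanti ⟨le_rfl, hL⟩ ⟨hL, le_rfl⟩ hL
  simp only [mul_zero, add_zero] at h1
  have h2 := Real.rpow_nonneg (hpos L ⟨hL, le_rfl⟩) (-α)
  have h3 : g 0 ^ (-α) ≤ A ^ (-α) := Real.rpow_le_rpow_of_nonpos hA hg0 (by linarith)
  linarith

theorem IsVecSolution.mul_le_rpow_neg {k₀ : ℝ} (hP : Params N m γ α)
    (hψ : BoundedByPsi0 N m γ k₀ ψ) (hψ0 : ∀ t, 0 < t → ∀ x, 0 ≤ flow N m ψ t x)
    (hu : IsVecSolution N m γ α 1 ψ S u) {t : ℝ} (ht : 0 < t) (htS : ENNReal.ofReal t < S)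
    {x : sector N m} (hx : 0 < flow N m ψ t x) : α * t ≤ flow N m ψ t x ^ (-α) := by
  have hα := hP.α_pos
  have hnn := fun s hs hsS => hu.nonneg hP hψ hψ0 (t := s) hs hsS
  -- There is no value of `u` in `C₀` at time `0`, so the argument starts at `ε`. Since `u ε`
  -- dominates the linear flow at `ε`, the initial value of `g` is at least the flow at `t`,
  -- independently of `ε`.
  have key : ∀ ε ∈ Ioo 0 t, α * (t - ε) ≤ flow N m ψ t x ^ (-α) := by
    intro ε hε
    have hmem : ∀ r ∈ Icc 0 (t - ε), 0 < ε + r ∧ ENNReal.ofReal (ε + r) < S := fun r hr =>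
      ⟨by linarith [hε.1, hr.1], ofReal_lt_of_le (by linarith [hr.2]) htS⟩
    have huc : ContinuousOn (fun r => u (ε + r)) (Icc 0 (t - ε)) :=
      hu.continuousOn.comp (by fun_prop) hmem
    have hqc : ContinuousOn (fun σ => heatOp N m (t - ε - σ) (nl α (u (ε + σ)))) (Icc 0 (t - ε)) :=
      continuousOn_heatOp_comp ((continuous_nl hα).comp_continuousOn huc) _
    refine mul_le_rpow_neg_of_rpow_le (g := fun r => heatOp N m (t - ε - r) (u (ε + r)) x)
      (q := fun σ => heatOp N m (t - ε - σ) (nl α (u (ε + σ))) x) hα hx (by linarith [hε.2])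
      ((evalCLM x).continuous.comp_continuousOn hqc) (fun r hr => ?_) ?_
      (fun r hr => heatOp_nonneg _ (hnn _ (hmem r hr).1 (hmem r hr).2) x)
      fun r hr => rpow_heatOp_le hα _ (hnn _ (hmem r hr).1 (hmem r hr).2) x
    · have hi : IntegrableOn (fun σ => heatOp N m (r - σ) (nl α (u (ε + σ)))) (Ioo 0 r) :=
        ((continuousOn_heatOp_comp ((continuous_nl hα).comp_continuousOn
          (huc.mono (Icc_subset_Icc_right hr.2))) r).integrableOn_Icc).mono_set Ioo_subset_Icc_self
      have hi2 : IntegrableOn (fun σ => heatOp N m (t - ε - r) (heatOp N m (r - σ)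
          (nl α (u (ε + σ))))) (Ioo 0 r) := (heatOp N m (t - ε - r)).integrable_comp hi
      rw [hu.restart hP hψ hε.1 hr.1 (hmem r hr).2, one_smul, map_add,
        heatOp_heatOp (by linarith [hr.2]) hr.1, duhamel,
        ← (heatOp N m (t - ε - r)).integral_comp_comm hi,
        ZeroAtInftyContinuousMap.add_apply, integral_apply hi2, sub_add_cancel, sub_zero, add_zero,
        intervalIntegral.integral_of_le hr.1, integral_Ioc_eq_integral_Ioo]
      congr 1
      refine setIntegral_congr_fun measurableSet_Ioo fun σ hσ => ?_
      rw [heatOp_heatOp (by linarith [hr.2]) (by linarith [hσ.2])]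
      congr 3
      ring
    · have hεS : ENNReal.ofReal ε < S := ofReal_lt_of_le hε.2.le htS
      have h1 : ∀ y, flow N m ψ ε y ≤ u ε y := by
        intro y
        rw [hu.eqn ε hε.1 hεS, one_smul, ZeroAtInftyContinuousMap.add_apply, duhamel,
          integral_apply (hu.integrableOn hP hε.1 hεS)]
        refine le_add_of_nonneg_right (setIntegral_nonneg measurableSet_Ioo fun σ hσ => ?_)
        exact heatOp_nonneg _ (nl_nonneg hα
          (hnn σ hσ.1 (ofReal_lt_of_le (hσ.2.le.trans hε.2.le) htS))) y
      have h2 := heatOp_mono (t - ε) h1 x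
      rw [hψ.heatOp_flow hP.toAdmissible (by linarith [hε.2]) hε.1, sub_add_cancel] at h2
      simpa using h2
  have hlim : Tendsto (fun ε => α * (t - ε)) (𝓝[>] 0) (𝓝 (α * t)) := by
    have : Continuous fun ε : ℝ => α * (t - ε) := by fun_prop
    simpa using (this.tendsto 0).mono_left nhdsWithin_le_nhds
  refine le_of_tendsto hlim ?_
  filter_upwards [Ioo_mem_nhdsGT ht] with ε hε
  exact key ε hε

theorem Tmax_psi0_lt_top (hP : Params N m γ α) : Tmax N m γ α 1 (psi0 N m γ) < ⊤ := by
  have hψ := boundedByPsi0_psi0 N m hP.pos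
  have hα := hP.α_pos
  have hκ : 0 < 1 - α * ((γ + m) / 2) := by linarith [hP.lt_one]
  obtain ⟨x₁⟩ := nonempty_sector N m
  set p := Psi N m γ 1 x₁ with hp
  have hp0 : 0 < p := Psi_pos hP.toAdmissible one_pos x₁
  set B := (p ^ (-α) / α) ^ (1 - α * ((γ + m) / 2))⁻¹ with hB
  have hflow : ∀ t, 0 < t → ∀ x, 0 < flow N m (psi0 N m γ) t x := fun t ht x => by
    rw [flow_psi0_apply hP.toAdmissible ht]; exact Psi_pos hP.toAdmissible ht x
  suffices Tmax N m γ α 1 (psi0 N m γ) ≤ ENNReal.ofReal B from this.trans_lt ENNReal.ofReal_lt_top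
  refine sSup_le fun S ⟨u, hu⟩ => ?_
  rw [isSolution_iff hP hψ] at hu
  by_contra! hS
  obtain ⟨t, hBt, htS⟩ := exists_real_gt_of_ofReal_lt (by positivity) hS
  have hB0 : 0 ≤ B := by positivity
  have ht : 0 < t := hB0.trans_lt hBt
  -- Evaluation at the self-similar point `√t x₁` makes the right side an explicit power of `t`, of
  -- exponent less than `1`.
  have h := hu.mul_le_rpow_neg hP hψ (fun t ht x => (hflow t ht x).le) ht htS
    (hflow t ht (dil (Real.sqrt_pos.2 ht) x₁))
  rw [flow_psi0_apply hP.toAdmissible ht, Psi_sqrt hP.le ht, ← hp,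
    Real.mul_rpow (by positivity) hp0.le, ← Real.rpow_mul ht.le] at h
  have h1 : t ^ (1 - α * ((γ + m) / 2)) ≤ p ^ (-α) / α := by
    rw [Real.rpow_sub ht, Real.rpow_one, div_le_iff₀ (by positivity), div_mul_eq_mul_div,
      le_div_iff₀ hα, mul_comm, mul_comm (p ^ (-α))]
    refine h.trans_eq ?_
    congr 2
    ring
  have h2 : t ≤ B := by
    rw [hB, ← Real.rpow_rpow_inv ht.le hκ.ne']
    gcongr
  linarith

end

end SectorHeat

end

/-! ### Assembly of the theorem. -/

open SectorHeat
theorem mainTheorem10 (N m : ℕ) (γ α : ℝ) (hm : m ≤ N) (hγ : 0 < γ) (hγN : γ < N)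
    (hα : 0 < α) (hα' : α < 2 / (γ + m))
    (K M T : ℝ) (hK : 0 < K) (hM : 0 < M) (hT : 0 < T)
    (hKMT : ENNReal.ofReal K +
      ENNReal.ofReal (2 * (α + 1) * M ^ (α + 1)) * PsiIntegral N m γ α T ≤ ENNReal.ofReal M)
    (hMT : ENNReal.ofReal (2 * (α + 1) * M ^ α) * PsiIntegral N m γ α T < 1)
    (a : ℝ) (ha : a = 1 ∨ a = -1)
    (ψ : sector N m → ℝ) (hψ : ψ ∈ ball N m γ K) :
    -- the solution in the ball of radius `M` on `(0, T]` extends to a unique maximal solution,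
    -- whose existence time is `Tmax`
    (∃ u, IsMaximalSolution N m γ α a ψ (Tmax N m γ α a ψ) u ∧
      ENNReal.ofReal T < Tmax N m γ α a ψ ∧
      ∀ t ∈ Set.Ioc 0 T, ∀ x, |u t x| ≤ M * Psi N m γ t x) ∧
    (a = -1 → Tmax N m γ α a ψ = ⊤) ∧
    (a = 1 → ∃ c : ℝ, 0 < c ∧ ∀ l : ℝ, 0 < l →
      ENNReal.ofReal c <
        ENNReal.ofReal (l ^ (1 / α - (γ + m) / 2)⁻¹) * Tmax N m γ α a (fun x => l * ψ x)) ∧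
    (a = 1 → Tmax N m γ α a (psi0 N m γ) < ⊤ ∧ ∀ l : ℝ, 0 < l →
      ENNReal.ofReal (l ^ (1 / α - (γ + m) / 2)⁻¹) *
        Tmax N m γ α a (fun x => l * psi0 N m γ x) = Tmax N m γ α a (psi0 N m γ)) := by
  have hm' : 0 < γ + m := by positivity
  have hlt : α * ((γ + m) / 2) < 1 := by
    rw [lt_div_iff₀ hm'] at hα'
    linarith
  have hP : Params N m γ α := ⟨⟨hm, hγ, hγN⟩, hα, hlt⟩
  have habs : |a| ≤ 1 := by rcases ha with rfl | rfl <;> simp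
  have hψb := boundedByPsi0_of_mem_ball hγ hγN hK.le hψ
  have hI : 0 ≤ ‖flow N m (psi0 N m γ) 1‖ ^ α *
      (T ^ (1 - α * ((γ + m) / 2)) / (1 - α * ((γ + m) / 2))) := by
    have : 0 < 1 - α * ((γ + m) / 2) := by linarith
    positivity
  -- The closed form of the time integral is finite, so both hypotheses become inequalities between
  -- real numbers.
  rw [PsiIntegral_eq hP.toAdmissible hα hlt hT, ← ENNReal.ofReal_mul (by positivity)] at hKMT hMT
  rw [← ENNReal.ofReal_add hK.le (by positivity), ENNReal.ofReal_le_ofReal_iff hM.le] at hKMT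
  rw [← ENNReal.ofReal_one, ENNReal.ofReal_lt_ofReal_iff one_pos] at hMT
  obtain ⟨T', hTT', v, hv⟩ := hψb.exists_solution hP habs hM hT hKMT hMT
  have hvs := hv.isVecSolution (hT.trans hTT') hM.le
  obtain ⟨u, hu, hmax⟩ := exists_maximal_of_exists hP hψb habs ⟨_, v, hvs⟩
  have hTS : ENNReal.ofReal T < ENNReal.ofReal T' :=
    (ENNReal.ofReal_lt_ofReal_iff (hT.trans hTT')).2 hTT'
  refine ⟨⟨u, hmax, hTS.trans_le (hvs.le_Tmax hP hψb), fun t ht x => ?_⟩, ?_, ?_, ?_⟩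
  · rw [← hmax.eq_of_solution _ v ((isSolution_iff hP hψb).2 hvs) t ht.1
      ((ENNReal.ofReal_le_ofReal ht.2).trans_lt hTS)]
    exact hv.bound t ⟨ht.1, ht.2.trans_lt hTT'⟩ x
  · rintro rfl
    exact Tmax_eq_top_of_neg_one hP hψb hu
  · intro _
    exact exists_lt_Tmax_const_mul hP hψb hK habs
  · rintro rfl
    exact ⟨Tmax_psi0_lt_top hP, fun l hl => Tmax_const_mul_psi0 hP hl⟩
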